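/- Let $1\le k<n$. Let $\Gamma_n$ be the quiver with vertices $\mathbb Z/n$ and, for each $i\in\mathbb Z/n=\{1,\dots,n\}$, arrows $x_i:i-1\to i$ and $y_i:i\to i-1$. Let $B=B_{k,n}$ be the completed path algebra of $\Gamma_n$ over $\mathbb C$ modulo the relations $xy=yx$ and $x^k=y^{n-k}$ at every vertex; its centre is $Z=\mathbb C[[t]]$ with $t=\sum_i x_iy_i$. Let ${\rm CM}(B_{k,n})$ be the category of $B$-modules that are free of finite rank over $Z$; such a module has rank $r$ if $e_iM$ is free of rank $r$ over $Z$ for every vertex $i$. For a $k$-subset $I\subset\{1,\dots,n\}$, $L_I$ is the rank $1$ module with $\mathbb C[[t]]$ at every vertex, where $x_i$ acts as $1$ if $i\in I$ and as $t$ if $i\notin I$, and $y_i$ acts as $t$ if $i\in I$ and as $1$ if $i\notin I$. A rank $2$ module $M$ has profile $I\mid J$ if there is an exact sequence $0\to L_J\to M\to L_I\to 0$. The rim of a $k$-subset $I$ is the lattice path over the vertices $0,1,\dots,n$ which goes half a step down between $i-1$ and $i$ if $i\in I$ and half a step up if $i\notin I$. Given $I\mid J$, draw the rim of $J$ below that of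 $I$, as far up as possible so that no part of it lies strictly above the rim of $I$. The boxes of $I\mid J$ are the regions enclosed between the two rims from one meeting point to the next (the vertices $0$ and $n$ being identified). If there are $r_1$ boxes, one says that the poset of $I\mid J$ is $1^{r_1}\mid 2$. The sets $I$ and $J$ are almost tightly $3$-interlacing if, for some $r\ge 0$, $I\setminus J=\{a_1,a_2,a_3,\dots,a_{3+r}\}$ and $J\setminus I=\{b_1,b_2,b_3,\dots,b_{3+r}\}$ with $b_1<a_1<b_2<a_2<b_3<\dots<b_{3+r}<a_3<\dots<a_{3+r}$ in the cyclic order; that is, after removal of the common elements of $I,J$ and of their complements, there are three square boxes, at least two of them of size $1$. Theorem. Let $M\in{\rm CM}(B_{k,n})$ be an indecomposable module of rank $2$. Then $M$ has a profile $I\mid J$ with at least three boxes. For every profile $I\mid J$ of $M$ with at least three boxes, $M$ is uniquely determined by this profile (that is, every indecomposable rank $2$ module in ${\rm CM}(B_{k,n})$ with profile $I\mid J$ is isomorphic to $M$) if and only if the poset of $I\mid J$ is $1^3\mid 2$ and $I$ and $J$ are almost tightly $3$-interlacing. -/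

import Mathlib

open scoped PowerSeries

universe u

namespace GrCat

/-- The generators of `B_{k,n}`: trivial paths `e i` at the vertices `i ∈ ℤ/n`, and for every edge
`i ∈ ℤ/n` (joining the vertices `i - 1` and `i`) the arrows `x i : i - 1 → i`, `y i : i → i - 1`.
The labels `1, …, n` are read modulo `n`, so that the label `n` is `0 : ZMod n`. -/
inductive Gen (n : ℕ) : Type
  | e (i : ZMod n) : Gen n
  | x (i : ZMod n) : Gen n
  | y (i : ZMod n) : Gen n

/-- The free algebra over `Z = ℂ⟦t⟧` on the generators. -/
abbrev Free (n : ℕ) : Type := FreeAlgebra ℂ⟦X⟧ (Gen n)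

noncomputable abbrev fe {n : ℕ} (i : ZMod n) : Free n := FreeAlgebra.ι ℂ⟦X⟧ (Gen.e i)
noncomputable abbrev fx {n : ℕ} (i : ZMod n) : Free n := FreeAlgebra.ι ℂ⟦X⟧ (Gen.x i)
noncomputable abbrev fy {n : ℕ} (i : ZMod n) : Free n := FreeAlgebra.ι ℂ⟦X⟧ (Gen.y i)

/-- The defining relations of `B_{k,n}`: those of the path algebra of the double quiver (paths are
composed from right to left, as for left modules), the relations `xy = yx` and `x^k = y^(n-k)` at
every vertex, and the identification of the formal variable `t` with `∑ x_i y_i`. -/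
inductive Rel (k n : ℕ) [NeZero n] : Free n → Free n → Prop
  | e_mul_self (i : ZMod n) : Rel k n (fe i * fe i) (fe i)
  | e_mul_ne (i j : ZMod n) (h : i ≠ j) : Rel k n (fe i * fe j) 0
  | e_sum : Rel k n (∑ i, fe i) 1
  | x_path (i : ZMod n) : Rel k n (fe i * fx i * fe (i - 1)) (fx i)
  | y_path (i : ZMod n) : Rel k n (fe (i - 1) * fy i * fe i) (fy i)
  | comm (i : ZMod n) : Rel k n (fx i * fy i) (fy (i + 1) * fx (i + 1))
  | pow : Rel k n ((∑ i, fx i) ^ k) ((∑ i, fy i) ^ (n - k))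
  | center : Rel k n (∑ i, fx i * fy i) (algebraMap ℂ⟦X⟧ (Free n) PowerSeries.X)

/-- The algebra `B_{k,n}`, as an algebra over `Z = ℂ⟦t⟧`, `t = ∑ x_i y_i`. The quotient of the
uncompleted path algebra by the relations `xy = yx`, `x^k = y^(n-k)` is a free `ℂ[t]`-module of
finite rank in which the ideal `(t)` and the arrow ideal define the same topology, so extending its
scalars from `ℂ[t]` to `ℂ⟦t⟧`, as is done here, is completing it at the arrow ideal. -/
abbrev B (k n : ℕ) [NeZero n] : Type := RingQuot (Rel k n)

/-- The idempotent of `B_{k,n}` at the vertex `i`. -/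
noncomputable def idem (k n : ℕ) [NeZero n] (i : ZMod n) : B k n := RingQuot.mkAlgHom ℂ⟦X⟧ (Rel k n) (fe i)

/-! ### Rank one modules -/

/-- The `k`-subsets of `{1, …, n}` (read modulo `n`). -/
abbrev KSubset (k n : ℕ) : Type := {I : Finset (ZMod n) // I.card = k}

section RankOne

variable {k n : ℕ}

/-- The factor by which `x_i` acts on `L_I`. -/
noncomputable def xCoeff (I : KSubset k n) (i : ZMod n) : ℂ⟦X⟧ :=
  if i ∈ I.1 then 1 else PowerSeries.X

/-- The factor by which `y_i` acts on `L_I`. -/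
noncomputable def yCoeff (I : KSubset k n) (i : ZMod n) : ℂ⟦X⟧ :=
  if i ∈ I.1 then PowerSeries.X else 1

/-- The actions of the generators on `⨁ U_i`, `U_i = ℂ⟦t⟧`. -/
noncomputable def genAct (I : KSubset k n) : Gen n → Module.End ℂ⟦X⟧ (ZMod n → ℂ⟦X⟧)
  | .e i => LinearMap.single ℂ⟦X⟧ (fun _ => ℂ⟦X⟧) i ∘ₗ LinearMap.proj i
  | .x i => xCoeff I i • (LinearMap.single ℂ⟦X⟧ (fun _ => ℂ⟦X⟧) i ∘ₗ LinearMap.proj (i - 1))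
  | .y i => yCoeff I i • (LinearMap.single ℂ⟦X⟧ (fun _ => ℂ⟦X⟧) (i - 1) ∘ₗ LinearMap.proj i)

theorem genAct_e (I : KSubset k n) (i : ZMod n) (v : ZMod n → ℂ⟦X⟧) :
    genAct I (.e i) v = Pi.single i (v i) := rfl

theorem genAct_x (I : KSubset k n) (i : ZMod n) (v : ZMod n → ℂ⟦X⟧) :
    genAct I (.x i) v = Pi.single i (xCoeff I i * v (i - 1)) := by
  simp [genAct, ← Pi.single_smul]

theorem genAct_y (I : KSubset k n) (i : ZMod n) (v : ZMod n → ℂ⟦X⟧) :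
    genAct I (.y i) v = Pi.single (i - 1) (yCoeff I i * v i) := by
  simp [genAct, ← Pi.single_smul]

theorem xCoeff_mul_yCoeff (I : KSubset k n) (i : ZMod n) :
    xCoeff I i * yCoeff I i = PowerSeries.X := by
  unfold xCoeff yCoeff; split_ifs <;> simp

variable [NeZero n]

theorem sum_x (I : KSubset k n) (v : ZMod n → ℂ⟦X⟧) (j : ZMod n) :
    (∑ i, genAct I (.x i)) v j = xCoeff I j * v (j - 1) := by
  simp [LinearMap.sum_apply, Finset.sum_apply, genAct_x, Pi.single_apply]

theorem sum_y (I : KSubset k n) (v : ZMod n → ℂ⟦X⟧) (j : ZMod n) :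
    (∑ i, genAct I (.y i)) v j = yCoeff I (j + 1) * v (j + 1) := by
  rw [LinearMap.sum_apply, Finset.sum_apply, Finset.sum_eq_single (j + 1)]
  · simp [genAct_y]
  · intro b _ hb
    rw [genAct_y, Pi.single_apply, if_neg]
    rintro rfl; simp at hb
  · simp

theorem sum_x_pow (I : KSubset k n) (m : ℕ) (v : ZMod n → ℂ⟦X⟧) (j : ZMod n) :
    ((∑ i, genAct I (.x i)) ^ m) v j = (∏ l ∈ Finset.range m, xCoeff I (j - l)) * v (j - m) := by
  induction m generalizing j with
  | zero => simp
  | succ m ih =>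
    rw [pow_succ', Module.End.mul_apply, sum_x, ih, Finset.prod_range_succ']
    have h1 : ∀ l : ℕ, j - 1 - (l : ZMod n) = j - ((l + 1 : ℕ) : ZMod n) := by
      intro l; push_cast; ring
    simp only [h1]
    simp; ring

theorem prod_cycle (I : KSubset k n) (j : ZMod n) :
    ∏ l ∈ Finset.range n, xCoeff I (j - l) = PowerSeries.X ^ (n - k) := by
  have h : ∏ l ∈ Finset.range n, xCoeff I (j - l) = ∏ i : ZMod n, xCoeff I i := by
    refine Finset.prod_bij (fun l _ => j - (l : ZMod n)) (by simp) ?_ ?_ (by simp)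
    · intro a ha b hb hab
      have h2 : (a : ZMod n) = b := sub_right_injective hab
      have := congrArg ZMod.val h2
      rwa [ZMod.val_natCast_of_lt (Finset.mem_range.1 ha),
        ZMod.val_natCast_of_lt (Finset.mem_range.1 hb)] at this
    · intro b _
      exact ⟨(j - b).val, Finset.mem_range.2 (ZMod.val_lt _), by simp⟩
  rw [h]
  simp only [xCoeff]
  rw [Finset.prod_ite]
  simp only [Finset.prod_const_one, Finset.prod_const, one_mul]
  congr 1
  have : (Finset.univ.filter fun i => i ∉ I.1) = (I.1)ᶜ := by ext; simp
  rw [this, Finset.card_compl, ZMod.card, I.2]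

theorem sum_x_mul_sum_y (I : KSubset k n) :
    (∑ i, genAct I (.x i)) * (∑ i, genAct I (.y i)) =
      algebraMap ℂ⟦X⟧ (Module.End ℂ⟦X⟧ (ZMod n → ℂ⟦X⟧)) PowerSeries.X := by
  refine LinearMap.ext fun v => funext fun j => ?_
  rw [Module.End.mul_apply, sum_x, sum_y, Module.algebraMap_end_apply]
  simp [← mul_assoc, xCoeff_mul_yCoeff]

theorem genAct_pow (I : KSubset k n) :
    (∑ i, genAct I (.x i)) ^ k = (∑ i, genAct I (.y i)) ^ (n - k) := by
  set x := ∑ i, genAct I (.x i) with hx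
  set y := ∑ i, genAct I (.y i) with hy
  have hxy : ∀ m : ℕ, x ^ m * y ^ m =
      algebraMap ℂ⟦X⟧ (Module.End ℂ⟦X⟧ (ZMod n → ℂ⟦X⟧)) (PowerSeries.X ^ m) := by
    intro m
    induction m with
    | zero => simp
    | succ m ih =>
      rw [pow_succ x, pow_succ' y, mul_assoc, ← mul_assoc x y, hx, hy, sum_x_mul_sum_y, ← hx, ← hy,
        Algebra.commutes, ← mul_assoc, ih, ← map_mul, pow_succ]
  have hkn : k ≤ n := by
    have := Finset.card_le_univ I.1
    rwa [I.2, ZMod.card] at this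
  have h1 : x ^ (n - k) * x ^ k = x ^ (n - k) * y ^ (n - k) := by
    rw [hxy, ← pow_add, Nat.sub_add_cancel hkn]
    refine LinearMap.ext fun v => funext fun j => ?_
    rw [hx, sum_x_pow, prod_cycle, Module.algebraMap_end_apply]
    simp
  refine LinearMap.ext fun v => funext fun j => ?_
  have h2 := congrFun (LinearMap.congr_fun h1 v) (j + (n - k : ℕ))
  rw [Module.End.mul_apply, Module.End.mul_apply, sum_x_pow I (n - k) ((x ^ k) v),
    sum_x_pow I (n - k) ((y ^ (n - k)) v)] at h2
  have h3 : ∏ l ∈ Finset.range (n - k), xCoeff I (j + (n - k : ℕ) - l) ≠ 0 := by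
    refine Finset.prod_ne_zero_iff.2 fun l _ => ?_
    unfold xCoeff
    split_ifs
    · exact one_ne_zero
    · exact PowerSeries.X_ne_zero
  simpa using mul_left_cancel₀ h3 h2

/-- The action of `B_{k,n}` on `L_I`. -/
noncomputable def act (I : KSubset k n) :
    B k n →ₐ[ℂ⟦X⟧] Module.End ℂ⟦X⟧ (ZMod n → ℂ⟦X⟧) :=
  RingQuot.liftAlgHom ℂ⟦X⟧ ⟨FreeAlgebra.lift ℂ⟦X⟧ (genAct I), by
    intro a b h
    induction h with
    | e_mul_self i =>
      refine LinearMap.ext fun v => ?_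
      simp [genAct_e]
    | e_mul_ne i j h =>
      refine LinearMap.ext fun v => ?_
      simp [genAct_e, h]
    | e_sum =>
      refine LinearMap.ext fun v => ?_
      simp [genAct_e, LinearMap.sum_apply, Finset.univ_sum_single]
    | x_path i =>
      refine LinearMap.ext fun v => ?_
      simp [genAct_e, genAct_x]
    | y_path i =>
      refine LinearMap.ext fun v => ?_
      simp [genAct_e, genAct_y]
    | comm i =>
      refine LinearMap.ext fun v => ?_
      simp [genAct_x, genAct_y, ← mul_assoc, xCoeff_mul_yCoeff,
        mul_comm (yCoeff I (i + 1)) (xCoeff I (i + 1))]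
    | pow => simpa using genAct_pow I
    | center =>
      refine LinearMap.ext fun v => funext fun j => ?_
      simp [genAct_x, genAct_y, ← mul_assoc, xCoeff_mul_yCoeff, LinearMap.sum_apply,
        Finset.sum_apply, Pi.single_apply, Module.algebraMap_end_apply]⟩

/-- The rank one module `L_I`: `U_i = ℂ⟦t⟧` at every vertex; `x_i : U_{i-1} → U_i` is
multiplication by `1` if `i ∈ I` and by `t` otherwise, `y_i : U_i → U_{i-1}` is multiplication by
`t` if `i ∈ I` and by `1` otherwise. -/
def L (_I : KSubset k n) : Type := ZMod n → ℂ⟦X⟧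

noncomputable instance (I : KSubset k n) : AddCommGroup (L I) :=
  inferInstanceAs (AddCommGroup (ZMod n → ℂ⟦X⟧))

noncomputable instance (I : KSubset k n) : Module ℂ⟦X⟧ (L I) :=
  inferInstanceAs (Module ℂ⟦X⟧ (ZMod n → ℂ⟦X⟧))

noncomputable instance (I : KSubset k n) : Module (B k n) (L I) :=
  letI : Module (Module.End ℂ⟦X⟧ (ZMod n → ℂ⟦X⟧)) (L I) :=
    inferInstanceAs (Module (Module.End ℂ⟦X⟧ (ZMod n → ℂ⟦X⟧)) (ZMod n → ℂ⟦X⟧))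
  Module.compHom (L I) (act I).toRingHom

theorem smul_def (I : KSubset k n) (b : B k n) (v : L I) : b • v = act I b v := rfl

instance (I : KSubset k n) : IsScalarTower ℂ⟦X⟧ (B k n) (L I) where
  smul_assoc a b v := by
    rw [smul_def, smul_def, map_smul]
    rfl

end RankOne

/-! ### Cohen-Macaulay modules, rank, indecomposability, profiles -/

section Modules

variable (k n : ℕ) [NeZero n] (M : Type u) [AddCommGroup M] [Module ℂ⟦X⟧ M] [Module (B k n) M]
  [IsScalarTower ℂ⟦X⟧ (B k n) M]

/-- The component `M_i = e_i M` of a `B_{k,n}`-module at the vertex `i`. -/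
noncomputable def component (i : ZMod n) : Submodule ℂ⟦X⟧ M :=
  LinearMap.range (Algebra.lsmul ℂ⟦X⟧ ℂ⟦X⟧ M (idem k n i))

/-- `M` lies in `CM(B_{k,n})` and has rank `r`: it is free of finite rank over `Z = ℂ⟦t⟧`, and so
of rank `r` over `Z` at every vertex. -/
structure IsCMOfRank (r : ℕ) : Prop where
  free : Module.Free ℂ⟦X⟧ M
  finite : Module.Finite ℂ⟦X⟧ M
  rank_component : ∀ i : ZMod n, Module.finrank ℂ⟦X⟧ (component k n M i) = r

/-- `M` is nonzero and not the direct sum of two nonzero `B_{k,n}`-submodules. -/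
structure IsIndecomposable (k n : ℕ) [NeZero n] (M : Type u) [AddCommGroup M]
    [Module (B k n) M] : Prop where
  nontrivial : Nontrivial M
  eq_bot_or_eq_bot : ∀ P Q : Submodule (B k n) M, IsCompl P Q → P = ⊥ ∨ Q = ⊥

end Modules

section Profile

variable {k n : ℕ} [NeZero n]

/-- `M` has profile `I ∣ J`: it is filtered with submodule `L_J` and quotient `L_I`, i.e. there is
an exact sequence `0 → L_J → M → L_I → 0` of `B_{k,n}`-modules. -/
def HasProfile (M : Type u) [AddCommGroup M] [Module (B k n) M] (I J : KSubset k n) : Prop :=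
  ∃ (f : L J →ₗ[B k n] M) (g : M →ₗ[B k n] L I),
    Function.Injective f ∧ Function.Exact f g ∧ Function.Surjective g

/-- The vertical distance, in units of the variable `t`, from the rim of `J` up to the rim of `I`
at the vertex `v`, when the two rims are drawn from a common point at the vertex `0`. Passing the
edge `i`, the rim of a set goes down half a unit if `i` lies in the set and up half a unit
otherwise, so the distance is the number of elements of `J` among the edges `1, …, v` minus the
number of elements of `I` among them. -/
def rimGap (I J : KSubset k n) (v : ZMod n) : ℤ :=
  ((J.1.filter fun i => 1 ≤ i.val ∧ i.val ≤ v.val).card : ℤ) -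
    ((I.1.filter fun i => 1 ≤ i.val ∧ i.val ≤ v.val).card : ℤ)

/-- The two rims meet at the vertex `v` in the lattice diagram of `I ∣ J`, in which the rim of `J`
is moved up as far as possible without any part of it lying strictly above the rim of `I`: this
makes the least distance `0`, so they meet where `rimGap` is least. -/
def RimsMeet (I J : KSubset k n) (v : ZMod n) : Prop :=
  ∀ w : ZMod n, rimGap I J v ≤ rimGap I J w

instance (I J : KSubset k n) (v : ZMod n) : Decidable (RimsMeet I J v) :=
  inferInstanceAs (Decidable (∀ w : ZMod n, rimGap I J v ≤ rimGap I J w))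

/-- The number of boxes of the lattice diagram of `I ∣ J`, i.e. of regions enclosed between the two
rims from one meeting point to the next, counted at the vertices where they begin. The poset of
`I ∣ J` is `1^r ∣ 2` (a tree with a central vertex of dimension `2` and `r` leaves of dimension `1`,
one for each box) where `r` is this number. -/
def numBoxes (I J : KSubset k n) : ℕ :=
  (Finset.univ.filter fun v : ZMod n => RimsMeet I J v ∧ ¬ RimsMeet I J (v + 1)).card

/-- `I` and `J` are almost tightly `3`-interlacing:
`I \ J = {a_1, a_2, a_3, …, a_{3+r}}` and `J \ I = {b_1, b_2, b_3, …, b_{3+r}}` with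
`b_1 < a_1 < b_2 < a_2 < b_3 < ⋯ < b_{3+r} < a_3 < ⋯ < a_{3+r}` in the cyclic order, that is, in the
linear order on `ℤ/n` starting at some `s` (the indices are shifted by one in the code). -/
def AlmostTightlyThreeInterlacing (I J : KSubset k n) : Prop :=
  ∃ (s : ZMod n) (r : ℕ) (a b : Fin (r + 3) → ZMod n),
    I.1 \ J.1 = Finset.univ.image a ∧ J.1 \ I.1 = Finset.univ.image b ∧
    StrictMono (fun l => (a l - s).val) ∧ StrictMono (fun l => (b l - s).val) ∧
    (b 0 - s).val < (a 0 - s).val ∧ (a 0 - s).val < (b 1 - s).val ∧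
    (b 1 - s).val < (a 1 - s).val ∧ (a 1 - s).val < (b 2 - s).val ∧
    (b (Fin.last (r + 2)) - s).val < (a 2 - s).val

end Profile

end GrCat

/-!
Let `K` be the field of fractions of `Z = ℂ⟦t⟧`. A module of rank two with profile `I ∣ J` is a
family of lattices in `K²`, one for each vertex of the quiver: with respect to coordinates adapted
to the profile, the lattice at the vertex `l` is spanned by `(1, s l)` and `(0, t ^ h l)`, where `h`
is the distance between the rims of `I` and `J` and `s l` is determined modulo `t ^ h l`. Conversely
every choice of `s` for which neighbouring residues are compatible gives a module (`lat`,
`exists_latEquiv`). Up to homothety, the family is a closed walk in the Bruhat-Tits tree of lattices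
of `K²`, and `h` is the distance to the lattice `Z²`, at which the walk is where the rims meet.
In terms of the tree, the boxes are the excursions of the walk from this vertex.

Homomorphisms are matrices (`exists_matrix`, `nonempty_latEquiv`), so that everything is a question
about the subtree spanned by the walk. If this subtree is a path, all the lattices are compatible
with two lines and the module splits (`not_isIndecomposable_lat`). If it has a branching point, an
endomorphism is scalar modulo `t` and the module is indecomposable
(`isIndecomposable_lat_of_three`, `isIndecomposable_lat_of_branch`).

*Existence of a profile with three boxes.* Two independent functionals at a vertex extend to
homomorphisms into a projective-injective module of rank one, which gives some profile
(`IsCMOfRank.exists_hasProfile`). A line in `K²` is an end of the tree, and each end gives a profile,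
in which the distance between the rims is the distance of the walk to a horosphere (a Busemann
function). The boxes begin at the point of the subtree nearest to the end; choosing the end such
that this is a branching point gives three boxes (`exists_three_le_numBoxes`).

*Uniqueness.* In the almost tightly interlacing case the walk is always a tripod at `Z²` with two
legs of length one. A projective transformation of the residual line takes the directions of the
legs of one tripod to those of another one, and it lifts to a matrix that respects the long leg
(`IsTripod.nonempty_latEquiv`). Otherwise there are two walks with the same distances from `Z²` whose
coincidences differ, although coincidences are invariants of the module (`dvd_sub_of_latEquiv`).
With four boxes, the first steps of two of the excursions can be equal or different; if two
excursions have height at least two, they can share their first step or not; and if an excursion has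
a valley, it can leave the valley by the edge through which it came or by another edge. If none of
this occurs, there are three boxes, at most one of them is of height more than one, and this one is
unimodal, which is the almost tightly interlacing pattern (`IsRigid.interlacing`).
-/

namespace GrCat

/-! ### Generators and relations of the algebra -/

section Algebra

variable {k n : ℕ} [NeZero n]

/-- The sum `x` of all arrows `x_i`, as an element of `B_{k,n}`. -/
noncomputable def bX (k n : ℕ) [NeZero n] : B k n :=
  ∑ i, RingQuot.mkAlgHom ℂ⟦X⟧ (Rel k n) (fx i)

/-- The sum `y` of all arrows `y_i`, as an element of `B_{k,n}`. -/
noncomputable def bY (k n : ℕ) [NeZero n] : B k n :=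
  ∑ i, RingQuot.mkAlgHom ℂ⟦X⟧ (Rel k n) (fy i)

theorem idem_mul_self (i : ZMod n) : idem k n i * idem k n i = idem k n i := by
  rw [idem, ← map_mul]
  exact RingQuot.mkAlgHom_rel _ (Rel.e_mul_self i)

theorem idem_mul_ne {i j : ZMod n} (h : i ≠ j) : idem k n i * idem k n j = 0 := by
  rw [idem, idem, ← map_mul, RingQuot.mkAlgHom_rel _ (Rel.e_mul_ne i j h), map_zero]

theorem sum_idem : ∑ i, idem k n i = 1 := by
  simp only [idem]
  rw [← map_sum, RingQuot.mkAlgHom_rel _ Rel.e_sum, map_one]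

theorem mk_fx_eq (i : ZMod n) : RingQuot.mkAlgHom ℂ⟦X⟧ (Rel k n) (fx i) =
    idem k n i * RingQuot.mkAlgHom ℂ⟦X⟧ (Rel k n) (fx i) * idem k n (i - 1) := by
  simp only [idem]
  rw [← map_mul, ← map_mul, RingQuot.mkAlgHom_rel _ (Rel.x_path i)]

theorem mk_fy_eq (i : ZMod n) : RingQuot.mkAlgHom ℂ⟦X⟧ (Rel k n) (fy i) =
    idem k n (i - 1) * RingQuot.mkAlgHom ℂ⟦X⟧ (Rel k n) (fy i) * idem k n i := by
  simp only [idem]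
  rw [← map_mul, ← map_mul, RingQuot.mkAlgHom_rel _ (Rel.y_path i)]

theorem idem_mul_bX (i : ZMod n) :
    idem k n i * bX k n = RingQuot.mkAlgHom ℂ⟦X⟧ (Rel k n) (fx i) := by
  rw [bX, Finset.mul_sum, Finset.sum_eq_single i]
  · rw [mk_fx_eq, ← mul_assoc, ← mul_assoc, idem_mul_self]
  · intro j _ hj
    rw [mk_fx_eq, ← mul_assoc, ← mul_assoc, idem_mul_ne hj.symm, zero_mul, zero_mul]
  · simp

theorem bX_mul_idem (i : ZMod n) :
    bX k n * idem k n i = RingQuot.mkAlgHom ℂ⟦X⟧ (Rel k n) (fx (i + 1)) := by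
  rw [bX, Finset.sum_mul, Finset.sum_eq_single (i + 1)]
  · rw [mk_fx_eq, mul_assoc, add_sub_cancel_right, idem_mul_self]
  · intro j _ hj
    rw [mk_fx_eq, mul_assoc, idem_mul_ne, mul_zero]
    rintro rfl; simp at hj
  · simp

theorem idem_mul_bY (i : ZMod n) :
    idem k n i * bY k n = RingQuot.mkAlgHom ℂ⟦X⟧ (Rel k n) (fy (i + 1)) := by
  rw [bY, Finset.mul_sum, Finset.sum_eq_single (i + 1)]
  · rw [mk_fy_eq, ← mul_assoc, ← mul_assoc, add_sub_cancel_right, idem_mul_self]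
  · intro j _ hj
    rw [mk_fy_eq, ← mul_assoc, ← mul_assoc, idem_mul_ne, zero_mul, zero_mul]
    rintro rfl; simp at hj
  · simp

theorem idem_mul_bX_comm (i : ZMod n) : idem k n i * bX k n = bX k n * idem k n (i - 1) := by
  rw [idem_mul_bX, bX_mul_idem, sub_add_cancel]

theorem idem_mul_bX_pow (i : ZMod n) (m : ℕ) :
    idem k n i * bX k n ^ m = bX k n ^ m * idem k n (i - m) := by
  induction m generalizing i with
  | zero => simp
  | succ m ih =>
    rw [pow_succ', ← mul_assoc, idem_mul_bX_comm, mul_assoc, ih, ← mul_assoc]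
    congr 2; push_cast; ring

theorem mk_fx_mul_fy {i j : ZMod n} (h : i ≠ j) : RingQuot.mkAlgHom ℂ⟦X⟧ (Rel k n) (fx i) *
    RingQuot.mkAlgHom ℂ⟦X⟧ (Rel k n) (fy j) = 0 := by
  rw [mk_fx_eq, mk_fy_eq, mul_assoc, ← mul_assoc (idem k n (i - 1)), ← mul_assoc (idem k n (i - 1)),
    idem_mul_ne (by simpa using h)]
  simp

theorem mk_fy_mul_fx {i j : ZMod n} (h : i ≠ j) : RingQuot.mkAlgHom ℂ⟦X⟧ (Rel k n) (fy i) *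
    RingQuot.mkAlgHom ℂ⟦X⟧ (Rel k n) (fx j) = 0 := by
  rw [mk_fx_eq, mk_fy_eq, mul_assoc, ← mul_assoc (idem k n i), ← mul_assoc (idem k n i),
    idem_mul_ne h]
  simp

theorem bX_mul_bY : bX k n * bY k n = algebraMap ℂ⟦X⟧ (B k n) PowerSeries.X := by
  rw [← (RingQuot.mkAlgHom ℂ⟦X⟧ (Rel k n)).commutes, ← RingQuot.mkAlgHom_rel _ Rel.center, map_sum,
    bX, bY, Finset.sum_mul]
  refine Finset.sum_congr rfl fun i _ => ?_
  rw [Finset.mul_sum, Finset.sum_eq_single i, map_mul]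
  · intro j _ hj
    exact mk_fx_mul_fy hj.symm
  · simp

theorem bY_mul_bX : bY k n * bX k n = algebraMap ℂ⟦X⟧ (B k n) PowerSeries.X := by
  rw [← (RingQuot.mkAlgHom ℂ⟦X⟧ (Rel k n)).commutes, ← RingQuot.mkAlgHom_rel _ Rel.center, map_sum,
    bX, bY, Finset.sum_mul, ← Equiv.sum_comp (Equiv.addRight (1 : ZMod n))]
  refine Finset.sum_congr rfl fun i _ => ?_
  rw [Finset.mul_sum, Finset.sum_eq_single (i + 1), RingQuot.mkAlgHom_rel _ (Rel.comm i), map_mul]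
  · rfl
  · intro j _ hj
    exact mk_fy_mul_fx hj.symm
  · simp

theorem bX_pow_eq : bX k n ^ k = bY k n ^ (n - k) := by
  have := RingQuot.mkAlgHom_rel ℂ⟦X⟧ (Rel.pow (k := k) (n := n))
  simpa [bX, bY] using this

theorem bX_pow_mul_bY_pow (m : ℕ) :
    bX k n ^ m * bY k n ^ m = algebraMap ℂ⟦X⟧ (B k n) (PowerSeries.X ^ m) := by
  induction m with
  | zero => simp
  | succ m ih =>
    rw [pow_succ, pow_succ', mul_assoc, ← mul_assoc (bX k n) (bY k n), bX_mul_bY,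
      Algebra.commutes, ← mul_assoc, ih, ← map_mul, pow_succ]

theorem bX_pow_of_le {j : ℕ} (hkj : k ≤ j) (hjn : j ≤ n) :
    bX k n ^ j = algebraMap ℂ⟦X⟧ (B k n) (PowerSeries.X ^ (j - k)) * bY k n ^ (n - j) := by
  have h1 : bX k n ^ j = bX k n ^ (j - k) * bX k n ^ k := by
    rw [← pow_add, Nat.sub_add_cancel hkj]
  have h2 : n - k = (j - k) + (n - j) := by omega
  rw [h1, bX_pow_eq, h2, pow_add, ← mul_assoc, bX_pow_mul_bY_pow]

theorem bX_pow_card (hkn : k ≤ n) :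
    bX k n ^ n = algebraMap ℂ⟦X⟧ (B k n) (PowerSeries.X ^ (n - k)) := by
  rw [bX_pow_of_le hkn le_rfl]; simp

/-- The algebra is generated over its centre by the idempotents and the elements `x`, `y`. -/
theorem mem_of_generators (S : Subalgebra ℂ⟦X⟧ (B k n)) (he : ∀ i, idem k n i ∈ S)
    (hx : bX k n ∈ S) (hy : bY k n ∈ S) (b : B k n) : b ∈ S := by
  obtain ⟨a, rfl⟩ := RingQuot.mkAlgHom_surjective ℂ⟦X⟧ (Rel k n) b
  induction a using FreeAlgebra.induction with
  | grade0 r => rw [AlgHom.commutes]; exact S.algebraMap_mem r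
  | grade1 g =>
    cases g with
    | e i => exact he i
    | x i => rw [← idem_mul_bX]; exact S.mul_mem (he i) hx
    | y i =>
      have := idem_mul_bY (k := k) (i - 1)
      rw [sub_add_cancel] at this
      rw [← this]; exact S.mul_mem (he _) hy
  | mul a b ha hb => rw [map_mul]; exact S.mul_mem ha hb
  | add a b ha hb => rw [map_add]; exact S.add_mem ha hb

end Algebra

section Modules

/-- Submodules of `B_{k,n}`-modules are additive groups; the two semiring structures on a quotient
of a free algebra are not unified at the transparency at which instances are searched for. -/
noncomputable instance {k n : ℕ} [NeZero n] {M : Type*} [AddCommGroup M] [Module (B k n) M]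
    (P : Submodule (B k n) M) : AddCommGroup P :=
  @Submodule.addCommGroup (B k n) M _ _ _ P

variable {k n : ℕ} [NeZero n] {M N : Type*} [AddCommGroup M] [Module ℂ⟦X⟧ M] [Module (B k n) M]
  [IsScalarTower ℂ⟦X⟧ (B k n) M] [AddCommGroup N] [Module ℂ⟦X⟧ N] [Module (B k n) N]
  [IsScalarTower ℂ⟦X⟧ (B k n) N]

/-- A `Z`-submodule that is stable under the generators is a `B_{k,n}`-submodule. -/
theorem smul_mem_of_generators (P : Submodule ℂ⟦X⟧ M) (he : ∀ i, ∀ m ∈ P, idem k n i • m ∈ P)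
    (hx : ∀ m ∈ P, bX k n • m ∈ P) (hy : ∀ m ∈ P, bY k n • m ∈ P) (b : B k n) {m : M}
    (hm : m ∈ P) : b • m ∈ P := by
  let S : Subalgebra ℂ⟦X⟧ (B k n) :=
    { carrier := {b | ∀ m ∈ P, b • m ∈ P}
      mul_mem' := fun {a b} ha hb m hm => by rw [mul_smul]; exact ha _ (hb _ hm)
      add_mem' := fun {a b} ha hb m hm => by rw [add_smul]; exact P.add_mem (ha _ hm) (hb _ hm)
      algebraMap_mem' := fun r m hm => by
        rw [algebraMap_smul]; exact P.smul_mem _ hm }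
  exact mem_of_generators S he hx hy b m hm

theorem bX_bY_smul (m : M) : bX k n • bY k n • m = (PowerSeries.X : ℂ⟦X⟧) • m := by
  rw [← mul_smul, bX_mul_bY, algebraMap_smul]

theorem bY_bX_smul (m : M) : bY k n • bX k n • m = (PowerSeries.X : ℂ⟦X⟧) • m := by
  rw [← mul_smul, bY_mul_bX, algebraMap_smul]

/-- A `Z`-linear map commuting with the idempotents and with `x` is `B_{k,n}`-linear, provided that
`x` acts injectively on the target: `x (g (y m)) = g (t m) = x (y (g m))`. -/
noncomputable def linearMapOfGenerators (g : M →ₗ[ℂ⟦X⟧] N)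
    (he : ∀ i m, g (idem k n i • m) = idem k n i • g m)
    (hx : ∀ m, g (bX k n • m) = bX k n • g m)
    (hinj : Function.Injective fun v : N => bX k n • v) : M →ₗ[B k n] N :=
  { toFun := g
    map_add' := map_add g
    map_smul' := fun b m => by
      let S : Subalgebra ℂ⟦X⟧ (B k n) :=
        { carrier := {b | ∀ m, g (b • m) = b • g m}
          mul_mem' := fun {a b} ha hb m => by rw [mul_smul, ha, hb, mul_smul]
          add_mem' := fun {a b} ha hb m => by rw [add_smul, map_add, ha, hb, add_smul]
          algebraMap_mem' := fun r m => by
            rw [algebraMap_smul, algebraMap_smul, map_smul] }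
      refine mem_of_generators S he hx (fun m => hinj ?_) b m
      change bX k n • g (bY k n • m) = bX k n • bY k n • g m
      rw [← hx, bX_bY_smul, bX_bY_smul, map_smul] }

theorem map_smul_center (g : M →ₗ[B k n] N) (a : ℂ⟦X⟧) (m : M) : g (a • m) = a • g m := by
  rw [← algebraMap_smul (B k n) a m, map_smul, algebraMap_smul]

end Modules

/-! ### Rank one modules -/

section RankOne

variable {k n : ℕ}

theorem xCoeff_ne_zero (I : KSubset k n) (i : ZMod n) : xCoeff I i ≠ 0 := by
  unfold xCoeff; split_ifs
  · exact one_ne_zero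
  · exact PowerSeries.X_ne_zero

@[ext]
theorem L.ext {I : KSubset k n} {v w : L I} (h : ∀ i, v i = w i) : v = w := funext h

@[simp]
theorem L.add_apply {I : KSubset k n} (v w : L I) (i : ZMod n) : (v + w) i = v i + w i := rfl

@[simp]
theorem L.sub_apply {I : KSubset k n} (v w : L I) (i : ZMod n) : (v - w) i = v i - w i := rfl

@[simp]
theorem L.zero_apply {I : KSubset k n} (i : ZMod n) : (0 : L I) i = 0 := rfl

@[simp]
theorem L.smul_apply {I : KSubset k n} (a : ℂ⟦X⟧) (v : L I) (i : ZMod n) :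
    (a • v) i = a * v i := rfl

/-- The element of `L_I` with value `a` at the vertex `i` and `0` elsewhere. -/
noncomputable def L.single (I : KSubset k n) (i : ZMod n) (a : ℂ⟦X⟧) : L I :=
  fun j => if j = i then a else 0

@[simp]
theorem L.single_same (I : KSubset k n) (i : ZMod n) (a : ℂ⟦X⟧) : L.single I i a i = a := if_pos rfl

theorem L.single_apply (I : KSubset k n) (i j : ZMod n) (a : ℂ⟦X⟧) :
    L.single I i a j = if j = i then a else 0 := rfl

variable [NeZero n]

theorem act_idem (I : KSubset k n) (i : ZMod n) : act I (idem k n i) = genAct I (.e i) := by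
  rw [act, idem, RingQuot.liftAlgHom_mkAlgHom_apply, FreeAlgebra.lift_ι_apply]

theorem act_bX (I : KSubset k n) : act I (bX k n) = ∑ i, genAct I (.x i) := by
  rw [bX, map_sum]
  refine Finset.sum_congr rfl fun i _ => ?_
  rw [act, RingQuot.liftAlgHom_mkAlgHom_apply, FreeAlgebra.lift_ι_apply]

theorem act_bY (I : KSubset k n) : act I (bY k n) = ∑ i, genAct I (.y i) := by
  rw [bY, map_sum]
  refine Finset.sum_congr rfl fun i _ => ?_
  rw [act, RingQuot.liftAlgHom_mkAlgHom_apply, FreeAlgebra.lift_ι_apply]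

theorem idem_smul_apply (I : KSubset k n) (i : ZMod n) (v : L I) (j : ZMod n) :
    (idem k n i • v : L I) j = if j = i then v j else 0 := by
  have h := congrFun (genAct_e I i v) j
  rw [← act_idem, Pi.single_apply] at h
  refine Eq.trans h ?_
  split_ifs with h
  · rw [h]
  · rfl

theorem bX_smul_apply (I : KSubset k n) (v : L I) (j : ZMod n) :
    (bX k n • v : L I) j = xCoeff I j * v (j - 1) := by
  have h := sum_x I v j
  rw [← act_bX] at h
  exact h

theorem bY_smul_apply (I : KSubset k n) (v : L I) (j : ZMod n) :
    (bY k n • v : L I) j = yCoeff I (j + 1) * v (j + 1) := by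
  have h := sum_y I v j
  rw [← act_bY] at h
  exact h

theorem bX_pow_smul_apply (I : KSubset k n) (m : ℕ) (v : L I) (j : ZMod n) :
    (bX k n ^ m • v : L I) j = (∏ l ∈ Finset.range m, xCoeff I (j - l)) * v (j - m) := by
  have h := sum_x_pow I m v j
  rw [← act_bX, ← map_pow] at h
  exact h

theorem bX_smul_injective (I : KSubset k n) :
    Function.Injective fun v : L I => (bX k n • v : L I) := by
  intro v w h
  ext1 i
  have := congrFun h (i + 1)
  simp only [bX_smul_apply, add_sub_cancel_right] at this
  exact mul_left_cancel₀ (xCoeff_ne_zero I _) this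

end RankOne

/-! ### Gap functions and lattices in `L_I ⊕ L_I` -/

section Lattice

variable {k n : ℕ}

/-- `h` is, up to an additive constant, the vertical distance between the rims of `I` and `J`. -/
def IsGap (I J : KSubset k n) (h : ZMod n → ℕ) : Prop :=
  ∀ l, h l + (if l ∈ I.1 then 1 else 0) = h (l - 1) + (if l ∈ J.1 then 1 else 0)

/-- The residue of `s l` modulo `t ^ h l` may only change along an edge modulo the smaller of the
two powers of `t` at its ends. -/
def Compat (h : ZMod n → ℕ) (s : ZMod n → ℂ⟦X⟧) : Prop :=
  ∀ l, (PowerSeries.X : ℂ⟦X⟧) ^ min (h l) (h (l - 1)) ∣ s l - s (l - 1)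

variable {I J : KSubset k n} {h : ZMod n → ℕ} {s s' : ZMod n → ℂ⟦X⟧}

theorem X_pow_mul_left_cancel {a : ℕ} {u v : ℂ⟦X⟧}
    (huv : PowerSeries.X ^ a * u = PowerSeries.X ^ a * v) : u = v :=
  mul_left_cancel₀ (pow_ne_zero _ PowerSeries.X_ne_zero) huv

theorem IsGap.mul_xCoeff (hg : IsGap I J h) (l : ZMod n) :
    PowerSeries.X ^ h l * xCoeff J l = PowerSeries.X ^ h (l - 1) * xCoeff I l := by
  have := hg l
  unfold xCoeff
  split_ifs at this ⊢
  · rw [show h l = h (l - 1) by omega]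
  · rw [show h l = h (l - 1) + 1 by omega, pow_succ, mul_one]
  · rw [show h (l - 1) = h l + 1 by omega, pow_succ, mul_one]
  · rw [show h l = h (l - 1) by omega]

theorem IsGap.mul_yCoeff (hg : IsGap I J h) (l : ZMod n) :
    PowerSeries.X ^ h (l - 1) * yCoeff J l = PowerSeries.X ^ h l * yCoeff I l := by
  have := hg l
  unfold yCoeff
  split_ifs at this ⊢
  · rw [show h l = h (l - 1) by omega]
  · rw [show h l = h (l - 1) + 1 by omega, pow_succ, mul_one]
  · rw [show h (l - 1) = h l + 1 by omega, pow_succ, mul_one]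
  · rw [show h l = h (l - 1) by omega]

theorem IsGap.le_succ (hg : IsGap I J h) (l : ZMod n) : h l ≤ h (l - 1) + 1 := by
  have := hg l
  split_ifs at this <;> omega

theorem IsGap.le_succ' (hg : IsGap I J h) (l : ZMod n) : h (l - 1) ≤ h l + 1 := by
  have := hg l
  split_ifs at this <;> omega

theorem Compat.dvd_xCoeff (hg : IsGap I J h) (hs : Compat h s) (l : ZMod n) :
    PowerSeries.X ^ h l ∣ xCoeff I l * (s l - s (l - 1)) := by
  have h1 := hg l
  have h2 := hs l
  unfold xCoeff
  split_ifs at h1 ⊢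
  · rw [one_mul]; refine dvd_trans (pow_dvd_pow _ ?_) h2; omega
  · rw [one_mul]; refine dvd_trans (pow_dvd_pow _ ?_) h2; omega
  · rw [show h l = min (h l) (h (l - 1)) + 1 by omega, pow_succ']
    exact mul_dvd_mul_left _ h2
  · refine Dvd.dvd.mul_left (dvd_trans (pow_dvd_pow _ ?_) h2) _; omega

theorem Compat.dvd_yCoeff (hg : IsGap I J h) (hs : Compat h s) (l : ZMod n) :
    PowerSeries.X ^ h (l - 1) ∣ yCoeff I l * (s l - s (l - 1)) := by
  have h1 := hg l
  have h2 := hs l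
  unfold yCoeff
  split_ifs at h1 ⊢
  · refine Dvd.dvd.mul_left (dvd_trans (pow_dvd_pow _ ?_) h2) _; omega
  · rw [show h (l - 1) = min (h l) (h (l - 1)) + 1 by omega, pow_succ']
    exact mul_dvd_mul_left _ h2
  · rw [one_mul]; refine dvd_trans (pow_dvd_pow _ ?_) h2; omega
  · rw [one_mul]; refine dvd_trans (pow_dvd_pow _ ?_) h2; omega

theorem Compat.of_dvd (hg : IsGap I J h)
    (hx : ∀ l, PowerSeries.X ^ h l ∣ xCoeff I l * (s l - s (l - 1)))
    (hy : ∀ l, PowerSeries.X ^ h (l - 1) ∣ yCoeff I l * (s l - s (l - 1))) : Compat h s := by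
  intro l
  have h1 := hg l
  have h2 := hx l
  have h3 := hy l
  unfold xCoeff at h2
  unfold yCoeff at h3
  split_ifs at h1 h2 h3
  · rw [one_mul] at h2; exact dvd_trans (pow_dvd_pow _ (min_le_left _ _)) h2
  · rw [one_mul] at h2; exact dvd_trans (pow_dvd_pow _ (min_le_left _ _)) h2
  · rw [one_mul] at h3; exact dvd_trans (pow_dvd_pow _ (min_le_right _ _)) h3
  · rw [one_mul] at h3; exact dvd_trans (pow_dvd_pow _ (min_le_right _ _)) h3

variable [NeZero n]

/-- Multiplication by `t ^ h l` at the vertex `l`, as a map from `L_J` to `L_I`. -/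
noncomputable def scaleHom (hg : IsGap I J h) : L J →ₗ[B k n] L I :=
  linearMapOfGenerators
    { toFun := fun v l => PowerSeries.X ^ h l * v l
      map_add' := fun v w => L.ext fun l => mul_add _ _ _
      map_smul' := fun a v => L.ext fun l => mul_left_comm _ _ _ }
    (fun i m => by
      ext1 l
      change _ * (idem k n i • m : L J) l = _
      rw [idem_smul_apply, idem_smul_apply]
      split_ifs
      · rfl
      · rw [mul_zero])
    (fun m => by
      ext1 l
      change _ * (bX k n • m : L J) l = _
      rw [bX_smul_apply, bX_smul_apply, ← mul_assoc, hg.mul_xCoeff, mul_comm _ (xCoeff I l),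
        mul_assoc]
      rfl)
    (bX_smul_injective I)

@[simp]
theorem scaleHom_apply (hg : IsGap I J h) (v : L J) (l : ZMod n) :
    scaleHom hg v l = PowerSeries.X ^ h l * v l := rfl

theorem scaleHom_injective (hg : IsGap I J h) : Function.Injective (scaleHom hg) := by
  intro v w hvw
  ext1 l
  exact X_pow_mul_left_cancel (congrFun hvw l)

/-- The rank two module given by a closed walk in the tree of lattices in `K²`, `K` the field of
fractions of `Z`: at the vertex `l` it is the lattice spanned by `(1, s l)` and `(0, t ^ h l)`. The
ambient `L_I ⊕ L_I` is `K²` with coordinates rescaled at each vertex so that `x` and `y` act as on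
`L_I`. -/
noncomputable def lat (hg : IsGap I J h) (hs : Compat h s) : Submodule (B k n) (L I × L I) :=
  let P : Submodule ℂ⟦X⟧ (L I × L I) :=
    { carrier := {v | ∀ l, PowerSeries.X ^ h l ∣ v.2 l - s l * v.1 l}
      zero_mem' := fun l => by simp
      add_mem' := fun {v w} hv hw l => by
        have := dvd_add (hv l) (hw l)
        refine this.trans (dvd_of_eq ?_)
        simp only [Prod.snd_add, Prod.fst_add, L.add_apply]; ring
      smul_mem' := fun a v hv l => by
        refine ((hv l).mul_left a).trans (dvd_of_eq ?_)
        simp only [Prod.smul_snd, Prod.smul_fst, L.smul_apply]; ring }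
  { P with
    smul_mem' := fun b v hv => by
      refine smul_mem_of_generators P ?_ ?_ ?_ b hv
      · intro i m hm l
        simp only [Prod.smul_snd, Prod.smul_fst, idem_smul_apply]
        split_ifs
        · exact hm l
        · simp
      · intro m hm l
        simp only [Prod.smul_snd, Prod.smul_fst, bX_smul_apply]
        have h1 : PowerSeries.X ^ h l ∣ xCoeff I l * (m.2 (l - 1) - s (l - 1) * m.1 (l - 1)) := by
          refine dvd_trans ?_ (mul_dvd_mul_left _ (hm (l - 1)))
          rw [mul_comm, ← hg.mul_xCoeff]
          exact dvd_mul_right _ _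
        refine (dvd_sub h1 ((hs.dvd_xCoeff hg l).mul_right (m.1 (l - 1)))).trans (dvd_of_eq ?_)
        ring
      · intro m hm l
        simp only [Prod.smul_snd, Prod.smul_fst, bY_smul_apply]
        have h0 := hg.mul_yCoeff (l + 1)
        have h2 := hs.dvd_yCoeff hg (l + 1)
        rw [add_sub_cancel_right] at h0 h2
        have h1 : PowerSeries.X ^ h l ∣
            yCoeff I (l + 1) * (m.2 (l + 1) - s (l + 1) * m.1 (l + 1)) := by
          refine dvd_trans ?_ (mul_dvd_mul_left _ (hm (l + 1)))
          rw [mul_comm, ← h0]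
          exact dvd_mul_right _ _
        refine (dvd_add h1 (h2.mul_right (m.1 (l + 1)))).trans (dvd_of_eq ?_)
        ring }

/-- The basis vector `(1, s l)` at the vertex `l`. -/
noncomputable def latBasisFst (hg : IsGap I J h) (hs : Compat h s) (l : ZMod n) : lat hg hs :=
  ⟨(L.single I l 1, L.single I l (s l)), fun j => by
    simp only [L.single_apply]
    split_ifs with hj
    · simp [hj]
    · simp⟩

/-- The basis vector `(0, t ^ h l)` at the vertex `l`. -/
noncomputable def latBasisSnd (hg : IsGap I J h) (hs : Compat h s) (l : ZMod n) : lat hg hs :=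
  ⟨(0, L.single I l (PowerSeries.X ^ h l)), fun j => by
    simp only [L.single_apply]
    split_ifs with hj
    · simp [hj]
    · simp⟩

theorem lat_ext {hg : IsGap I J h} {hs : Compat h s} {v w : lat hg hs}
    (h1 : ∀ l, v.1.1 l = w.1.1 l) (h2 : ∀ l, v.1.2 l = w.1.2 l) : v = w :=
  Subtype.ext (Prod.ext (L.ext h1) (L.ext h2))

theorem hasProfile_lat (hg : IsGap I J h) (hs : Compat h s) : HasProfile (lat hg hs) I J := by
  refine ⟨LinearMap.codRestrict (lat hg hs) (LinearMap.inr _ _ _ ∘ₗ scaleHom hg) fun v l => by simp,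
    LinearMap.fst _ _ _ ∘ₗ (lat hg hs).subtype, ?_, ?_, ?_⟩
  · intro v w hvw
    refine scaleHom_injective hg ?_
    exact congrArg (fun z : lat hg hs => z.1.2) hvw
  · intro v
    constructor
    · intro hv
      have hv1 : v.1.1 = 0 := hv
      choose w hw using v.2
      refine ⟨w, lat_ext (fun l => (congrFun hv1 l).symm) fun l => ?_⟩
      change _ * w l = _
      rw [← hw l, hv1, L.zero_apply, mul_zero, sub_zero]
    · rintro ⟨w, rfl⟩
      rfl
  · intro v
    exact ⟨⟨(v, fun l => s l * v l), fun l => by simp⟩, rfl⟩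

theorem isCMOfRank_lat (hg : IsGap I J h) (hs : Compat h s) : IsCMOfRank k n (lat hg hs) 2 := by
  have e : ((ZMod n → ℂ⟦X⟧) × (ZMod n → ℂ⟦X⟧)) ≃ₗ[ℂ⟦X⟧] lat hg hs :=
    LinearEquiv.ofBijective (M := (ZMod n → ℂ⟦X⟧) × (ZMod n → ℂ⟦X⟧)) (M₂ := lat hg hs)
      { toFun := fun v => ⟨(v.1, fun l => s l * v.1 l + PowerSeries.X ^ h l * v.2 l), fun l => by simp⟩
        map_add' := fun v w => lat_ext (fun l => rfl) fun l => by
          change s l * (v.1 l + w.1 l) + PowerSeries.X ^ h l * (v.2 l + w.2 l) =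
            (s l * v.1 l + PowerSeries.X ^ h l * v.2 l) +
              (s l * w.1 l + PowerSeries.X ^ h l * w.2 l)
          ring
        map_smul' := fun a v => lat_ext (fun l => rfl) fun l => by
          change s l * (a * v.1 l) + PowerSeries.X ^ h l * (a * v.2 l) =
            a * (s l * v.1 l + PowerSeries.X ^ h l * v.2 l)
          ring }
      (by
        constructor
        · intro v w hvw
          have h1 : v.1 = w.1 := congrArg (fun z : lat hg hs => z.1.1) hvw
          refine Prod.ext h1 (funext fun l => ?_)
          have h2 : s l * v.1 l + PowerSeries.X ^ h l * v.2 l =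
            s l * w.1 l + PowerSeries.X ^ h l * w.2 l :=
            congrArg (fun z : lat hg hs => z.1.2 l) hvw
          rw [h1] at h2
          exact X_pow_mul_left_cancel (add_left_cancel h2)
        · intro v
          choose w hw using v.2
          refine ⟨(v.1.1, w), lat_ext (fun l => rfl) fun l => ?_⟩
          change s l * v.1.1 l + PowerSeries.X ^ h l * w l = v.1.2 l
          rw [← hw l]; ring)
  refine ⟨Module.Free.of_equiv e, Module.Finite.equiv e, fun i => ?_⟩
  let κ : (ℂ⟦X⟧ × ℂ⟦X⟧) →ₗ[ℂ⟦X⟧] lat hg hs :=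
    (LinearMap.toSpanSingleton ℂ⟦X⟧ _ (latBasisFst hg hs i)).coprod
      (LinearMap.toSpanSingleton ℂ⟦X⟧ _ (latBasisSnd hg hs i))
  have hκ1 : ∀ a l, (κ a).1.1 l = if l = i then a.1 else 0 := by
    intro a l
    change a.1 * L.single I i 1 l + a.2 * 0 = _
    rw [L.single_apply]; split_ifs <;> simp
  have hκ2 : ∀ a l, (κ a).1.2 l = if l = i then s i * a.1 + PowerSeries.X ^ h i * a.2 else 0 := by
    intro a l
    change a.1 * L.single I i (s i) l + a.2 * L.single I i (PowerSeries.X ^ h i) l = _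
    rw [L.single_apply, L.single_apply]; split_ifs <;> ring
  have hinj : Function.Injective κ := by
    intro a b hab
    have h1 := hκ1 a i
    have h2 := hκ2 a i
    rw [hab, hκ1, if_pos rfl, if_pos rfl] at h1
    rw [hab, hκ2, if_pos rfl, if_pos rfl, h1] at h2
    exact Prod.ext h1.symm (X_pow_mul_left_cancel (add_left_cancel h2)).symm
  have hr : component k n (lat hg hs) i = LinearMap.range κ := by
    ext v
    constructor
    · rintro ⟨w, rfl⟩
      obtain ⟨c, hc⟩ := w.2 i
      refine ⟨(w.1.1 i, c), ?_⟩
      change _ = idem k n i • w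
      refine lat_ext (fun l => ?_) fun l => ?_
      · rw [hκ1]
        change _ = (idem k n i • w.1.1 : L I) l
        rw [idem_smul_apply]
        split_ifs with hl
        · rw [hl]
        · rfl
      · rw [hκ2]
        change _ = (idem k n i • w.1.2 : L I) l
        rw [idem_smul_apply]
        split_ifs with hl
        · rw [hl, ← hc]; ring
        · rfl
    · rintro ⟨a, rfl⟩
      refine ⟨κ a, ?_⟩
      change idem k n i • κ a = _
      refine lat_ext (fun l => ?_) fun l => ?_
      · change (idem k n i • (κ a).1.1 : L I) l = _
        rw [idem_smul_apply, hκ1]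
        split_ifs <;> rfl
      · change (idem k n i • (κ a).1.2 : L I) l = _
        rw [idem_smul_apply, hκ2]
        split_ifs <;> rfl
  rw [hr, LinearMap.finrank_range_of_inj hinj]
  simp

end Lattice

/-! ### Homomorphisms between lattices are matrices -/

section Matrix

variable {k n : ℕ} [NeZero n] {I J : KSubset k n} {h : ZMod n → ℕ} {s s' : ZMod n → ℂ⟦X⟧}

/-- The homomorphism between two lattices given by a matrix over `Z`. -/
noncomputable def latHom (hg : IsGap I J h) (hs : Compat h s) (hs' : Compat h s') (a b c d : ℂ⟦X⟧)
    (H : ∀ l, PowerSeries.X ^ h l ∣ c + s l * d - s' l * (a + s l * b)) :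
    lat hg hs →ₗ[B k n] lat hg hs' where
  toFun v := ⟨(a • v.1.1 + b • v.1.2, c • v.1.1 + d • v.1.2), fun l => by
    simp only [L.add_apply, L.smul_apply]
    refine (dvd_add ((H l).mul_right (v.1.1 l)) ((v.2 l).mul_right (d - s' l * b))).trans
      (dvd_of_eq ?_)
    ring⟩
  map_add' v w := lat_ext (fun l => by
    change a * (v.1.1 l + w.1.1 l) + b * (v.1.2 l + w.1.2 l) =
      (a * v.1.1 l + b * v.1.2 l) + (a * w.1.1 l + b * w.1.2 l)
    ring) fun l => by
    change c * (v.1.1 l + w.1.1 l) + d * (v.1.2 l + w.1.2 l) =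
      (c * v.1.1 l + d * v.1.2 l) + (c * w.1.1 l + d * w.1.2 l)
    ring
  map_smul' r v := Subtype.ext (Prod.ext
    (by
      change a • (r • v.1.1 : L I) + b • (r • v.1.2 : L I) = r • (a • v.1.1 + b • v.1.2 : L I)
      rw [smul_add, smul_algebra_smul_comm, smul_algebra_smul_comm])
    (by
      change c • (r • v.1.1 : L I) + d • (r • v.1.2 : L I) = r • (c • v.1.1 + d • v.1.2 : L I)
      rw [smul_add, smul_algebra_smul_comm, smul_algebra_smul_comm]))

theorem latHom_fst (hg : IsGap I J h) (hs : Compat h s) (hs' : Compat h s') (a b c d : ℂ⟦X⟧)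
    (H : ∀ l, PowerSeries.X ^ h l ∣ c + s l * d - s' l * (a + s l * b)) (v : lat hg hs)
    (l : ZMod n) : (latHom hg hs hs' a b c d H v).1.1 l = a * v.1.1 l + b * v.1.2 l := rfl

theorem latHom_snd (hg : IsGap I J h) (hs : Compat h s) (hs' : Compat h s') (a b c d : ℂ⟦X⟧)
    (H : ∀ l, PowerSeries.X ^ h l ∣ c + s l * d - s' l * (a + s l * b)) (v : lat hg hs)
    (l : ZMod n) : (latHom hg hs hs' a b c d H v).1.2 l = c * v.1.1 l + d * v.1.2 l := rfl

/-- An invertible matrix mapping each lattice of the first chain into that of the second is an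
isomorphism: its adjugate maps the lattices back, since the condition is symmetric. -/
theorem nonempty_latEquiv (hg : IsGap I J h) (hs : Compat h s) (hs' : Compat h s')
    (a b c d : ℂ⟦X⟧) (H : ∀ l, PowerSeries.X ^ h l ∣ c + s l * d - s' l * (a + s l * b))
    (hu : IsUnit (a * d - b * c)) : Nonempty (lat hg hs ≃ₗ[B k n] lat hg hs') := by
  obtain ⟨e, he⟩ := hu.exists_right_inv
  have H' : ∀ l, PowerSeries.X ^ h l ∣
      (-c * e) + s' l * (a * e) - s l * (d * e + s' l * (-b * e)) := by
    intro l
    refine ((H l).mul_right (-e)).trans (dvd_of_eq ?_)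
    ring
  refine ⟨LinearEquiv.ofLinearMap (latHom hg hs hs' a b c d H)
    (latHom hg hs' hs (d * e) (-b * e) (-c * e) (a * e) H') ?_ ?_⟩
  · refine LinearMap.ext fun v => lat_ext (fun l => ?_) fun l => ?_
    · simp only [LinearMap.comp_apply, latHom_fst, latHom_snd, LinearMap.id_apply]
      linear_combination v.1.1 l * he
    · simp only [LinearMap.comp_apply, latHom_fst, latHom_snd, LinearMap.id_apply]
      linear_combination v.1.2 l * he
  · refine LinearMap.ext fun v => lat_ext (fun l => ?_) fun l => ?_
    · simp only [LinearMap.comp_apply, latHom_fst, latHom_snd, LinearMap.id_apply]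
      linear_combination v.1.1 l * he
    · simp only [LinearMap.comp_apply, latHom_fst, latHom_snd, LinearMap.id_apply]
      linear_combination v.1.2 l * he

/-- Every homomorphism between two lattices that are everything at the vertex `p` is given by a
matrix: its matrix at `p`, carried along by the powers of `x`. -/
theorem exists_matrix (hg : IsGap I J h) (hs : Compat h s) (hs' : Compat h s') {p : ZMod n}
    (hp : h p = 0) (φ : lat hg hs →ₗ[B k n] lat hg hs') :
    ∃ a b c d : ℂ⟦X⟧, (∀ v l, (φ v).1.1 l = a * v.1.1 l + b * v.1.2 l) ∧
      (∀ v l, (φ v).1.2 l = c * v.1.1 l + d * v.1.2 l) ∧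
      ∀ l, PowerSeries.X ^ h l ∣ c + s l * d - s' l * (a + s l * b) := by
  let E₁ : lat hg hs := ⟨(L.single I p 1, 0), fun j => by
    by_cases hj : j = p
    · simp [hj, hp]
    · simp [L.single_apply, hj]⟩
  let E₂ : lat hg hs := ⟨(0, L.single I p 1), fun j => by
    by_cases hj : j = p
    · simp [hj, hp]
    · simp [L.single_apply, hj]⟩
  have key : ∀ (v : lat hg hs) (l : ZMod n),
      (φ v).1.1 l = (φ E₁).1.1 p * v.1.1 l + (φ E₂).1.1 p * v.1.2 l ∧
      (φ v).1.2 l = (φ E₁).1.2 p * v.1.1 l + (φ E₂).1.2 p * v.1.2 l := by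
    intro v l
    set m := (p - l).val with hm
    have hpm : p - (m : ZMod n) = l := by rw [hm, ZMod.natCast_zmod_val]; ring
    set A := ∏ u ∈ Finset.range m, xCoeff I (p - u) with hA
    have hA0 : A ≠ 0 := Finset.prod_ne_zero_iff.2 fun u _ => xCoeff_ne_zero I _
    have hX : ∀ w : L I, (bX k n ^ m • w : L I) p = A * w l := fun w => by
      rw [bX_pow_smul_apply, hpm]
    have hv : idem k n p • bX k n ^ m • v = (A * v.1.1 l) • E₁ + (A * v.1.2 l) • E₂ := by
      refine lat_ext (fun j => ?_) fun j => ?_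
      · change (idem k n p • bX k n ^ m • v.1.1 : L I) j = A * v.1.1 l * L.single I p 1 j +
          A * v.1.2 l * 0
        rw [idem_smul_apply, L.single_apply]
        split_ifs with hj
        · rw [hj, hX]; ring
        · ring
      · change (idem k n p • bX k n ^ m • v.1.2 : L I) j = A * v.1.1 l * 0 +
          A * v.1.2 l * L.single I p 1 j
        rw [idem_smul_apply, L.single_apply]
        split_ifs with hj
        · rw [hj, hX]; ring
        · ring
    have h1 := congrArg φ hv
    rw [map_smul, map_smul, map_add, map_smul_center, map_smul_center] at h1
    have h2 : A * (φ v).1.1 l = A * v.1.1 l * (φ E₁).1.1 p + A * v.1.2 l * (φ E₂).1.1 p := by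
      have := congrArg (fun z : lat hg hs' => z.1.1 p) h1
      rw [← hX]
      refine Eq.trans ?_ this
      change _ = (idem k n p • bX k n ^ m • (φ v).1.1 : L I) p
      rw [idem_smul_apply, if_pos rfl]
    have h3 : A * (φ v).1.2 l = A * v.1.1 l * (φ E₁).1.2 p + A * v.1.2 l * (φ E₂).1.2 p := by
      have := congrArg (fun z : lat hg hs' => z.1.2 p) h1
      rw [← hX]
      refine Eq.trans ?_ this
      change _ = (idem k n p • bX k n ^ m • (φ v).1.2 : L I) p
      rw [idem_smul_apply, if_pos rfl]
    exact ⟨mul_left_cancel₀ hA0 (by rw [h2]; ring), mul_left_cancel₀ hA0 (by rw [h3]; ring)⟩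
  refine ⟨(φ E₁).1.1 p, (φ E₂).1.1 p, (φ E₁).1.2 p, (φ E₂).1.2 p, fun v l => (key v l).1,
    fun v l => (key v l).2, fun l => ?_⟩
  have h1 := (φ (latBasisFst hg hs l)).2 l
  rw [(key _ l).1, (key _ l).2] at h1
  refine h1.trans (dvd_of_eq ?_)
  change _ * L.single I l 1 l + _ * L.single I l (s l) l - s' l *
    (_ * L.single I l 1 l + _ * L.single I l (s l) l) = _
  simp only [L.single_same]
  ring

end Matrix

/-! ### Indecomposability and idempotents -/

section Indecomposable

variable {k n : ℕ} [NeZero n] {M N : Type*} [AddCommGroup M] [Module (B k n) M]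
  [AddCommGroup N] [Module (B k n) N]

theorem IsIndecomposable.of_equiv (e : M ≃ₗ[B k n] N) (hM : IsIndecomposable k n M) :
    IsIndecomposable k n N where
  nontrivial := by
    have := hM.nontrivial
    exact e.symm.toEquiv.nontrivial
  eq_bot_or_eq_bot P Q hPQ := by
    have h := (Submodule.orderIsoMapComap e).symm.isCompl hPQ
    rcases hM.eq_bot_or_eq_bot _ _ h with h | h
    · left; exact (map_eq_bot_iff (Submodule.orderIsoMapComap e).symm).1 h
    · right; exact (map_eq_bot_iff (Submodule.orderIsoMapComap e).symm).1 h

theorem IsIndecomposable.idempotent (hM : IsIndecomposable k n M) (π : M →ₗ[B k n] M)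
    (hπ : ∀ v, π (π v) = π v) : (∀ v, π v = 0) ∨ ∀ v, π v = v := by
  have hc : IsCompl (LinearMap.range π) (LinearMap.ker π) := by
    constructor
    · rw [Submodule.disjoint_def]
      rintro _ ⟨w, rfl⟩ hw
      rw [← hπ]; exact hw
    · rw [codisjoint_iff, eq_top_iff]
      intro v _
      have h1 : v = π v + (v - π v) := by abel
      rw [h1]
      refine Submodule.add_mem_sup ⟨v, rfl⟩ ?_
      rw [LinearMap.mem_ker, map_sub, hπ, sub_self]
  rcases hM.eq_bot_or_eq_bot _ _ hc with h | h
  · left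
    intro v
    have : π v ∈ LinearMap.range π := ⟨v, rfl⟩
    rwa [h, Submodule.mem_bot] at this
  · right
    intro v
    have : v - π v ∈ LinearMap.ker π := by
      rw [LinearMap.mem_ker, map_sub, hπ, sub_self]
    rw [h, Submodule.mem_bot, sub_eq_zero] at this
    exact this.symm

theorem submodule_sub_mem (P : Submodule (B k n) M) {v w : M} (hv : v ∈ P) (hw : w ∈ P) :
    v - w ∈ P :=
  ((⟨v, hv⟩ : P) - ⟨w, hw⟩).2

theorem isIndecomposable_of_idempotent [Nontrivial M]
    (H : ∀ π : M →ₗ[B k n] M, (∀ v, π (π v) = π v) → (∀ v, π v = 0) ∨ ∀ v, π v = v) :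
    IsIndecomposable k n M where
  nontrivial := inferInstance
  eq_bot_or_eq_bot P Q hPQ := by
    have hex : ∀ v : M, ∃ p ∈ P, ∃ q ∈ Q, p + q = v := fun v => by
      have : v ∈ P ⊔ Q := by rw [hPQ.sup_eq_top]; trivial
      exact Submodule.mem_sup.1 this
    have huniq : ∀ p ∈ P, ∀ q ∈ Q, ∀ p' ∈ P, ∀ q' ∈ Q, p + q = p' + q' → p = p' := by
      intro p hp q hq p' hp' q' hq' h
      have h1 : p - p' = q' - q := by
        rw [sub_eq_sub_iff_add_eq_add, h, add_comm]
      have h2 : p - p' ∈ Q := by rw [h1]; exact submodule_sub_mem Q hq' hq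
      exact sub_eq_zero.1 (Submodule.disjoint_def.1 hPQ.disjoint _ (submodule_sub_mem P hp hp') h2)
    choose f hf g hg hfg using hex
    let π : M →ₗ[B k n] M :=
      { toFun := f
        map_add' := fun v w => huniq _ (hf _) _ (hg _) _ (P.add_mem (hf v) (hf w)) _
          (Q.add_mem (hg v) (hg w)) (by rw [hfg, add_add_add_comm, hfg, hfg])
        map_smul' := fun b v => huniq _ (hf _) _ (hg _) _ (P.smul_mem b (hf v)) _
          (Q.smul_mem b (hg v)) (by rw [hfg, RingHom.id_apply, ← smul_add, hfg]) }
    have hP : ∀ v ∈ P, π v = v := fun v hv =>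
      huniq _ (hf _) _ (hg _) _ hv 0 Q.zero_mem (by rw [hfg, add_zero])
    have hQ : ∀ v ∈ Q, π v = 0 := fun v hv =>
      huniq _ (hf _) _ (hg _) _ P.zero_mem v hv (by rw [hfg, zero_add])
    rcases H π fun v => hP _ (hf v) with h | h
    · left
      rw [Submodule.eq_bot_iff]
      intro v hv
      rw [← hP v hv, h]
    · right
      rw [Submodule.eq_bot_iff]
      intro v hv
      rw [← h v, hQ v hv]

end Indecomposable

section Lattice

variable {k n : ℕ} [NeZero n] {I J : KSubset k n} {h : ZMod n → ℕ} {s s' : ZMod n → ℂ⟦X⟧}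

theorem latBasisFst_fst (hg : IsGap I J h) (hs : Compat h s) (l : ZMod n) :
    (latBasisFst hg hs l).1.1 l = 1 := L.single_same I _ _

theorem latBasisFst_snd (hg : IsGap I J h) (hs : Compat h s) (l : ZMod n) :
    (latBasisFst hg hs l).1.2 l = s l := L.single_same I _ _

theorem latBasisSnd_fst (hg : IsGap I J h) (hs : Compat h s) (l : ZMod n) :
    (latBasisSnd hg hs l).1.1 l = 0 := rfl

theorem latBasisSnd_snd (hg : IsGap I J h) (hs : Compat h s) (l : ZMod n) :
    (latBasisSnd hg hs l).1.2 l = PowerSeries.X ^ h l := L.single_same I _ _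

/-- A lattice chain is indecomposable if every matrix that preserves it is scalar modulo `t`: an
idempotent matrix that is scalar modulo `t` is `0` or `1`. -/
theorem isIndecomposable_lat (hg : IsGap I J h) (hs : Compat h s) {p : ZMod n} (hp : h p = 0)
    (H : ∀ a b c d : ℂ⟦X⟧, (∀ l, PowerSeries.X ^ h l ∣ c + s l * d - s l * (a + s l * b)) →
      PowerSeries.constantCoeff b = 0 ∧ PowerSeries.constantCoeff c = 0 ∧
        PowerSeries.constantCoeff a = PowerSeries.constantCoeff d) :
    IsIndecomposable k n (lat hg hs) := by
  have : Nontrivial (lat hg hs) := by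
    refine ⟨latBasisFst hg hs p, 0, fun h0 => ?_⟩
    have := congrArg (fun v : lat hg hs => v.1.1 p) h0
    simp only [latBasisFst_fst] at this
    exact one_ne_zero this
  refine isIndecomposable_of_idempotent fun π hπ => ?_
  obtain ⟨a, b, c, d, h1, h2, h3⟩ := exists_matrix hg hs hs hp π
  obtain ⟨hb, hc, had⟩ := H a b c d h3
  have e1 := congrArg (fun v : lat hg hs => v.1.1 p) (hπ (latBasisSnd hg hs p))
  have e2 := congrArg (fun v : lat hg hs => v.1.2 p) (hπ (latBasisSnd hg hs p))
  have e3 := congrArg (fun v : lat hg hs => v.1.1 p) (hπ (latBasisFst hg hs p))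
  simp only [h1, h2, latBasisFst_fst, latBasisFst_snd, latBasisSnd_fst, latBasisSnd_snd, hp,
    pow_zero] at e1 e2 e3
  have e4 : a * a + b * c = a := by linear_combination e3 - s p * e1
  -- Modulo `t` the idempotent is the scalar `0` or `1`, so its trace is not `1`.
  have hne : a + d - 1 ≠ 0 := by
    intro h0
    have f1 := congrArg PowerSeries.constantCoeff h0
    have f2 := congrArg PowerSeries.constantCoeff e4
    simp only [map_add, map_sub, map_mul, map_one, map_zero, hb, had] at f1 f2
    have f3 : (1 : ℂ) = 0 := by
      linear_combination (-4) * f2 + (2 * PowerSeries.constantCoeff d - 1) * f1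
    exact one_ne_zero f3
  have hb0 : b = 0 := by
    refine (mul_eq_zero.1 (?_ : b * (a + d - 1) = 0)).resolve_right hne
    linear_combination e1
  have hdd : d * (d - 1) = 0 := by
    rw [hb0] at e2; linear_combination e2
  have haa : a * (a - 1) = 0 := by
    rw [hb0] at e4; linear_combination e4
  have had' : a = d := by
    rcases mul_eq_zero.1 haa with ha | ha <;> rcases mul_eq_zero.1 hdd with hd | hd
    · rw [ha, hd]
    · rw [ha, sub_eq_zero.1 hd] at had; simp at had
    · rw [sub_eq_zero.1 ha, hd] at had; simp at had
    · rw [sub_eq_zero.1 ha, sub_eq_zero.1 hd]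
  have hc0 : c = 0 := by
    have e5 := congrArg (fun v : lat hg hs => v.1.2 p) (hπ (latBasisFst hg hs p))
    simp only [h1, h2, latBasisFst_fst, latBasisFst_snd] at e5
    refine (mul_eq_zero.1 (?_ : c * (a + d - 1) = 0)).resolve_right hne
    linear_combination e5 - s p * e2
  rcases mul_eq_zero.1 hdd with hd | hd
  · left
    intro v
    refine lat_ext (fun l => ?_) fun l => ?_
    · rw [h1, had', hd, hb0, zero_mul, zero_mul, zero_add]; rfl
    · rw [h2, hd, hc0, zero_mul, zero_mul, zero_add]; rfl
  · right
    rw [sub_eq_zero] at hd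
    intro v
    refine lat_ext (fun l => ?_) fun l => ?_
    · rw [h1, had', hd, hb0, zero_mul, one_mul, add_zero]
    · rw [h2, hd, hc0, zero_mul, one_mul, zero_add]

theorem constantCoeff_eq_zero_of_X_pow_dvd {m : ℕ} (hm : m ≠ 0) {f : ℂ⟦X⟧}
    (hf : PowerSeries.X ^ m ∣ f) : PowerSeries.constantCoeff f = 0 :=
  PowerSeries.X_dvd_iff.1 ((dvd_pow_self _ hm).trans hf)

/-- Three directions of the walk at the lattice `Z²` make the module indecomposable: a matrix
over `ℂ` with three eigenlines is scalar. -/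
theorem isIndecomposable_lat_of_three (hg : IsGap I J h) (hs : Compat h s) {p : ZMod n}
    (hp : h p = 0) {q₁ q₂ q₃ : ZMod n} (h₁ : h q₁ ≠ 0) (h₂ : h q₂ ≠ 0) (h₃ : h q₃ ≠ 0)
    (h₁₂ : PowerSeries.constantCoeff (s q₁) ≠ PowerSeries.constantCoeff (s q₂))
    (h₁₃ : PowerSeries.constantCoeff (s q₁) ≠ PowerSeries.constantCoeff (s q₃))
    (h₂₃ : PowerSeries.constantCoeff (s q₂) ≠ PowerSeries.constantCoeff (s q₃)) :
    IsIndecomposable k n (lat hg hs) := by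
  refine isIndecomposable_lat hg hs hp fun a b c d H => ?_
  have e₁ := constantCoeff_eq_zero_of_X_pow_dvd h₁ (H q₁)
  have e₂ := constantCoeff_eq_zero_of_X_pow_dvd h₂ (H q₂)
  have e₃ := constantCoeff_eq_zero_of_X_pow_dvd h₃ (H q₃)
  simp only [map_add, map_sub, map_mul] at e₁ e₂ e₃
  generalize PowerSeries.constantCoeff (s q₁) = x at *
  generalize PowerSeries.constantCoeff (s q₂) = y at *
  generalize PowerSeries.constantCoeff (s q₃) = z at *
  generalize PowerSeries.constantCoeff a = a at *
  generalize PowerSeries.constantCoeff b = b at *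
  generalize PowerSeries.constantCoeff c = c at *
  generalize PowerSeries.constantCoeff d = d at *
  have f₁ : d - a - (x + y) * b = 0 := by
    refine (mul_eq_zero.1 (?_ : (x - y) * _ = 0)).resolve_left (sub_ne_zero.2 h₁₂)
    linear_combination e₁ - e₂
  have f₂ : d - a - (x + z) * b = 0 := by
    refine (mul_eq_zero.1 (?_ : (x - z) * _ = 0)).resolve_left (sub_ne_zero.2 h₁₃)
    linear_combination e₁ - e₃
  have hb : b = 0 := by
    refine (mul_eq_zero.1 (?_ : (y - z) * _ = 0)).resolve_left (sub_ne_zero.2 h₂₃)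
    linear_combination f₂ - f₁
  have had : a = d := by rw [hb] at f₁; linear_combination -f₁
  refine ⟨hb, ?_, had⟩
  rw [hb, had] at e₁; linear_combination e₁

/-- A branching at distance one from the lattice `Z²`, with branches through `s = 0` and `s = t`,
together with a step from `Z²` in the direction `s = 1` makes the module indecomposable. -/
theorem isIndecomposable_lat_of_branch (hg : IsGap I J h) (hs : Compat h s) {p : ZMod n}
    (hp : h p = 0) {q₁ q₂ q₃ : ZMod n} (h₁ : 2 ≤ h q₁) (h₂ : 2 ≤ h q₂) (h₃ : h q₃ ≠ 0)
    (hs₁ : s q₁ = 0) (hs₂ : s q₂ = PowerSeries.X) (hs₃ : s q₃ = 1) :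
    IsIndecomposable k n (lat hg hs) := by
  refine isIndecomposable_lat hg hs hp fun a b c d H => ?_
  have e₁ := (pow_dvd_pow _ h₁).trans (H q₁)
  have e₂ := (pow_dvd_pow _ h₂).trans (H q₂)
  have e₃ := constantCoeff_eq_zero_of_X_pow_dvd h₃ (H q₃)
  rw [hs₁, zero_mul, add_zero, zero_mul, sub_zero] at e₁
  rw [hs₂] at e₂
  have hc := constantCoeff_eq_zero_of_X_pow_dvd two_ne_zero e₁
  have e₄ : (PowerSeries.X : ℂ⟦X⟧) * PowerSeries.X ∣ PowerSeries.X * (a - d) := by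
    rw [← sq]
    refine (dvd_sub (dvd_sub e₁ (dvd_mul_right (PowerSeries.X ^ 2) b)) e₂).trans (dvd_of_eq ?_)
    ring
  have had := PowerSeries.X_dvd_iff.1 ((mul_dvd_mul_iff_left PowerSeries.X_ne_zero).1 e₄)
  rw [map_sub, sub_eq_zero] at had
  rw [hs₃] at e₃
  simp only [map_add, map_sub, hc, had, one_mul] at e₃
  refine ⟨?_, hc, had⟩
  linear_combination -e₃

/-- If all lattices are compatible with the two lines spanned by `(1, z₁)` and `(1, z₂)`, which are
distinct modulo `t`, then the projection to the first along the second is an idempotent. -/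
theorem not_isIndecomposable_lat (hg : IsGap I J h) (hs : Compat h s) (z₁ z₂ : ℂ⟦X⟧)
    (hu : IsUnit (z₁ - z₂)) (H : ∀ l, PowerSeries.X ^ h l ∣ (s l - z₁) * (s l - z₂)) :
    ¬ IsIndecomposable k n (lat hg hs) := by
  intro hind
  obtain ⟨e, he⟩ := hu.exists_right_inv
  have he0 : e ≠ 0 := by rintro rfl; simp at he
  have H' : ∀ l, PowerSeries.X ^ h l ∣ -z₁ * z₂ * e + s l * (z₁ * e) -
      s l * (-z₂ * e + s l * e) := by
    intro l
    refine ((H l).mul_right (-e)).trans (dvd_of_eq ?_)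
    ring
  have key := hind.idempotent (latHom hg hs hs (-z₂ * e) e (-z₁ * z₂ * e) (z₁ * e) H')
    fun v => lat_ext
      (fun l => by
        simp only [latHom_fst, latHom_snd]
        linear_combination e * (v.1.2 l - z₂ * v.1.1 l) * he)
      (fun l => by
        simp only [latHom_fst, latHom_snd]
        linear_combination e * z₁ * (v.1.2 l - z₂ * v.1.1 l) * he)
  have hne : e * (PowerSeries.X : ℂ⟦X⟧) ^ h 0 ≠ 0 :=
    mul_ne_zero he0 (pow_ne_zero _ PowerSeries.X_ne_zero)
  rcases key with key | key
  · have := congrArg (fun v : lat hg hs => v.1.1 0) (key (latBasisSnd hg hs 0))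
    simp only [latHom_fst, latBasisSnd_fst, latBasisSnd_snd] at this
    refine hne (Eq.trans ?_ this); ring
  · have := congrArg (fun v : lat hg hs => v.1.1 0) (key (latBasisSnd hg hs 0))
    simp only [latHom_fst, latBasisSnd_fst, latBasisSnd_snd] at this
    refine hne (Eq.trans ?_ this); ring

theorem isUnit_of_constantCoeff_ne_zero {f : ℂ⟦X⟧} (hf : PowerSeries.constantCoeff f ≠ 0) :
    IsUnit f :=
  PowerSeries.isUnit_iff_constantCoeff.2 (isUnit_iff_ne_zero.2 hf)

theorem isUnit_of_not_X_dvd {f : ℂ⟦X⟧} (hf : ¬ PowerSeries.X ∣ f) : IsUnit f :=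
  isUnit_of_constantCoeff_ne_zero fun h => hf (PowerSeries.X_dvd_iff.2 h)

/-- The length of the common part of the paths from `Z²` to two lattices of the chain is an
invariant of the module. -/
theorem dvd_sub_of_latEquiv (hg : IsGap I J h) (hs : Compat h s) (hs' : Compat h s') {p : ZMod n}
    (hp : h p = 0) (φ : lat hg hs ≃ₗ[B k n] lat hg hs') {i j : ZMod n} {m : ℕ} (hi : m ≤ h i)
    (hj : m ≤ h j) (hij : PowerSeries.X ^ m ∣ s i - s j) : PowerSeries.X ^ m ∣ s' i - s' j := by
  rcases Nat.eq_zero_or_pos m with rfl | hm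
  · simp
  obtain ⟨a, b, c, d, h1, h2, h3⟩ := exists_matrix hg hs hs' hp φ.toLinearMap
  obtain ⟨a', b', c', d', h1', h2', -⟩ := exists_matrix hg hs' hs hp φ.symm.toLinearMap
  have hinv : ∀ v, φ.symm.toLinearMap (φ.toLinearMap v) = v := φ.symm_apply_apply
  have e1 := congrArg (fun v : lat hg hs => v.1.1 p) (hinv (latBasisSnd hg hs p))
  have e2 := congrArg (fun v : lat hg hs => v.1.1 p) (hinv (latBasisFst hg hs p))
  simp only [h1', h1, h2, latBasisSnd_fst, latBasisSnd_snd, latBasisFst_fst, latBasisFst_snd, hp,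
    pow_zero] at e1 e2
  have e3 : a' * (a + s i * b) + b' * (c + s i * d) = 1 := by
    linear_combination e2 + (s i - s p) * e1
  have f1 := (pow_dvd_pow _ hi).trans (h3 i)
  have f2 := (pow_dvd_pow _ hj).trans (h3 j)
  have hu : IsUnit (a + s i * b) := by
    refine isUnit_of_not_X_dvd fun hX => ?_
    have hX' : PowerSeries.X ∣ c + s i * d := by
      have := dvd_add ((dvd_pow_self _ hm.ne').trans f1) (hX.mul_left (s' i))
      rwa [sub_add_cancel] at this
    have h4 := dvd_add (hX.mul_left a') (hX'.mul_left b')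
    rw [e3] at h4
    have := PowerSeries.X_dvd_iff.1 h4
    simp at this
  refine (hu.dvd_mul_right).1 (?_ : _ ∣ (s' i - s' j) * (a + s i * b))
  refine (dvd_add (dvd_sub f2 f1) (hij.mul_right (d - s' j * b))).trans (dvd_of_eq ?_)
  ring

/-- The lattice chain consists of at most three legs, two of them of length one, that start at
`Z²` and pass through the lattices at `q₁`, `q₂`, `q₃`, whatever the choice of `s`. -/
def IsTripod (h : ZMod n → ℕ) (q₁ q₂ q₃ : ZMod n) : Prop :=
  ∀ i, h i = 0 ∨ (h i = 1 ∧ ∀ s, Compat h s → PowerSeries.X ∣ s i - s q₁) ∨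
    (h i = 1 ∧ ∀ s, Compat h s → PowerSeries.X ∣ s i - s q₂) ∨
    ∀ s, Compat h s → PowerSeries.X ^ h i ∣ s i - s q₃

variable {q₁ q₂ q₃ : ZMod n}

/-- The legs of an indecomposable tripod have distinct directions. -/
theorem IsTripod.not_dvd (hT : IsTripod h q₁ q₂ q₃) (hg : IsGap I J h) (hs : Compat h s)
    (hind : IsIndecomposable k n (lat hg hs)) :
    ¬ PowerSeries.X ∣ s q₁ - s q₃ ∧ ¬ PowerSeries.X ∣ s q₂ - s q₃ ∧
      ¬ PowerSeries.X ∣ s q₁ - s q₂ := by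
  have main : ∀ z, IsUnit (s q₃ - z) →
      (PowerSeries.X ∣ s q₁ - s q₃ ∨ PowerSeries.X ∣ s q₁ - z) →
      (PowerSeries.X ∣ s q₂ - s q₃ ∨ PowerSeries.X ∣ s q₂ - z) → False := by
    intro z hz h1 h2
    refine not_isIndecomposable_lat hg hs (s q₃) z hz (fun l => ?_) hind
    rcases hT l with h0 | ⟨h0, h3⟩ | ⟨h0, h3⟩ | h3
    · rw [h0]; simp
    · rw [h0, pow_one]
      have h3 := h3 s hs
      rcases h1 with h1 | h1
      · refine Dvd.dvd.mul_right ?_ _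
        have := dvd_add h3 h1
        rwa [sub_add_sub_cancel] at this
      · refine Dvd.dvd.mul_left ?_ _
        have := dvd_add h3 h1
        rwa [sub_add_sub_cancel] at this
    · rw [h0, pow_one]
      have h3 := h3 s hs
      rcases h2 with h1 | h1
      · refine Dvd.dvd.mul_right ?_ _
        have := dvd_add h3 h1
        rwa [sub_add_sub_cancel] at this
      · refine Dvd.dvd.mul_left ?_ _
        have := dvd_add h3 h1
        rwa [sub_add_sub_cancel] at this
    · exact (h3 s hs).mul_right _
  have two : ∀ q, (PowerSeries.X ∣ s q₁ - s q₃ ∨ PowerSeries.X ∣ s q₁ - s q) →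
      (PowerSeries.X ∣ s q₂ - s q₃ ∨ PowerSeries.X ∣ s q₂ - s q) → False := by
    intro q h1 h2
    by_cases hq : PowerSeries.X ∣ s q - s q₃
    · refine main (s q₃ + 1) (by simp) (Or.inl ?_) (Or.inl ?_)
      · rcases h1 with h1 | h1
        · exact h1
        · have := dvd_add h1 hq
          rwa [sub_add_sub_cancel] at this
      · rcases h2 with h1 | h1
        · exact h1
        · have := dvd_add h1 hq
          rwa [sub_add_sub_cancel] at this
    · refine main (s q) ?_ h1 h2
      rw [← neg_sub, IsUnit.neg_iff]
      exact isUnit_of_not_X_dvd hq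
  refine ⟨fun h1 => two q₂ (Or.inl h1) (Or.inr (by simp)), fun h1 => two q₁ (Or.inr (by simp))
    (Or.inl h1), fun h1 => two q₂ (Or.inr h1) (Or.inr (by simp))⟩

/-- Indecomposable tripods with legs of the same lengths, at most one of them of length more than
one, are isomorphic: a projective transformation of the line takes the three directions of the one
to those of the other. -/
theorem IsTripod.nonempty_latEquiv (hT : IsTripod h q₁ q₂ q₃) (hg : IsGap I J h)
    (hs : Compat h s) (hs' : Compat h s') (hind : IsIndecomposable k n (lat hg hs))
    (hind' : IsIndecomposable k n (lat hg hs')) :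
    Nonempty (lat hg hs ≃ₗ[B k n] lat hg hs') := by
  obtain ⟨n1, n2, n3⟩ := hT.not_dvd hg hs hind
  obtain ⟨n1', n2', n3'⟩ := hT.not_dvd hg hs' hind'
  rw [PowerSeries.X_dvd_iff, map_sub] at n1 n2 n3 n1' n2' n3'
  obtain ⟨x, hx⟩ : ∃ x, x = PowerSeries.constantCoeff (s q₁) - PowerSeries.constantCoeff (s q₃) :=
    ⟨_, rfl⟩
  obtain ⟨y, hy⟩ : ∃ y, y = PowerSeries.constantCoeff (s q₂) - PowerSeries.constantCoeff (s q₃) :=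
    ⟨_, rfl⟩
  obtain ⟨x', hx'⟩ :
    ∃ x, x = PowerSeries.constantCoeff (s' q₁) - PowerSeries.constantCoeff (s' q₃) := ⟨_, rfl⟩
  obtain ⟨y', hy'⟩ :
    ∃ y, y = PowerSeries.constantCoeff (s' q₂) - PowerSeries.constantCoeff (s' q₃) := ⟨_, rfl⟩
  have n4 : x - y ≠ 0 := by
    rw [hx, hy]; simpa using n3
  have n4' : x' - y' ≠ 0 := by
    rw [hx', hy']; simpa using n3'
  rw [← hx] at n1
  rw [← hy] at n2
  rw [← hx'] at n1'
  rw [← hy'] at n2'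
  -- The transformation `σ ↦ σ / (α + β σ)` fixes `0` and takes `x`, `y` to `x'`, `y'`.
  obtain ⟨β, hβ⟩ : ∃ β, β = (x / x' - y / y') / (x - y) := ⟨_, rfl⟩
  obtain ⟨α, hα⟩ : ∃ α, α = x / x' - β * x := ⟨_, rfl⟩
  have hx1 : x - x' * (α + x * β) = 0 := by
    rw [hα]; field_simp; ring
  have hy1 : y - y' * (α + y * β) = 0 := by
    rw [hα, hβ]; field_simp; ring
  have hα0 : α ≠ 0 := by
    have : α = x * y * (x' - y') / (x' * y' * (x - y)) := by
      rw [hα, hβ]; field_simp; ring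
    rw [this]
    exact div_ne_zero (mul_ne_zero (mul_ne_zero n1 n2) n4')
      (mul_ne_zero (mul_ne_zero n1' n2') n4)
  set A : ℂ⟦X⟧ := PowerSeries.C α
  set E : ℂ⟦X⟧ := PowerSeries.C β
  have cond : ∀ l, (s l - s q₃) - (s' l - s' q₃) * (A + (s l - s q₃) * E) =
      (s' q₃ * (A - E * s q₃) - s q₃) + s l * (1 + s' q₃ * E) -
        s' l * ((A - E * s q₃) + s l * E) := fun l => by ring
  refine GrCat.nonempty_latEquiv hg hs hs' (A - E * s q₃) E (s' q₃ * (A - E * s q₃) - s q₃)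
    (1 + s' q₃ * E) (fun l => ?_) ?_
  · rw [← cond]
    rcases hT l with h0 | ⟨h0, h3⟩ | ⟨h0, h3⟩ | h3
    · rw [h0]; simp
    · rw [h0, pow_one, PowerSeries.X_dvd_iff]
      have e1 := PowerSeries.X_dvd_iff.1 (h3 s hs)
      have e2 := PowerSeries.X_dvd_iff.1 (h3 s' hs')
      rw [map_sub, sub_eq_zero] at e1 e2
      simp only [map_sub, map_mul, map_add, e1, e2, ← hx, ← hx', A, E,
        PowerSeries.constantCoeff_C]
      exact hx1
    · rw [h0, pow_one, PowerSeries.X_dvd_iff]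
      have e1 := PowerSeries.X_dvd_iff.1 (h3 s hs)
      have e2 := PowerSeries.X_dvd_iff.1 (h3 s' hs')
      rw [map_sub, sub_eq_zero] at e1 e2
      simp only [map_sub, map_mul, map_add, e1, e2, ← hy, ← hy', A, E,
        PowerSeries.constantCoeff_C]
      exact hy1
    · exact dvd_sub (h3 s hs) ((h3 s' hs').mul_right _)
  · refine isUnit_of_constantCoeff_ne_zero ?_
    have : (A - E * s q₃) * (1 + s' q₃ * E) - E * (s' q₃ * (A - E * s q₃) - s q₃) = A := by ring
    rw [this]
    simpa [A] using hα0

end Lattice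

/-! ### Extending functionals to homomorphisms into rank one modules -/

section Extension

variable {k n : ℕ}

/-- The factor by which `x ^ j` acts from the vertex `p - j` to the vertex `p` of `L_I`. -/
noncomputable def pathProd (I : KSubset k n) (p : ZMod n) (j : ℕ) : ℂ⟦X⟧ :=
  ∏ u ∈ Finset.range j, xCoeff I (p - u)

theorem pathProd_ne_zero (I : KSubset k n) (p : ZMod n) (j : ℕ) : pathProd I p j ≠ 0 :=
  Finset.prod_ne_zero_iff.2 fun _ _ => xCoeff_ne_zero I _

theorem pathProd_succ (I : KSubset k n) (p : ZMod n) (j : ℕ) :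
    pathProd I p (j + 1) = pathProd I p j * xCoeff I (p - j) := Finset.prod_range_succ _ _

theorem IsGap.pathProd_eq {I J : KSubset k n} {h : ZMod n → ℕ} (hg : IsGap I J h) {p : ZMod n}
    (hp : h p = 0) (j : ℕ) :
    pathProd J p j = PowerSeries.X ^ h (p - j) * pathProd I p j := by
  induction j with
  | zero => simp [pathProd, hp]
  | succ j ih =>
    have h1 := hg.mul_xCoeff (p - j)
    have h2 : p - ((j + 1 : ℕ) : ZMod n) = p - j - 1 := by push_cast; ring
    rw [pathProd_succ, ih, pathProd_succ, h2]
    linear_combination pathProd I p j * h1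

theorem pathProd_initial (S : KSubset k n) (p : ZMod n)
    (hS : ∀ l, l ∈ S.1 ↔ (p - l).val < k) {j : ℕ} (hj : j ≤ n) :
    pathProd S p j = PowerSeries.X ^ (j - k) := by
  induction j with
  | zero => simp [pathProd]
  | succ j ih =>
    have hv : (p - (p - (j : ZMod n))).val = j := by
      rw [sub_sub_cancel, ZMod.val_natCast_of_lt hj]
    rw [pathProd_succ, ih (by omega), xCoeff]
    split_ifs with h
    · rw [hS, hv] at h
      rw [mul_one, show j + 1 - k = j - k by omega]
    · rw [hS, hv] at h
      rw [← pow_succ, show j + 1 - k = j - k + 1 by omega]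

variable [NeZero n]

section

variable {M : Type*} [AddCommGroup M] [Module (B k n) M]

theorem eq_sum_idem_smul (m : M) : m = ∑ i, idem k n i • m := by
  rw [← Finset.sum_smul, sum_idem, one_smul]

theorem idem_smul_bX_pow_smul (p : ZMod n) (j : ℕ) (m : M) :
    idem k n p • bX k n ^ j • m = idem k n p • bX k n ^ j • idem k n (p - j) • m := by
  rw [← mul_smul, ← mul_smul, ← mul_smul, mul_assoc, ← idem_mul_bX_pow, ← mul_assoc, idem_mul_self]

end

variable {M : Type*} [AddCommGroup M] [Module ℂ⟦X⟧ M] [Module (B k n) M]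
  [IsScalarTower ℂ⟦X⟧ (B k n) M]

theorem sub_natCast_val_sub (p l : ZMod n) : p - ((p - l).val : ZMod n) = l := by
  rw [ZMod.natCast_zmod_val]; ring

theorem val_add_one {a : ZMod n} (h : a.val + 1 < n) : (a + 1).val = a.val + 1 := by
  have : a + 1 = ((a.val + 1 : ℕ) : ZMod n) := by
    push_cast; rw [ZMod.natCast_zmod_val]
  rw [this, ZMod.val_natCast_of_lt h]

theorem smul_center_comm (b : B k n) (a : ℂ⟦X⟧) (m : M) : b • a • m = a • b • m := by
  rw [← algebraMap_smul (B k n) a m, ← algebraMap_smul (B k n) a (b • m), ← mul_smul, ← mul_smul,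
    Algebra.commutes]

/-- A functional at the vertex `p` extends to a homomorphism into `L_I` if its values along the
paths of arrows `x` ending at `p` are divisible by the factors with which these paths act on
`L_I`. -/
theorem exists_extension (I : KSubset k n) (p : ZMod n) (ψ : M →ₗ[ℂ⟦X⟧] ℂ⟦X⟧)
    (H : ∀ j < n, ∀ m, pathProd I p j ∣ ψ (idem k n p • bX k n ^ j • m)) :
    ∃ G : M →ₗ[B k n] L I, ∀ m l, pathProd I p (p - l).val * G m l =
      ψ (idem k n p • bX k n ^ (p - l).val • m) := by
  have H' : ∀ m, ∃ v : L I, ∀ l, ψ (idem k n p • bX k n ^ (p - l).val • m) =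
      pathProd I p (p - l).val * v l := fun m => by
    choose v hv using fun l => H (p - l).val (ZMod.val_lt _) m
    exact ⟨v, hv⟩
  choose f hf using H'
  have hcancel : ∀ {l : ZMod n} {a b : ℂ⟦X⟧},
      pathProd I p (p - l).val * a = pathProd I p (p - l).val * b → a = b :=
    fun h => mul_left_cancel₀ (pathProd_ne_zero I p _) h
  have hkn : k ≤ n := by
    have := Finset.card_le_univ I.1
    rwa [I.2, ZMod.card] at this
  let G₀ : M →ₗ[ℂ⟦X⟧] L I :=
    { toFun := f
      map_add' := fun v w => L.ext fun l => hcancel (l := l) (by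
        rw [← hf, L.add_apply, mul_add, ← hf, ← hf, smul_add, smul_add, map_add])
      map_smul' := fun a v => L.ext fun l => hcancel (l := l) (by
        rw [← hf, RingHom.id_apply, L.smul_apply, mul_left_comm, ← hf, smul_center_comm,
          smul_center_comm, map_smul, smul_eq_mul]) }
  refine ⟨linearMapOfGenerators G₀ (fun i m => L.ext fun l => hcancel (l := l) ?_)
    (fun m => L.ext fun l => hcancel (l := l) ?_) (bX_smul_injective I), fun m l => (hf m l).symm⟩
  · rw [idem_smul_apply]
    change _ * f (idem k n i • m) l = _
    rw [← hf, idem_smul_bX_pow_smul, sub_natCast_val_sub, ← mul_smul (idem k n l)]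
    split_ifs with hl
    · rw [hl, idem_mul_self]
      change _ = _ * f m i
      rw [← hf, idem_smul_bX_pow_smul p _ m, sub_natCast_val_sub]
    · rw [idem_mul_ne hl, zero_smul, smul_zero, smul_zero, map_zero, mul_zero]
  · rw [bX_smul_apply]
    change _ * f (bX k n • m) l = _ * (xCoeff I l * f m (l - 1))
    have hsucc : pathProd I p ((p - l).val + 1) = pathProd I p (p - l).val * xCoeff I l := by
      rw [pathProd_succ, sub_natCast_val_sub]
    have hcast : p - (l - 1) = (((p - l).val + 1 : ℕ) : ZMod n) := by
      push_cast; rw [ZMod.natCast_zmod_val]; ring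
    rw [← hf, ← mul_smul (bX k n ^ _), ← pow_succ, ← mul_assoc, ← hsucc]
    by_cases hl : (p - l).val + 1 < n
    · have : (p - (l - 1)).val = (p - l).val + 1 := by rw [hcast, ZMod.val_natCast_of_lt hl]
      rw [← this, ← hf]
    · have hn : (p - l).val + 1 = n := le_antisymm (ZMod.val_lt _) (not_lt.1 hl)
      have h0 : p - (l - 1) = 0 := by rw [hcast, hn, ZMod.natCast_self]
      have h1 := hf m (l - 1)
      rw [h0, ZMod.val_zero, pow_zero, one_smul, pathProd, Finset.prod_range_zero, one_mul] at h1
      rw [hn, bX_pow_card hkn, algebraMap_smul, smul_center_comm, map_smul, h1, smul_eq_mul,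
        pathProd, prod_cycle]

/-- The functional on a module with profile `I ∣ J` that splits the inclusion of `L_J` at a vertex
where the rims meet extends to a homomorphism into `L_I`. -/
theorem exists_hom_extending_scale {I J : KSubset k n} {h : ZMod n → ℕ} (hg : IsGap I J h)
    {p : ZMod n} (hp : h p = 0) (f : L J →ₗ[B k n] M) (g : M →ₗ[B k n] L I)
    (hf : Function.Injective f) (hfg : Function.Exact f g) (hg' : Function.Surjective g) :
    ∃ r : M →ₗ[B k n] L I, ∀ v l, r (f v) l = PowerSeries.X ^ h l * v l := by
  have : Module.Free ℂ⟦X⟧ (L I) := inferInstanceAs (Module.Free ℂ⟦X⟧ (ZMod n → ℂ⟦X⟧))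
  let gZ : M →ₗ[ℂ⟦X⟧] L I :=
    { toFun := g, map_add' := map_add g, map_smul' := map_smul_center g }
  obtain ⟨σ, hσ⟩ := Module.projective_lifting_property gZ LinearMap.id hg'
  have hσ' : ∀ v, g (σ v) = v := fun v => LinearMap.congr_fun hσ v
  have hex : ∀ m, ∃ v, f v = m - σ (g m) := fun m =>
    (hfg _).1 (by rw [map_sub, hσ', sub_self])
  choose ρ hρ using hex
  let ψ : M →ₗ[ℂ⟦X⟧] ℂ⟦X⟧ :=
    { toFun := fun m => ρ m p
      map_add' := fun v w => by
        have : ρ (v + w) = ρ v + ρ w := hf (by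
          rw [hρ, map_add, map_add f, hρ, hρ, map_add]; abel)
        rw [this]; rfl
      map_smul' := fun a v => by
        have : ρ (a • v) = a • ρ v := hf (by
          rw [hρ, map_smul_center g, map_smul_center f, hρ, map_smul, smul_sub])
        rw [this]; rfl }
  have hψ : ∀ v, ψ (f v) = v p := fun v => by
    have : ρ (f v) = v := hf (by
      rw [hρ, (hfg (f v)).2 ⟨v, rfl⟩, map_zero, sub_zero])
    change ρ (f v) p = v p
    rw [this]
  have hdvd : ∀ j, ∀ m, pathProd I p j ∣ ψ (idem k n p • bX k n ^ j • m) := by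
    intro j
    induction j with
    | zero => intro m; simp [pathProd]
    | succ j ih =>
      intro m
      rw [pathProd_succ]
      by_cases hj : p - (j : ZMod n) ∈ I.1
      · rw [xCoeff, if_pos hj, mul_one, pow_succ, mul_smul]
        exact ih _
      -- If `x` acts as `t` on the quotient, then `y` acts as `1`, so that up to an element of the
      -- submodule every element at the start of the arrow is in the image of `y`.
      obtain ⟨w, hw⟩ := hg' (L.single I (p - j) 1)
      set q : ZMod n := p - ((j + 1 : ℕ) : ZMod n) with hq
      have hq1 : q + 1 = p - j := by rw [hq]; push_cast; ring
      obtain ⟨β, hβ⟩ : ∃ β, f β = idem k n q • (m - (g m q) • bY k n • w) := by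
        refine (hfg _).1 (L.ext fun l => ?_)
        rw [map_smul, map_sub, map_smul_center, map_smul, hw, idem_smul_apply]
        split_ifs with hl
        · rw [hl, L.sub_apply, L.smul_apply, bY_smul_apply, hq1, L.single_same, yCoeff, if_neg hj]
          simp
        · rfl
      have hm : idem k n p • bX k n ^ (j + 1) • m =
          f (idem k n p • bX k n ^ (j + 1) • β) +
            (g m q * PowerSeries.X) • idem k n p • bX k n ^ j • w := by
        rw [map_smul, map_smul, hβ, ← idem_smul_bX_pow_smul, smul_sub, smul_sub,
          smul_center_comm _ (g m q), smul_center_comm _ (g m q), pow_succ, mul_smul _ _ (bY k n • w),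
          bX_bY_smul, smul_center_comm _ PowerSeries.X, smul_center_comm _ PowerSeries.X, mul_smul,
          mul_smul (g m q)]
        exact (sub_add_cancel _ _).symm
      rw [hm, map_add, hψ, map_smul, idem_smul_apply, if_pos rfl, bX_pow_smul_apply]
      refine dvd_add ?_ ?_
      · change _ ∣ pathProd J p (j + 1) * _
        rw [hg.pathProd_eq hp, ← pathProd_succ]
        exact (dvd_mul_left _ _).mul_right _
      · rw [xCoeff, if_neg hj, smul_eq_mul, mul_comm (g m q), mul_assoc, mul_comm (pathProd I p j)]
        exact mul_dvd_mul_left _ ((ih w).mul_left _)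
  obtain ⟨r, hr⟩ := exists_extension I p ψ fun j _ => hdvd j
  refine ⟨r, fun v l => mul_left_cancel₀ (pathProd_ne_zero I p (p - l).val) ?_⟩
  rw [hr, ← map_smul, ← map_smul, hψ, idem_smul_apply, if_pos rfl, bX_pow_smul_apply,
    sub_natCast_val_sub]
  change pathProd J p _ * _ = _
  rw [hg.pathProd_eq hp, sub_natCast_val_sub]
  ring

/-- Every module with profile `I ∣ J` is a lattice chain. -/
theorem exists_latEquiv {I J : KSubset k n} {h : ZMod n → ℕ} (hg : IsGap I J h)
    {p : ZMod n} (hp : h p = 0) (hM : HasProfile M I J) :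
    ∃ (s : ZMod n → ℂ⟦X⟧) (hs : Compat h s), Nonempty (M ≃ₗ[B k n] lat hg hs) := by
  obtain ⟨f, g, hf, hfg, hg'⟩ := hM
  obtain ⟨r, hr⟩ := exists_hom_extending_scale hg hp f g hf hfg hg'
  choose w hw using fun l => hg' (L.single I l 1)
  let s : ZMod n → ℂ⟦X⟧ := fun l => r (w l) l
  have key : ∀ m l, PowerSeries.X ^ h l ∣ r m l - s l * g m l := by
    intro m l
    obtain ⟨β, hβ⟩ : ∃ β, f β = idem k n l • (m - g m l • w l) := by
      refine (hfg _).1 (L.ext fun i => ?_)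
      rw [map_smul, map_sub, map_smul_center, hw, idem_smul_apply]
      split_ifs with hl
      · rw [hl, L.sub_apply, L.smul_apply, L.single_same]; simp
      · rfl
    refine ⟨β l, ?_⟩
    rw [← hr, hβ, map_smul, map_sub, map_smul_center, idem_smul_apply, if_pos rfl, L.sub_apply,
      L.smul_apply, mul_comm]
  have hs : Compat h s := by
    refine Compat.of_dvd hg (fun l => ?_) fun l => ?_
    · have h1 := key (bX k n • w (l - 1)) l
      rw [map_smul, map_smul, bX_smul_apply, bX_smul_apply, hw, L.single_same] at h1
      refine (h1.mul_right (-1)).trans (dvd_of_eq ?_)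
      change (xCoeff I l * s (l - 1) - _) * _ = _
      ring
    · have h1 := key (bY k n • w l) (l - 1)
      rw [map_smul, map_smul, bY_smul_apply, bY_smul_apply, hw, sub_add_cancel,
        L.single_same] at h1
      refine h1.trans (dvd_of_eq ?_)
      change yCoeff I l * s l - _ = _
      ring
  refine ⟨s, hs, ⟨LinearEquiv.ofBijective
    ((g.prod r).codRestrict (lat hg hs) fun m l => key m l) ⟨fun m m' hmm => ?_, fun v => ?_⟩⟩⟩
  · have h1 : g m = g m' := congrArg (fun v : lat hg hs => v.1.1) hmm
    have h2 : r m = r m' := congrArg (fun v : lat hg hs => v.1.2) hmm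
    obtain ⟨β, hβ⟩ := (hfg (m - m')).1 (by rw [map_sub, h1, sub_self])
    have hβ0 : β = 0 := L.ext fun l => X_pow_mul_left_cancel (a := h l) (by
      rw [← hr, hβ, map_sub, h2, sub_self, L.zero_apply, L.zero_apply, mul_zero])
    rw [hβ0, map_zero] at hβ
    exact sub_eq_zero.1 hβ.symm
  · obtain ⟨m, hm⟩ := hg' v.1.1
    obtain ⟨β, hβ⟩ : ∃ β : L J, ∀ l, PowerSeries.X ^ h l * β l = v.1.2 l - r m l := by
      choose β hβ using v.2
      choose γ hγ using key m
      refine ⟨fun l => β l - γ l, fun l => ?_⟩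
      rw [mul_sub, ← hβ, ← hγ, hm]
      ring
    refine ⟨m + f β, lat_ext (fun l => ?_) fun l => ?_⟩
    · change g (m + f β) l = _
      rw [map_add, (hfg (f β)).2 ⟨_, rfl⟩, add_zero, hm]
    · change r (m + f β) l = _
      rw [map_add, L.add_apply, hr, hβ]
      ring

end Extension

/-! ### Existence of profiles -/

section Profile

variable {k n : ℕ} [NeZero n] {M : Type*} [AddCommGroup M] [Module ℂ⟦X⟧ M] [Module (B k n) M]
  [IsScalarTower ℂ⟦X⟧ (B k n) M]

theorem X_pow_dvd_X_pow_iff {a b : ℕ} :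
    (PowerSeries.X : ℂ⟦X⟧) ^ a ∣ PowerSeries.X ^ b ↔ a ≤ b :=
  pow_dvd_pow_iff PowerSeries.X_ne_zero PowerSeries.X_prime.not_isUnit

/-- A submodule of `L_S` of full rank that is given by powers of `t` at the vertices is isomorphic
to a module `L_I`. -/
theorem exists_isGap (S : KSubset k n) (m : ZMod n → ℕ) (P : Submodule (B k n) (L S))
    (hP : ∀ v, v ∈ P ↔ ∀ l, PowerSeries.X ^ m l ∣ v l) : ∃ I : KSubset k n, IsGap S I m := by
  have hmem : ∀ l, L.single S l (PowerSeries.X ^ m l) ∈ P := fun l => (hP _).2 fun i => by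
    rw [L.single_apply]
    split_ifs with hi
    · rw [hi]
    · exact dvd_zero _
  have hx : ∀ l, m l ≤ m (l - 1) + (if l ∈ S.1 then 0 else 1) := by
    intro l
    have h1 := (hP _).1 (P.smul_mem (bX k n) (hmem (l - 1))) l
    rw [bX_smul_apply, L.single_same, xCoeff] at h1
    rw [← X_pow_dvd_X_pow_iff]
    refine h1.trans (dvd_of_eq ?_)
    split_ifs
    · simp
    · rw [pow_succ']
  have hy : ∀ l, m (l - 1) ≤ m l + (if l ∈ S.1 then 1 else 0) := by
    intro l
    have h1 := (hP _).1 (P.smul_mem (bY k n) (hmem l)) (l - 1)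
    rw [bY_smul_apply, sub_add_cancel, L.single_same, yCoeff] at h1
    rw [← X_pow_dvd_X_pow_iff]
    refine h1.trans (dvd_of_eq ?_)
    split_ifs
    · rw [pow_succ']
    · simp
  set I : Finset (ZMod n) :=
    Finset.univ.filter fun l => m l + (if l ∈ S.1 then 1 else 0) = m (l - 1) + 1 with hI
  have hgap : ∀ l, m l + (if l ∈ S.1 then 1 else 0) = m (l - 1) + (if l ∈ I then 1 else 0) := by
    intro l
    have h1 := hx l
    have h2 := hy l
    by_cases hl : l ∈ I
    · rw [if_pos hl]
      simpa [hI] using hl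
    · rw [if_neg hl]
      have h3 : m l + (if l ∈ S.1 then 1 else 0) ≠ m (l - 1) + 1 := by simpa [hI] using hl
      split_ifs at h1 h2 h3 ⊢ <;> omega
  refine ⟨⟨I, ?_⟩, hgap⟩
  have hsum := Finset.sum_congr (rfl : (Finset.univ : Finset (ZMod n)) = _) fun l _ => hgap l
  have hshift : ∑ l, m (l - 1) = ∑ l, m l := Equiv.sum_comp (Equiv.subRight (1 : ZMod n)) m
  rw [Finset.sum_add_distrib, Finset.sum_add_distrib, hshift] at hsum
  have h1 := add_left_cancel hsum
  simp only [Finset.sum_boole, Finset.filter_mem_eq_inter, Finset.univ_inter, Nat.cast_id] at h1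
  rw [← h1, S.2]

theorem exists_lift_of_injective {P Q R : Type*} [AddCommGroup P] [Module (B k n) P]
    [AddCommGroup Q] [Module (B k n) Q] [AddCommGroup R] [Module (B k n) R]
    (i : P →ₗ[B k n] R) (hi : Function.Injective i) (g : Q →ₗ[B k n] R)
    (h : ∀ q, ∃ p, i p = g q) : ∃ g' : Q →ₗ[B k n] P, ∀ q, i (g' q) = g q := by
  choose g' hg' using h
  exact ⟨{ toFun := g'
           map_add' := fun v w => hi (by rw [hg', map_add, map_add, hg', hg'])
           map_smul' := fun b v => hi (by rw [hg', map_smul, RingHom.id_apply, map_smul, hg']) },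
    hg'⟩

/-- Two homomorphisms to `L_S` that are jointly injective give a profile, which can be read off from
the image of the first and from the image of its kernel under the second. -/
theorem exists_hasProfile {M : Type*} [AddCommGroup M] [Module (B k n) M]
    (S : KSubset k n) (G F : M →ₗ[B k n] L S)
    (hinj : ∀ v, G v = 0 → F v = 0 → v = 0) (m c : ZMod n → ℕ)
    (hG : ∀ w, (∃ v, G v = w) ↔ ∀ l, PowerSeries.X ^ m l ∣ w l)
    (hF : ∀ w, (∃ v, G v = 0 ∧ F v = w) ↔ ∀ l, PowerSeries.X ^ c l ∣ w l) :
    ∃ I J : KSubset k n, HasProfile M I J ∧ IsGap S I m ∧ IsGap S J c := by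
  obtain ⟨I, hI⟩ := exists_isGap S m (LinearMap.range G) hG
  obtain ⟨J, hJ⟩ := exists_isGap S c (Submodule.map F (LinearMap.ker G)) hF
  have himI : ∀ w, (∃ v, scaleHom hI v = w) ↔ ∀ l, PowerSeries.X ^ m l ∣ w l := fun w =>
    ⟨by rintro ⟨v, rfl⟩ l; exact dvd_mul_right _ _, fun h => by
      choose v hv using h
      exact ⟨v, L.ext fun l => (hv l).symm⟩⟩
  have himJ : ∀ w, (∃ v, scaleHom hJ v = w) ↔ ∀ l, PowerSeries.X ^ c l ∣ w l := fun w =>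
    ⟨by rintro ⟨v, rfl⟩ l; exact dvd_mul_right _ _, fun h => by
      choose v hv using h
      exact ⟨v, L.ext fun l => (hv l).symm⟩⟩
  obtain ⟨g, hg⟩ := exists_lift_of_injective (scaleHom hI) (scaleHom_injective hI) G fun v =>
    (himI _).2 ((hG _).1 ⟨v, rfl⟩)
  have hFinj : Function.Injective (F ∘ₗ (LinearMap.ker G).subtype) := by
    intro v w hvw
    refine Subtype.ext (sub_eq_zero.1 (hinj _ ?_ ?_))
    · rw [map_sub, LinearMap.mem_ker.1 v.2, LinearMap.mem_ker.1 w.2, sub_zero]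
    · rw [map_sub, sub_eq_zero]; exact hvw
  obtain ⟨f, hf⟩ := exists_lift_of_injective (F ∘ₗ (LinearMap.ker G).subtype) hFinj (scaleHom hJ)
    fun v => by
      obtain ⟨w, hw, hw'⟩ := (hF _).2 ((himJ _).1 ⟨v, rfl⟩)
      exact ⟨⟨w, hw⟩, hw'⟩
  have hf' : ∀ v, F (f v).1 = scaleHom hJ v := hf
  refine ⟨I, J, ⟨(LinearMap.ker G).subtype ∘ₗ f, g, ?_, ?_, ?_⟩, hI, hJ⟩
  · intro v w hvw
    refine scaleHom_injective hJ ?_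
    rw [← hf', ← hf']
    exact congrArg F hvw
  · intro v
    constructor
    · intro hv
      have hGv : G v = 0 := by rw [← hg, hv, map_zero]
      obtain ⟨w, hw⟩ := (himJ _).2 ((hF (F v)).1 ⟨v, hGv, rfl⟩)
      refine ⟨w, ?_⟩
      change (f w).1 = v
      refine sub_eq_zero.1 (hinj _ ?_ ?_)
      · rw [map_sub, LinearMap.mem_ker.1 (f w).2, hGv, sub_zero]
      · rw [map_sub, hf', hw, sub_self]
    · rintro ⟨w, rfl⟩
      refine scaleHom_injective hI ?_
      rw [hg, map_zero]
      exact (f w).2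
  · intro w
    obtain ⟨v, hv⟩ := (hG _).2 ((himI _).1 ⟨w, rfl⟩)
    exact ⟨v, scaleHom_injective hI (by rw [hg, hv])⟩

theorem exists_eq_X_pow_mul_unit {f : ℂ⟦X⟧} (hf : f ≠ 0) :
    ∃ (m : ℕ) (u : ℂ⟦X⟧), IsUnit u ∧ f = PowerSeries.X ^ m * u := by
  obtain ⟨m, u, hu, h⟩ := WfDvdMonoid.max_power_factor hf PowerSeries.X_prime.irreducible
  exact ⟨m, u, isUnit_of_not_X_dvd hu, h⟩

/-- A nonzero submodule of `L_S` is given by powers of `t` at the vertices. -/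
theorem exists_exponents (S : KSubset k n) (P : Submodule (B k n) (L S)) {v : L S} (hv : v ∈ P)
    {p : ZMod n} (hvp : v p ≠ 0) :
    ∃ m : ZMod n → ℕ, ∀ w, w ∈ P ↔ ∀ l, PowerSeries.X ^ m l ∣ w l := by
  have hcenter : ∀ (a : ℂ⟦X⟧) (w : L S), w ∈ P → a • w ∈ P := fun a w hw => by
    rw [← algebraMap_smul (B k n) a w]; exact P.smul_mem _ hw
  have hne : ∀ l, ∃ (m : ℕ) (w : L S), w ∈ P ∧ w l = PowerSeries.X ^ m := by
    intro l
    have h1 : (bX k n ^ (l - p).val • v : L S) l ≠ 0 := by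
      rw [bX_pow_smul_apply, sub_natCast_val_sub]
      exact mul_ne_zero (pathProd_ne_zero S l _) hvp
    obtain ⟨m, u, hu, hm⟩ := exists_eq_X_pow_mul_unit h1
    obtain ⟨u', hu'⟩ := hu.exists_right_inv
    refine ⟨m, u' • bX k n ^ (l - p).val • v, hcenter _ _ (P.smul_mem _ hv), ?_⟩
    rw [L.smul_apply, hm]
    linear_combination PowerSeries.X ^ m * hu'
  classical
  refine ⟨fun l => Nat.find (hne l), fun w => ⟨fun hw l => ?_, fun hw => ?_⟩⟩
  · by_cases h0 : w l = 0
    · rw [h0]; exact dvd_zero _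
    · obtain ⟨m, u, hu, hm⟩ := exists_eq_X_pow_mul_unit h0
      obtain ⟨u', hu'⟩ := hu.exists_right_inv
      have h1 : Nat.find (hne l) ≤ m := Nat.find_min' _ ⟨u' • w, hcenter _ _ hw, by
        rw [L.smul_apply, hm]; linear_combination PowerSeries.X ^ m * hu'⟩
      rw [hm]
      exact (pow_dvd_pow _ h1).mul_right _
  · rw [eq_sum_idem_smul (k := k) (n := n) w]
    refine P.sum_mem fun l _ => ?_
    obtain ⟨v, hv, hvl⟩ := Nat.find_spec (hne l)
    obtain ⟨a, ha⟩ := hw l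
    have : idem k n l • w = a • idem k n l • v := by
      refine L.ext fun i => ?_
      rw [idem_smul_apply, L.smul_apply, idem_smul_apply]
      split_ifs with hi
      · rw [hi, ha, hvl, mul_comm]
      · rw [mul_zero]
    rw [this]
    exact hcenter _ _ (P.smul_mem _ hv)

theorem exists_initial (hkn : k ≤ n) (p : ZMod n) :
    ∃ S : KSubset k n, ∀ l, l ∈ S.1 ↔ (p - l).val < k := by
  refine ⟨⟨(Finset.range k).image fun j : ℕ => p - (j : ZMod n), ?_⟩, fun l => ?_⟩
  · rw [Finset.card_image_of_injOn, Finset.card_range]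
    intro a ha b hb hab
    have := congrArg ZMod.val (sub_right_injective hab : (a : ZMod n) = b)
    have ha' : a < k := by simpa using ha
    have hb' : b < k := by simpa using hb
    rwa [ZMod.val_natCast_of_lt (by omega), ZMod.val_natCast_of_lt (by omega)] at this
  · simp only [Finset.mem_image, Finset.mem_range]
    constructor
    · rintro ⟨j, hj, rfl⟩
      rw [sub_sub_cancel, ZMod.val_natCast_of_lt (by omega)]
      exact hj
    · intro h
      exact ⟨(p - l).val, h, sub_natCast_val_sub p l⟩

/-- Every functional at the vertex `p` extends to a homomorphism into the projective-injective
module `L_S`, `S` consisting of the `k` edges before `p`. -/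
theorem exists_extension_initial (S : KSubset k n) (p : ZMod n)
    (hS : ∀ l, l ∈ S.1 ↔ (p - l).val < k) (ψ : M →ₗ[ℂ⟦X⟧] ℂ⟦X⟧) :
    ∃ G : M →ₗ[B k n] L S, ∀ m l, PowerSeries.X ^ ((p - l).val - k) * G m l =
      ψ (idem k n p • bX k n ^ (p - l).val • m) := by
  obtain ⟨G, hG⟩ := exists_extension S p ψ fun j hj m => by
    rw [pathProd_initial S p hS hj.le]
    rcases le_total j k with h | h
    · rw [Nat.sub_eq_zero_of_le h, pow_zero]; exact one_dvd _
    · rw [bX_pow_of_le h hj.le, mul_smul, algebraMap_smul, smul_center_comm, map_smul]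
      exact dvd_mul_right _ _
  refine ⟨G, fun m l => ?_⟩
  rw [← hG, pathProd_initial S p hS (ZMod.val_lt _).le]

/-- Every module of rank two has a profile. -/
theorem IsCMOfRank.exists_hasProfile (hkn : k ≤ n) (hM : IsCMOfRank k n M 2) :
    ∃ I J : KSubset k n, HasProfile M I J := by
  have := hM.free
  have := hM.finite
  have hmemc : ∀ m, idem k n 0 • m ∈ component k n M 0 := fun m => ⟨m, rfl⟩
  have hc : ∀ m ∈ component k n M 0, idem k n 0 • m = m := by
    rintro _ ⟨w, rfl⟩
    change idem k n 0 • idem k n 0 • w = idem k n 0 • w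
    rw [← mul_smul, idem_mul_self]
  have b := Module.finBasisOfFinrankEq ℂ⟦X⟧ (component k n M 0) (hM.rank_component 0)
  let ψ : Fin 2 → M →ₗ[ℂ⟦X⟧] ℂ⟦X⟧ := fun i =>
    { toFun := fun m => b.repr ⟨idem k n 0 • m, hmemc m⟩ i
      map_add' := fun v w => by
        rw [← Finsupp.add_apply, ← map_add]
        congr 2
        exact Subtype.ext (smul_add _ _ _)
      map_smul' := fun a v => by
        rw [RingHom.id_apply, smul_eq_mul, ← smul_eq_mul, ← Finsupp.smul_apply, ← map_smul]
        congr 2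
        exact Subtype.ext (smul_center_comm (idem k n 0) a v) }
  have hψb : ∀ i j, ψ i (b j) = if j = i then 1 else 0 := by
    intro i j
    have h1 : (⟨idem k n 0 • (b j : M), hmemc _⟩ : component k n M 0) = b j :=
      Subtype.ext (hc _ (b j).2)
    change b.repr ⟨idem k n 0 • (b j : M), hmemc _⟩ i = _
    rw [h1, b.repr_self, Finsupp.single_apply]
  obtain ⟨S, hS⟩ := exists_initial (k := k) hkn (0 : ZMod n)
  choose G hG using fun i => exists_extension_initial S 0 hS (ψ i)
  have hG0 : ∀ i m, G i m 0 = ψ i m := by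
    intro i m
    have h1 := hG i m 0
    rw [sub_zero, ZMod.val_zero, Nat.zero_sub, pow_zero, one_mul, pow_zero, one_smul] at h1
    rw [h1]
    change b.repr ⟨idem k n 0 • idem k n 0 • m, hmemc _⟩ i = _
    congr 2
    exact Subtype.ext (hc _ (hmemc m))
  have hXinj : ∀ m : M, bX k n • m = 0 → m = 0 := by
    intro m hm
    have h1 : (PowerSeries.X : ℂ⟦X⟧) • m = 0 := by rw [← bY_bX_smul (k := k) (n := n), hm, smul_zero]
    exact (smul_eq_zero.1 h1).resolve_left PowerSeries.X_ne_zero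
  have hXpow : ∀ (j : ℕ) (m : M), bX k n ^ j • m = 0 → m = 0 := by
    intro j
    induction j with
    | zero => intro m hm; simpa using hm
    | succ j ih => intro m hm; rw [pow_succ, mul_smul] at hm; exact hXinj _ (ih _ hm)
  have hinj : ∀ m, G 0 m = 0 → G 1 m = 0 → m = 0 := by
    intro m h0 h1
    rw [eq_sum_idem_smul (k := k) (n := n) m]
    refine Finset.sum_eq_zero fun l _ => hXpow ((0 : ZMod n) - l).val _ ?_
    have h2 : ∀ i, ψ i (idem k n 0 • bX k n ^ ((0 : ZMod n) - l).val • m) = 0 := by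
      intro i
      have : G i m = 0 := by fin_cases i <;> assumption
      rw [← hG, this, L.zero_apply, mul_zero]
    have h3 : (⟨idem k n 0 • bX k n ^ ((0 : ZMod n) - l).val • m, hmemc _⟩ : component k n M 0) = 0 := by
      refine b.repr.injective (Finsupp.ext fun i => ?_)
      rw [map_zero, Finsupp.zero_apply, ← h2 i]
      change _ = b.repr ⟨idem k n 0 • idem k n 0 • _, hmemc _⟩ i
      congr 2
      exact Subtype.ext (hc _ (hmemc _)).symm
    have h4 := congrArg Subtype.val h3
    change idem k n 0 • bX k n ^ ((0 : ZMod n) - l).val • m = 0 at h4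
    rw [← mul_smul, idem_mul_bX_pow, sub_natCast_val_sub, mul_smul] at h4
    exact h4
  have hker : G 0 (b 1 : M) = 0 := by
    refine L.ext fun l => X_pow_mul_left_cancel (a := ((0 : ZMod n) - l).val - k) ?_
    rw [hG, idem_smul_bX_pow_smul, sub_natCast_val_sub, ← hc _ (b 1).2, ← mul_smul (idem k n l),
      L.zero_apply, mul_zero]
    by_cases hl : l = 0
    · rw [hl, idem_mul_self, sub_zero, ZMod.val_zero, pow_zero, one_smul, hc _ (b 1).2,
        hc _ (b 1).2, hψb]
      simp
    · rw [idem_mul_ne hl, zero_smul, smul_zero, smul_zero, map_zero]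
  obtain ⟨m, hm⟩ := exists_exponents S (LinearMap.range (G 0)) (v := G 0 (b 0 : M)) ⟨_, rfl⟩
    (p := 0) (by rw [hG0, hψb, if_pos rfl]; exact one_ne_zero)
  obtain ⟨c, hc'⟩ := exists_exponents S (Submodule.map (G 1) (LinearMap.ker (G 0)))
    (v := G 1 (b 1 : M)) ⟨_, hker, rfl⟩
    (p := 0) (by rw [hG0, hψb, if_pos rfl]; exact one_ne_zero)
  obtain ⟨I, J, hIJ, -⟩ := GrCat.exists_hasProfile S (G 0) (G 1) hinj m c hm hc'
  exact ⟨I, J, hIJ⟩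

end Profile

/-! ### Rims, gap functions and boxes -/

section Rims

variable {k n : ℕ} [NeZero n] {I J : KSubset k n} {h : ZMod n → ℕ}

theorem card_filter_val_sub_one (A : Finset (ZMod n)) {l : ZMod n} (hl : l ≠ 0) :
    (A.filter fun i => 1 ≤ i.val ∧ i.val ≤ l.val).card =
      (A.filter fun i => 1 ≤ i.val ∧ i.val ≤ (l - 1).val).card + if l ∈ A then 1 else 0 := by
  have hv0 : l.val ≠ 0 := by rwa [Ne, ZMod.val_eq_zero]
  have hv : (l - 1).val + 1 = l.val := by
    have h1 : l - 1 = ((l.val - 1 : ℕ) : ZMod n) := by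
      rw [Nat.cast_sub (by omega), ZMod.natCast_zmod_val, Nat.cast_one]
    have := ZMod.val_lt l
    rw [h1, ZMod.val_natCast_of_lt (by omega)]; omega
  have hiff : ∀ i : ZMod n, (1 ≤ i.val ∧ i.val ≤ l.val) ↔
      (1 ≤ i.val ∧ i.val ≤ (l - 1).val) ∨ i = l := by
    intro i
    constructor
    · rintro ⟨h1, h2⟩
      rcases Nat.lt_or_ge i.val l.val with h3 | h3
      · left; omega
      · right; exact ZMod.val_injective n (le_antisymm h2 h3)
    · rintro (h1 | rfl) <;> omega
  simp only [hiff, Finset.filter_or, Finset.filter_eq']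
  rw [Finset.card_union_of_disjoint]
  · split_ifs <;> simp
  · rw [Finset.disjoint_left]
    intro i hi hi'
    split_ifs at hi'
    · rw [Finset.mem_singleton] at hi'
      rw [Finset.mem_filter, hi'] at hi
      omega
    · simp at hi'

theorem card_filter_val_neg_one (A : Finset (ZMod n)) :
    (A.filter fun i => 1 ≤ i.val ∧ i.val ≤ ((0 : ZMod n) - 1).val).card +
      (if (0 : ZMod n) ∈ A then 1 else 0) = A.card := by
  have hv : ((0 : ZMod n) - 1).val = n - 1 := by
    have hn := NeZero.pos n
    have h1 : (0 : ZMod n) - 1 = ((n - 1 : ℕ) : ZMod n) := by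
      rw [Nat.cast_sub hn]; simp
    rw [h1, ZMod.val_natCast_of_lt (by omega)]
  have hiff : ∀ i : ZMod n, (1 ≤ i.val ∧ i.val ≤ ((0 : ZMod n) - 1).val) ↔ ¬ i = 0 := by
    intro i
    have h1 := ZMod.val_lt i
    rw [hv, ← ZMod.val_eq_zero]
    omega
  simp only [hiff]
  rw [← Finset.card_filter_add_card_filter_not (s := A) (fun i => i = 0), add_comm,
    Finset.filter_eq']
  split_ifs <;> simp

/-- Passing the edge `l` changes the distance between the rims according to the sets. -/
theorem rimGap_eq (I J : KSubset k n) (l : ZMod n) :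
    rimGap I J l + (if l ∈ I.1 then 1 else 0) =
      rimGap I J (l - 1) + (if l ∈ J.1 then 1 else 0) := by
  unfold rimGap
  by_cases hl : l = 0
  · subst hl
    have h1 := card_filter_val_neg_one I.1
    have h2 := card_filter_val_neg_one J.1
    have h3 : ∀ A : Finset (ZMod n),
        (A.filter fun i => 1 ≤ i.val ∧ i.val ≤ (0 : ZMod n).val).card = 0 := by
      intro A
      rw [Finset.card_eq_zero, Finset.filter_eq_empty_iff]
      intro i _
      rw [ZMod.val_zero]; omega
    rw [I.2] at h1
    rw [J.2] at h2
    rw [h3, h3]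
    split_ifs at h1 h2 ⊢ <;> push_cast <;> omega
  · rw [card_filter_val_sub_one I.1 hl, card_filter_val_sub_one J.1 hl]
    push_cast
    ring

theorem eq_of_eq_sub_one {α : Type*} {f : ZMod n → α} (hf : ∀ l, f l = f (l - 1)) (a b : ZMod n) :
    f a = f b := by
  have key : ∀ j : ℕ, f (b + j) = f b := by
    intro j
    induction j with
    | zero => simp
    | succ j ih => rw [hf, ← ih]; congr 1; push_cast; ring
  have := key (a - b).val
  rwa [ZMod.natCast_zmod_val, add_sub_cancel] at this

theorem IsGap.rimsMeet_iff (hg : IsGap I J h) {p : ZMod n} (hp : h p = 0) (v : ZMod n) :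
    RimsMeet I J v ↔ h v = 0 := by
  have hconst : ∀ a b, (h a : ℤ) - rimGap I J a = h b - rimGap I J b :=
    eq_of_eq_sub_one fun l => by
      have h1 := hg l
      have h2 := rimGap_eq I J l
      split_ifs at h1 h2 <;> omega
  constructor
  · intro hv
    have h1 := hv p
    have h2 := hconst v p
    omega
  · intro hv w
    have := hconst v w
    omega

theorem exists_gap (I J : KSubset k n) : ∃ (h : ZMod n → ℕ) (p : ZMod n), IsGap I J h ∧ h p = 0 := by
  obtain ⟨p, hp⟩ := Finite.exists_min (rimGap I J)
  refine ⟨fun v => (rimGap I J v - rimGap I J p).toNat, p, fun l => ?_, by simp⟩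
  have h1 := rimGap_eq I J l
  have h2 := hp l
  have h3 := hp (l - 1)
  dsimp only
  split_ifs at h1 ⊢ <;> omega

theorem IsGap.numBoxes_eq (hg : IsGap I J h) {p : ZMod n} (hp : h p = 0) :
    numBoxes I J = (Finset.univ.filter fun v : ZMod n => h v = 0 ∧ h (v + 1) ≠ 0).card := by
  unfold numBoxes
  congr 1
  ext v
  simp only [Finset.mem_filter, Finset.mem_univ, true_and, hg.rimsMeet_iff hp, Ne]

/-- If a direction is assigned to the points of the walk at positive height, constant along the
excursions, then every direction that occurs is that of the first point of a box. -/
theorem exists_start {α : Type*} {dir : ZMod n → α}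
    (hdir : ∀ l, h l ≠ 0 → h (l - 1) ≠ 0 → dir l = dir (l - 1)) {p : ZMod n} (hp : h p = 0)
    {i : ZMod n} (hi : h i ≠ 0) : ∃ v, h v = 0 ∧ h (v + 1) ≠ 0 ∧ dir (v + 1) = dir i := by
  have key : ∀ (j : ℕ) (i : ZMod n), h i ≠ 0 → h (i - j) = 0 →
      ∃ v, h v = 0 ∧ h (v + 1) ≠ 0 ∧ dir (v + 1) = dir i := by
    intro j
    induction j with
    | zero => intro i hi hj; simp at hj; exact absurd hj hi
    | succ j ih =>
      intro i hi hj
      by_cases h1 : h (i - 1) = 0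
      · exact ⟨i - 1, h1, by rwa [sub_add_cancel], by rw [sub_add_cancel]⟩
      · have h2 : i - 1 - (j : ZMod n) = i - ((j + 1 : ℕ) : ZMod n) := by push_cast; ring
        obtain ⟨v, h3, h4, h5⟩ := ih (i - 1) h1 (by rw [h2]; exact hj)
        exact ⟨v, h3, h4, h5.trans (hdir i hi h1).symm⟩
  refine key (i - p).val i hi ?_
  rwa [sub_natCast_val_sub]

/-- If three directions occur, there are at least three boxes. -/
theorem three_le_numBoxes {α : Type*} (hg : IsGap I J h) {dir : ZMod n → α}
    (hdir : ∀ l, h l ≠ 0 → h (l - 1) ≠ 0 → dir l = dir (l - 1)) {q₁ q₂ q₃ : ZMod n}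
    (h₁ : h q₁ ≠ 0) (h₂ : h q₂ ≠ 0) (h₃ : h q₃ ≠ 0) (h₁₂ : dir q₁ ≠ dir q₂)
    (h₁₃ : dir q₁ ≠ dir q₃) (h₂₃ : dir q₂ ≠ dir q₃) : 3 ≤ numBoxes I J := by
  obtain ⟨p, hp⟩ : ∃ p, h p = 0 := by
    by_contra! hne
    exact h₁₂ (eq_of_eq_sub_one (fun l => hdir l (hne _) (hne _)) q₁ q₂)
  rw [hg.numBoxes_eq hp]
  obtain ⟨v₁, a₁, b₁, c₁⟩ := exists_start hdir hp h₁
  obtain ⟨v₂, a₂, b₂, c₂⟩ := exists_start hdir hp h₂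
  obtain ⟨v₃, a₃, b₃, c₃⟩ := exists_start hdir hp h₃
  refine Finset.two_lt_card.2 ⟨v₁, by simp [a₁, b₁], v₂, by simp [a₂, b₂], v₃, by simp [a₃, b₃],
    ?_, ?_, ?_⟩
  · rintro rfl; exact h₁₂ (c₁.symm.trans c₂)
  · rintro rfl; exact h₁₃ (c₁.symm.trans c₃)
  · rintro rfl; exact h₂₃ (c₂.symm.trans c₃)

end Rims

/-! ### A profile with three boxes -/

section Existence

variable {k n : ℕ} [NeZero n] {I J : KSubset k n} {h : ZMod n → ℕ} {s : ZMod n → ℂ⟦X⟧}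

theorem HasProfile.of_equiv {M N : Type*} [AddCommGroup M] [Module (B k n) M] [AddCommGroup N]
    [Module (B k n) N] (e : M ≃ₗ[B k n] N) (hM : HasProfile M I J) : HasProfile N I J := by
  obtain ⟨f, g, hf, hfg, hg⟩ := hM
  refine ⟨e.toLinearMap ∘ₗ f, g ∘ₗ e.symm.toLinearMap, e.injective.comp hf, fun v => ?_,
    hg.comp e.symm.surjective⟩
  change g (e.symm v) = 0 ↔ _
  rw [hfg]
  constructor
  · rintro ⟨w, hw⟩
    exact ⟨w, by change e (f w) = v; rw [hw, e.apply_symm_apply]⟩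
  · rintro ⟨w, rfl⟩
    exact ⟨w, (e.symm_apply_apply _).symm⟩

theorem X_pow_dvd_X_pow_mul_iff {a b : ℕ} {w : ℂ⟦X⟧} :
    PowerSeries.X ^ a ∣ PowerSeries.X ^ b * w ↔ PowerSeries.X ^ (a - min b a) ∣ w := by
  rcases le_total b a with hab | hab
  · rw [min_eq_left hab]
    conv_lhs => rw [← Nat.add_sub_cancel' hab, pow_add]
    exact mul_dvd_mul_iff_left (pow_ne_zero _ PowerSeries.X_ne_zero)
  · rw [min_eq_right hab, Nat.sub_self, pow_zero]
    exact ⟨fun _ => one_dvd _, fun _ => (pow_dvd_pow _ hab).mul_right _⟩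

/-- The profile of a lattice chain that is defined by the line spanned by `(1, z)`: the submodule
consists of the vectors in this line, and the quotient is the image under `(a, b) ↦ b - z a`. Up to
a unit, `s l - z` is `t ^ e l`: the path from `Z²` to the end of the tree given by the line agrees
for `min (e l) (h l)` steps with the path to the lattice at `l`. -/
theorem exists_hasProfile_of_line (hg : IsGap I J h) (hs : Compat h s) (z : ℂ⟦X⟧) (e : ZMod n → ℕ)
    (u : ZMod n → ℂ⟦X⟧) (hu : ∀ l, IsUnit (u l))
    (hz : ∀ l, s l - z = PowerSeries.X ^ e l * u l) :
    ∃ I' J' : KSubset k n, HasProfile (lat hg hs) I' J' ∧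
      IsGap I I' (fun l => min (e l) (h l)) ∧ IsGap I J' (fun l => h l - min (e l) (h l)) := by
  let G : lat hg hs →ₗ[B k n] L I :=
    { toFun := fun v => v.1.2 - z • v.1.1
      map_add' := fun v w => L.ext fun l => by
        change (v.1.2 l + w.1.2 l) - z * (v.1.1 l + w.1.1 l) =
          (v.1.2 l - z * v.1.1 l) + (w.1.2 l - z * w.1.1 l)
        ring
      map_smul' := fun b v => by
        change b • v.1.2 - z • b • v.1.1 = b • (v.1.2 - z • v.1.1)
        rw [smul_sub, smul_center_comm] }
  let F : lat hg hs →ₗ[B k n] L I := LinearMap.fst _ _ _ ∘ₗ (lat hg hs).subtype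
  have hG : ∀ v l, G v l = v.1.2 l - z * v.1.1 l := fun v l => rfl
  refine exists_hasProfile I G F (fun v hv hv' => ?_) _ _ (fun w => ?_) fun w => ?_
  · have h1 : v.1.1 = 0 := hv'
    refine lat_ext (fun l => congrFun h1 l) fun l => ?_
    have h2 := hG v l
    rw [hv, h1, L.zero_apply, mul_zero, sub_zero] at h2
    exact h2.symm
  · constructor
    · rintro ⟨v, rfl⟩ l
      have h1 := (pow_dvd_pow _ (min_le_right (e l) (h l))).trans (v.2 l)
      have h2 : PowerSeries.X ^ min (e l) (h l) ∣ s l - z := by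
        rw [hz]; exact (pow_dvd_pow _ (min_le_left _ _)).mul_right _
      rw [hG]
      refine (dvd_add h1 (h2.mul_right (v.1.1 l))).trans (dvd_of_eq ?_)
      ring
    · intro hw
      have hex : ∀ l, ∃ a b : ℂ⟦X⟧, PowerSeries.X ^ h l ∣ b - s l * a ∧ b - z * a = w l := by
        intro l
        obtain ⟨c, hc⟩ := hw l
        rcases le_total (e l) (h l) with hl | hl
        · obtain ⟨u', hu'⟩ := (hu l).exists_right_inv
          rw [min_eq_left hl] at hc
          refine ⟨u' * c, s l * (u' * c), by simp, ?_⟩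
          rw [hc]
          linear_combination (u' * c) * hz l + PowerSeries.X ^ e l * c * hu'
        · rw [min_eq_right hl] at hc
          exact ⟨0, w l, by rw [hc]; simp, by simp⟩
      choose a b hab hab' using hex
      exact ⟨⟨(a, b), hab⟩, L.ext hab'⟩
  · have key : ∀ l (a : ℂ⟦X⟧), PowerSeries.X ^ h l ∣ z * a - s l * a ↔
        PowerSeries.X ^ (h l - min (e l) (h l)) ∣ a := by
      intro l a
      have h1 : z * a - s l * a = -(PowerSeries.X ^ e l * a * u l) := by
        linear_combination (-a) * hz l
      rw [h1, dvd_neg, (hu l).dvd_mul_right, X_pow_dvd_X_pow_mul_iff]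
    constructor
    · rintro ⟨v, hv, rfl⟩ l
      refine (key l _).1 ?_
      have h1 := hG v l
      rw [hv, L.zero_apply] at h1
      have h2 : v.1.2 l = z * v.1.1 l := by linear_combination -h1
      have h3 := v.2 l
      rw [h2] at h3
      exact h3
    · intro hw
      exact ⟨⟨(w, z • w), fun l => (key l _).2 (hw l)⟩, sub_self _, rfl⟩

/-- If the paths to two lattices of the chain separate at distance `v ≥ 1` from the lattice
`Z²`, then the lattice where they separate is a branching point of the chain, and a
general end attached to it gives a profile with at least three boxes. -/
theorem exists_three_le_of_branch (hg : IsGap I J h) (hs : Compat h s) {p : ZMod n} (hp : h p = 0)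
    {i j : ZMod n} {v : ℕ} (hv : v ≠ 0) (hi : v < h i) (hj : v < h j) {u : ℂ⟦X⟧} (hu : IsUnit u)
    (hij : s i - s j = PowerSeries.X ^ v * u) :
    ∃ I' J' : KSubset k n, HasProfile (lat hg hs) I' J' ∧ 3 ≤ numBoxes I' J' := by
  -- A direction `c` at the branching point that is not taken by the walk.
  obtain ⟨c, hc⟩ := Infinite.exists_notMem_finset
    (Finset.univ.image fun l => PowerSeries.coeff v (s l - s i))
  simp only [Finset.mem_image, Finset.mem_univ, true_and, not_exists] at hc
  set z : ℂ⟦X⟧ := s i + PowerSeries.C c * PowerSeries.X ^ v with hz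
  have hcoeff : ∀ l, PowerSeries.coeff v (s l - z) = PowerSeries.coeff v (s l - s i) - c := by
    intro l
    have : s l - z = s l - s i - PowerSeries.C c * PowerSeries.X ^ v := by rw [hz]; ring
    rw [this, map_sub, PowerSeries.coeff_C_mul, PowerSeries.coeff_X_pow_self, mul_one]
  have hne : ∀ l, PowerSeries.coeff v (s l - z) ≠ 0 := fun l => by
    rw [hcoeff]; exact sub_ne_zero.2 (hc l)
  have hex : ∀ l, ∃ (e : ℕ) (w : ℂ⟦X⟧), IsUnit w ∧ s l - z = PowerSeries.X ^ e * w := fun l =>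
    exists_eq_X_pow_mul_unit fun h0 => hne l (by rw [h0, map_zero])
  choose e w hw hez using hex
  have hev : ∀ l, e l ≤ v := by
    intro l
    by_contra! hlt
    refine hne l (PowerSeries.X_pow_dvd_iff.1 ?_ v hlt)
    rw [hez]; exact dvd_mul_right _ _
  have hev' : ∀ l, PowerSeries.X ^ v ∣ s l - z → e l = v := by
    intro l hl
    refine le_antisymm (hev l) ?_
    rw [hez, (hw l).dvd_mul_right, X_pow_dvd_X_pow_iff] at hl
    exact hl
  obtain ⟨I', J', hprof, hI', hJ'⟩ := exists_hasProfile_of_line hg hs z e w hw hez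
  refine ⟨I', J', hprof, ?_⟩
  -- The distance between the rims of the new profile, which is `0` at the branching point: the
  -- distance of the lattice to the path to the new end, corrected by the place where it meets it.
  set h' : ZMod n → ℕ := fun l => (h l - min (e l) (h l)) + v - min (e l) (h l) with hh'
  have hg' : IsGap I' J' h' := by
    intro l
    have h1 := hI' l
    have h2 := hJ' l
    have h3 := hev l
    have h4 := hev (l - 1)
    dsimp only at h1 h2
    simp only [hh']
    split_ifs at h1 h2 ⊢ <;> omega
  classical
  have step : ∀ a b, PowerSeries.X ^ min (h a) (h b) ∣ s a - s b → h a ≤ h b + 1 → h' b ≠ 0 →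
      e a = v ∧ v < h a →
      (e b = v ∧ v < h b) ∧ PowerSeries.coeff v (s a - z) = PowerSeries.coeff v (s b - z) := by
    rintro a b hab hle hb ⟨ha1, ha2⟩
    have h1 : PowerSeries.X ^ v ∣ s b - z := by
      have h2 : PowerSeries.X ^ v ∣ s a - z := by rw [hez, ha1]; exact dvd_mul_right _ _
      have h3 := dvd_sub h2 ((pow_dvd_pow _ (by omega : v ≤ min (h a) (h b))).trans hab)
      have h4 : s a - z - (s a - s b) = s b - z := by ring
      rwa [h4] at h3
    have h2 := hev' b h1
    have h3 : v < h b := by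
      by_contra! hlt
      refine hb ?_
      simp only [hh']
      omega
    refine ⟨⟨h2, h3⟩, ?_⟩
    have h4 := PowerSeries.X_pow_dvd_iff.1 hab v (by omega)
    rw [map_sub, sub_eq_zero] at h4
    rw [map_sub, map_sub, h4]
  -- The direction in which the lattice is seen from the branching point, `0` being that of `Z²`.
  let dir : ZMod n → ℂ := fun l => if e l = v ∧ v < h l then PowerSeries.coeff v (s l - z) else 0
  refine three_le_numBoxes hg' (dir := dir) (fun l hl hl' => ?_) (q₁ := p) (q₂ := i) (q₃ := j)
    ?_ ?_ ?_ ?_ ?_ ?_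
  · simp only [dir]
    have hc1 := hs l
    by_cases hP : e l = v ∧ v < h l
    · obtain ⟨h1, h2⟩ := step l (l - 1) hc1 (hg.le_succ l) hl' hP
      rw [if_pos hP, if_pos h1, h2]
    · by_cases hP' : e (l - 1) = v ∧ v < h (l - 1)
      · obtain ⟨h1, h2⟩ := step (l - 1) l
          (by rw [min_comm, dvd_sub_comm]; exact hc1) (hg.le_succ' l) hl hP'
        exact absurd h1 hP
      · rw [if_neg hP, if_neg hP']
  all_goals
    have hei : e i = v := hev' i (by
      rw [hz, sub_add_cancel_left, dvd_neg]; exact dvd_mul_left _ _)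
    have hej : e j = v := hev' j (by
      have : s j - z = -(PowerSeries.X ^ v * (u + PowerSeries.C c)) := by
        rw [hz]; linear_combination -hij
      rw [this, dvd_neg]; exact dvd_mul_right _ _)
    have hdp : dir p = 0 := if_neg (by omega)
    have hdi : dir i = -c := by
      simp only [dir]
      rw [if_pos ⟨hei, hi⟩, hcoeff, sub_self, map_zero, zero_sub]
    have hdj : dir j = -PowerSeries.constantCoeff u - c := by
      simp only [dir]
      rw [if_pos ⟨hej, hj⟩, hcoeff, ← neg_sub (s i), hij, map_neg, PowerSeries.coeff_X_pow_mul',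
        if_pos le_rfl, Nat.sub_self, PowerSeries.coeff_zero_eq_constantCoeff]
  · simp only [hh']; omega
  · simp only [hh']; omega
  · simp only [hh']; omega
  · rw [hdp, hdi, ← hdi]
    simp only [dir]
    rw [if_pos ⟨hei, hi⟩]
    exact (hne i).symm
  · rw [hdp]
    simp only [dir]
    rw [if_pos ⟨hej, hj⟩]
    exact (hne j).symm
  · rw [hdi, hdj]
    intro h0
    have : PowerSeries.constantCoeff u = 0 := by linear_combination h0
    exact (isUnit_iff_ne_zero.1 (PowerSeries.isUnit_iff_constantCoeff.1 hu)) this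

/-- An indecomposable lattice chain has a branching point: otherwise all its lattices lie on a path
in the tree, and hence are compatible with two lines. -/
theorem exists_three_le_numBoxes (hg : IsGap I J h) (hs : Compat h s) {p : ZMod n} (hp : h p = 0)
    (hind : IsIndecomposable k n (lat hg hs)) :
    ∃ I' J' : KSubset k n, HasProfile (lat hg hs) I' J' ∧ 3 ≤ numBoxes I' J' := by
  let dir : ZMod n → ℂ := fun l => PowerSeries.constantCoeff (s l)
  by_cases hb : ∃ i j, dir i = dir j ∧ ¬ PowerSeries.X ^ min (h i) (h j) ∣ s i - s j
  · obtain ⟨i, j, hij, hnd⟩ := hb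
    obtain ⟨v, u, hu, hvu⟩ := exists_eq_X_pow_mul_unit (f := s i - s j) fun h0 => hnd (by simp [h0])
    have hlt : v < min (h i) (h j) := by
      by_contra! hle
      exact hnd (by rw [hvu]; exact (pow_dvd_pow _ hle).mul_right _)
    refine exists_three_le_of_branch hg hs hp (v := v) ?_ (by omega) (by omega) hu hvu
    rintro rfl
    have h1 := congrArg PowerSeries.constantCoeff hvu
    rw [pow_zero, one_mul, map_sub, sub_eq_zero.2 hij] at h1
    exact (isUnit_iff_ne_zero.1 (PowerSeries.isUnit_iff_constantCoeff.1 hu)) h1.symm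
  push Not at hb
  by_cases ht : ∃ q₁ q₂ q₃, h q₁ ≠ 0 ∧ h q₂ ≠ 0 ∧ h q₃ ≠ 0 ∧ dir q₁ ≠ dir q₂ ∧ dir q₁ ≠ dir q₃ ∧
      dir q₂ ≠ dir q₃
  · obtain ⟨q₁, q₂, q₃, h₁, h₂, h₃, h₁₂, h₁₃, h₂₃⟩ := ht
    refine ⟨I, J, hasProfile_lat hg hs, three_le_numBoxes hg (dir := dir) (fun l hl hl' => ?_)
      h₁ h₂ h₃ h₁₂ h₁₃ h₂₃⟩
    have := constantCoeff_eq_zero_of_X_pow_dvd (by omega) (hs l)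
    rwa [map_sub, sub_eq_zero] at this
  exfalso
  push Not at ht
  -- In each of the at most two directions the farthest lattice determines all others.
  obtain ⟨i₁, hi₁⟩ := Finite.exists_max h
  by_cases h2 : ∃ i, h i ≠ 0 ∧ dir i ≠ dir i₁
  · obtain ⟨i, hi, hid⟩ := h2
    obtain ⟨i₂, hi₂, hmax⟩ := Finset.exists_max_image
      (Finset.univ.filter fun l => h l ≠ 0 ∧ dir l ≠ dir i₁) h ⟨i, by simp [hi, hid]⟩
    simp only [Finset.mem_filter, Finset.mem_univ, true_and] at hi₂ hmax
    refine not_isIndecomposable_lat hg hs (s i₁) (s i₂)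
      (isUnit_of_constantCoeff_ne_zero ?_) (fun l => ?_) hind
    · rw [map_sub]
      exact sub_ne_zero.2 hi₂.2.symm
    · by_cases hl : h l = 0
      · rw [hl]; simp
      by_cases hd : dir l = dir i₁
      · have := hb l i₁ hd
        rw [min_eq_left (hi₁ l)] at this
        exact this.mul_right _
      · have hd2 : dir l = dir i₂ := by
          by_contra hne
          have h1 := hi₁ i₂
          exact hne (ht i₁ l i₂ (by omega) hl hi₂.1 (Ne.symm hd) (Ne.symm hi₂.2))
        have := hb l i₂ hd2
        rw [min_eq_left (hmax l ⟨hl, hd⟩)] at this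
        exact this.mul_left _
  · push Not at h2
    refine not_isIndecomposable_lat hg hs (s i₁) (s i₁ + 1) (by simp) (fun l => ?_) hind
    by_cases hl : h l = 0
    · rw [hl]; simp
    have := hb l i₁ (h2 l hl)
    rw [min_eq_left (hi₁ l)] at this
    exact this.mul_right _

end Existence

/-! ### Closed walks on the natural numbers -/

section Walks

/-- The number of boxes of the walk `H` that begin before `j`. If `H j ≠ 0`, this is the number,
counted from `1`, of the box to which `j` belongs. -/
def boxIndex (H : ℕ → ℕ) (j : ℕ) : ℕ :=
  Nat.count (fun u => H u = 0 ∧ H (u + 1) ≠ 0) j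

variable {H : ℕ → ℕ} {n : ℕ}

theorem boxIndex_succ (H : ℕ → ℕ) (j : ℕ) :
    boxIndex H (j + 1) = boxIndex H j + if H j = 0 ∧ H (j + 1) ≠ 0 then 1 else 0 :=
  Nat.count_succ _ _

theorem boxIndex_mono (H : ℕ → ℕ) {i j : ℕ} (hij : i ≤ j) : boxIndex H i ≤ boxIndex H j :=
  Nat.count_monotone _ hij

theorem boxIndex_eq_of_pos {i j : ℕ} (hij : i ≤ j) (hpos : ∀ u, i ≤ u → u < j → H u ≠ 0) :
    boxIndex H j = boxIndex H i := by
  induction j, hij using Nat.le_induction with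
  | base => rfl
  | succ j hj ih =>
    rw [boxIndex_succ, ih fun u h1 h2 => hpos u h1 (by omega),
      if_neg fun h1 => hpos j hj (by omega) h1.1, add_zero]

theorem boxIndex_lt {i j : ℕ} (hij : i ≤ j) (hi : H i = 0) (hj : H j ≠ 0) :
    boxIndex H i < boxIndex H j := by
  induction j, hij using Nat.le_induction with
  | base => exact absurd hi hj
  | succ j hij ih =>
    rw [boxIndex_succ]
    by_cases h0 : H j = 0
    · rw [if_pos ⟨h0, hj⟩]
      exact Nat.lt_succ_of_le (boxIndex_mono H hij)
    · exact Nat.lt_of_lt_of_le (ih h0) (Nat.le_add_right _ _)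

theorem exists_count_eq {P : ℕ → Prop} [DecidablePred P] {i : ℕ} (hi : i < Nat.count P n) :
    ∃ m, m < n ∧ P m ∧ Nat.count P m = i := by
  induction n with
  | zero => simp at hi
  | succ n ih =>
    rw [Nat.count_succ] at hi
    by_cases h : i < Nat.count P n
    · obtain ⟨m, h1, h2⟩ := ih h
      exact ⟨m, by omega, h2⟩
    · split_ifs at hi with hP
      · exact ⟨n, by omega, hP, by omega⟩
      · omega

theorem exists_boxIndex_eq {c : ℕ} (hn : H n = 0) (hc : c < boxIndex H n) :
    ∃ j, j < n ∧ H j ≠ 0 ∧ boxIndex H j = c + 1 := by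
  obtain ⟨m, h1, h2, h3⟩ := exists_count_eq hc
  refine ⟨m + 1, ?_, h2.2, ?_⟩
  · rcases Nat.lt_or_ge (m + 1) n with h | h
    · exact h
    · obtain rfl : m + 1 = n := by omega
      exact absurd hn h2.2
  · rw [boxIndex_succ, if_pos h2]
    exact congrArg (· + 1) h3

/-- The places where a property holds, enumerated in increasing order. -/
theorem exists_strictMono_enum (P : ℕ → Prop) [DecidablePred P] {c : ℕ} (hc : Nat.count P n = c) :
    ∃ α : Fin c → ℕ, StrictMono α ∧ (∀ j, j < n ∧ P j ↔ ∃ l, α l = j) ∧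
      ∀ l, Nat.count P (α l) = l := by
  choose α h1 h2 h3 using fun l : Fin c => exists_count_eq (P := P) (l.2.trans_eq hc.symm)
  refine ⟨α, fun i j hij => ?_, fun j => ⟨fun hj => ?_, ?_⟩, h3⟩
  · by_contra! hle
    have := Nat.count_monotone P hle
    rw [h3, h3] at this
    exact absurd hij (not_lt.2 this)
  · have hlt : Nat.count P j < c := hc ▸ Nat.count_strict_mono hj.2 hj.1
    exact ⟨⟨_, hlt⟩, Nat.count_injective (h2 _) hj.2 (h3 _)⟩
  · rintro ⟨l, rfl⟩
    exact ⟨h1 l, h2 l⟩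

/-- A closed walk with three boxes, the first two of height one and the last one unimodal, goes up
and down in the almost tightly interlacing pattern. -/
theorem exists_interlacing (hup : ∀ j, H (j + 1) ≤ H j + 1) (hdown : ∀ j, H j ≤ H (j + 1) + 1)
    (h0 : H 0 = 0) (hn : H n = 0) (hE : boxIndex H n = 3)
    (hlow : ∀ j, j ≤ n → boxIndex H j ≤ 2 → H j ≤ 1)
    (hvalley : ∀ i v j, i < v → v < j → j < n → (∀ u, i ≤ u → u ≤ j → H u ≠ 0) →
      H v < H i → ¬ H v < H j) :
    ∃ (r : ℕ) (α β : Fin (r + 3) → ℕ), (∀ j, j < n ∧ H (j + 1) < H j ↔ ∃ l, α l = j) ∧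
      (∀ j, j < n ∧ H j < H (j + 1) ↔ ∃ l, β l = j) ∧ StrictMono α ∧ StrictMono β ∧
      β 0 < α 0 ∧ α 0 < β 1 ∧ β 1 < α 1 ∧ α 1 < β 2 ∧ β (Fin.last (r + 2)) < α 2 := by
  let cA := Nat.count fun j => H (j + 1) < H j
  let cB := Nat.count fun j => H j < H (j + 1)
  have hA : ∀ j, cA (j + 1) = cA j + if H (j + 1) < H j then 1 else 0 := Nat.count_succ _
  have hB : ∀ j, cB (j + 1) = cB j + if H j < H (j + 1) then 1 else 0 := Nat.count_succ _
  have hH : ∀ j, cB j = cA j + H j := by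
    intro j
    induction j with
    | zero => simp [cA, cB, h0]
    | succ j ih =>
      have h1 := hup j
      have h2 := hdown j
      rw [hA, hB]
      split_ifs <;> omega
  -- every box begins with a step up, and the steps up of low boxes all begin a box
  have hEB : ∀ j, boxIndex H j ≤ cB j := by
    intro j
    refine Nat.count_mono_left fun u hu => ?_
    omega
  have hEB' : ∀ j, j ≤ n → boxIndex H j ≤ 2 → boxIndex H j = cB j := by
    intro j
    induction j with
    | zero => intro _ _; simp [boxIndex, cB]
    | succ j ih =>
      intro hj hj2
      have h1 := hlow (j + 1) hj hj2
      rw [boxIndex_succ] at hj2 ⊢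
      rw [hB, ih (by omega) (by omega)]
      congr 1
      refine if_congr ⟨fun h => by omega, fun h => by omega⟩ rfl rfl
  have hcB : 3 ≤ cB n := hE ▸ hEB n
  obtain ⟨r, hr⟩ := Nat.exists_eq_add_of_le' hcB
  have hr' : cA n = r + 3 := by have := hH n; omega
  obtain ⟨α, mα, iα, cα⟩ := exists_strictMono_enum _ hr'
  obtain ⟨β, mβ, iβ, cβ⟩ := exists_strictMono_enum _ hr
  have bα := fun l => (iα (α l)).2 ⟨l, rfl⟩
  have bβ := fun l => (iβ (β l)).2 ⟨l, rfl⟩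
  change ∀ l, cA (α l) = l at cα
  change ∀ l, cB (β l) = l at cβ
  have ltα : ∀ (l : Fin (r + 3)) (j : ℕ), (l : ℕ) < cA j → α l < j := by
    intro l j hl
    by_contra! hle
    have : cA j ≤ cA (α l) := Nat.count_monotone _ hle
    have := cα l
    omega
  have ltβ : ∀ (l : Fin (r + 3)) (j : ℕ), (l : ℕ) < cB j → β l < j := by
    intro l j hl
    by_contra! hle
    have : cB j ≤ cB (β l) := Nat.count_monotone _ hle
    have := cβ l
    omega
  have hβα : ∀ l, β l < α l := by
    intro l
    refine ltβ l _ ?_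
    have h1 := hH (α l)
    have h2 := cα l
    have h3 := (bα l).2
    omega
  -- the first three steps up start at height zero
  have hβ0 : ∀ l : Fin (r + 3), (l : ℕ) ≤ 2 → cA (β l) = l := by
    intro l hl
    have h1 := cβ l
    have h2 := hEB (β l)
    have h3 := hEB' (β l) (bβ l).1.le (by omega)
    have h4 := hEB' (β l + 1) (bβ l).1
    have h5 := hB (β l)
    have h6 := boxIndex_succ H (β l)
    have h7 := hH (β l)
    rw [if_pos (bβ l).2] at h5
    split_ifs at h6 with h8 <;> omega
  have e0 : ((0 : Fin (r + 3)) : ℕ) = 0 := rfl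
  have e1 : ((1 : Fin (r + 3)) : ℕ) = 1 := rfl
  have e2 : ((2 : Fin (r + 3)) : ℕ) = 2 := rfl
  refine ⟨r, α, β, iα, iβ, mα, mβ, hβα 0, ltα 0 _ ?_, hβα 1, ltα 1 _ ?_, ?_⟩
  · rw [hβ0 1 (by omega)]; omega
  · rw [hβ0 2 (by omega)]; omega
  by_contra! hle
  obtain ⟨v, hv⟩ : ∃ v, v = β (Fin.last (r + 2)) := ⟨_, rfl⟩
  have hvB := bβ (Fin.last (r + 2))
  have haA := bα 2
  rw [← hv] at hle hvB
  have hne : α 2 ≠ v := by rintro h; rw [h] at haA; omega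
  have hvn : v + 1 < n := by
    rcases Nat.lt_or_ge (v + 1) n with h | h
    · exact h
    · obtain rfl : v + 1 = n := by omega
      omega
  have hEa : 3 ≤ boxIndex H (α 2) := by
    by_contra! hlt
    have h1 := hEB' (α 2) haA.1.le (by omega)
    have h2 := hH (α 2)
    have h3 := cα 2
    omega
  have hpos : ∀ u, α 2 ≤ u → u ≤ v + 1 → H u ≠ 0 := by
    intro u h1 h2 h3
    have h4 := boxIndex_lt h2 h3 (by omega)
    have h5 := boxIndex_mono H h1
    have h6 := boxIndex_mono H hvn.le
    omega
  obtain ⟨m, hm, hmin⟩ := Finset.exists_min_image (Finset.Icc (α 2 + 1) v) H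
    ⟨v, Finset.mem_Icc.2 ⟨by omega, le_rfl⟩⟩
  rw [Finset.mem_Icc] at hm
  have h1 := hmin (α 2 + 1) (Finset.mem_Icc.2 ⟨le_rfl, by omega⟩)
  have h2 := hmin v (Finset.mem_Icc.2 ⟨by omega, le_rfl⟩)
  exact hvalley (α 2) m (v + 1) (by omega) (by omega) hvn hpos (by omega) (by omega)

end Walks

/-! ### Uniqueness forces interlacing -/

section Rigid

variable {k n : ℕ} {I J : KSubset k n} {h : ZMod n → ℕ}

/-- The gap function read as a walk on `ℕ`, starting from the vertex `p`. -/
def unroll (h : ZMod n → ℕ) (p : ZMod n) (j : ℕ) : ℕ := h (p + j)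

theorem unroll_zero (h : ZMod n → ℕ) (p : ZMod n) : unroll h p 0 = h p := by simp [unroll]

theorem unroll_card (h : ZMod n → ℕ) (p : ZMod n) : unroll h p n = h p := by simp [unroll]

theorem unroll_val_sub [NeZero n] (h : ZMod n → ℕ) (p l : ZMod n) : unroll h p (l - p).val = h l := by
  rw [unroll, ZMod.natCast_zmod_val, add_sub_cancel]

theorem add_natCast_sub_val (p : ZMod n) {j : ℕ} (hj : j < n) : (p + (j : ZMod n) - p).val = j := by
  rw [add_sub_cancel_left, ZMod.val_natCast_of_lt hj]

theorem add_natCast_succ_sub_one (p : ZMod n) (j : ℕ) :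
    p + ((j + 1 : ℕ) : ZMod n) - 1 = p + j := by
  push_cast; ring

theorem unroll_succ_le (hg : IsGap I J h) (p : ZMod n) (j : ℕ) :
    unroll h p (j + 1) ≤ unroll h p j + 1 := by
  have := hg.le_succ (p + ((j + 1 : ℕ) : ZMod n))
  rwa [add_natCast_succ_sub_one] at this

theorem unroll_le_succ (hg : IsGap I J h) (p : ZMod n) (j : ℕ) :
    unroll h p j ≤ unroll h p (j + 1) + 1 := by
  have := hg.le_succ' (p + ((j + 1 : ℕ) : ZMod n))
  rwa [add_natCast_succ_sub_one] at this

variable [NeZero n]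

theorem IsGap.numBoxes_eq_boxIndex (hg : IsGap I J h) {p : ZMod n} (hp : h p = 0) :
    numBoxes I J = boxIndex (unroll h p) n := by
  rw [hg.numBoxes_eq hp, boxIndex, Nat.count_eq_card_filter_range]
  refine Finset.card_bij' (fun v _ => (v - p).val) (fun j _ => p + (j : ZMod n)) ?_ ?_ ?_ ?_
  · intro v hv
    have hv' := (Finset.mem_filter.1 hv).2
    refine Finset.mem_filter.2 ⟨Finset.mem_range.2 (ZMod.val_lt _), ?_⟩
    rw [unroll_val_sub]
    have h1 : unroll h p ((v - p).val + 1) = h (v + 1) := by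
      unfold unroll
      congr 1
      push_cast
      rw [ZMod.natCast_zmod_val]; ring
    rwa [h1]
  · intro j hj
    have hj' := (Finset.mem_filter.1 hj).2
    refine Finset.mem_filter.2 ⟨Finset.mem_univ _, hj'.1, ?_⟩
    have h1 : p + (j : ZMod n) + 1 = p + ((j + 1 : ℕ) : ZMod n) := by push_cast; ring
    rw [h1]
    exact hj'.2
  · intro v _
    simp
  · intro j hj
    exact add_natCast_sub_val p (Finset.mem_range.1 (Finset.mem_filter.1 hj).1)

theorem compat_unroll {p : ZMod n} (hp : h p = 0) (σ : ℕ → ℂ⟦X⟧)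
    (hσ : ∀ j, unroll h p j ≠ 0 → unroll h p (j + 1) ≠ 0 →
      PowerSeries.X ^ min (unroll h p (j + 1)) (unroll h p j) ∣ σ (j + 1) - σ j) :
    Compat h fun l => σ (l - p).val := by
  intro l
  dsimp only
  by_cases h0 : h l = 0
  · rw [h0]; simp
  by_cases h1 : h (l - 1) = 0
  · rw [h1]; simp
  have hl : l ≠ p := by rintro rfl; exact h0 hp
  have hval : (l - p).val = (l - 1 - p).val + 1 := by
    have e1 : l - p = (l - 1 - p) + 1 := by ring
    have h2 : (l - 1 - p).val + 1 < n := by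
      have := ZMod.val_lt (l - 1 - p)
      refine lt_of_le_of_ne this fun h3 => hl ?_
      have h4 : ((l - p : ZMod n)) = (((l - 1 - p).val + 1 : ℕ) : ZMod n) := by
        push_cast; rw [ZMod.natCast_zmod_val]; ring
      rw [h3, ZMod.natCast_self, sub_eq_zero] at h4
      exact h4
    rw [e1, val_add_one h2]
  have := hσ (l - 1 - p).val
  rw [← hval, unroll_val_sub, unroll_val_sub] at this
  exact this h1 h0

/-- The chain of lattices whose walk leaves in the direction `φ c` in the `c`-th box. -/
theorem compat_boxIndex {p : ZMod n} (hp : h p = 0) (φ : ℕ → ℂ⟦X⟧) :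
    Compat h fun l => φ (boxIndex (unroll h p) (l - p).val) := by
  refine compat_unroll hp (fun j => φ (boxIndex (unroll h p) j)) fun j h1 h2 => ?_
  rw [boxIndex_succ, if_neg (fun h3 => h1 h3.1), add_zero, sub_self]
  exact dvd_zero _

/-- All indecomposable lattice chains with the given gap function are isomorphic. -/
def IsRigid (hg : IsGap I J h) : Prop :=
  ∀ (s s' : ZMod n → ℂ⟦X⟧) (hs : Compat h s) (hs' : Compat h s'),
    IsIndecomposable k n (lat hg hs) → IsIndecomposable k n (lat hg hs') →
      Nonempty (lat hg hs ≃ₗ[B k n] lat hg hs')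

variable {hg : IsGap I J h}

theorem IsRigid.dvd_sub (hU : IsRigid hg) {p : ZMod n} (hp : h p = 0) {s s' : ZMod n → ℂ⟦X⟧}
    (hs : Compat h s) (hs' : Compat h s') (hind : IsIndecomposable k n (lat hg hs))
    (hind' : IsIndecomposable k n (lat hg hs')) {i j : ZMod n} {m : ℕ} (hi : m ≤ h i)
    (hj : m ≤ h j) (hij : PowerSeries.X ^ m ∣ s i - s j) : PowerSeries.X ^ m ∣ s' i - s' j := by
  obtain ⟨φ⟩ := hU s s' hs hs' hind hind'
  exact dvd_sub_of_latEquiv hg hs hs' hp φ hi hj hij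

/-- With four boxes, the directions of two of them may or may not coincide in an indecomposable
chain. -/
theorem IsRigid.boxIndex_le (hU : IsRigid hg) {p : ZMod n} (hp : h p = 0) :
    boxIndex (unroll h p) n ≤ 3 := by
  by_contra! hlt
  have hn : unroll h p n = 0 := by rw [unroll_card, hp]
  obtain ⟨j₁, l₁, n₁, b₁⟩ := exists_boxIndex_eq hn (c := 0) (by omega)
  obtain ⟨j₂, l₂, n₂, b₂⟩ := exists_boxIndex_eq hn (c := 1) (by omega)
  obtain ⟨j₃, l₃, n₃, b₃⟩ := exists_boxIndex_eq hn (c := 2) (by omega)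
  obtain ⟨j₄, l₄, n₄, b₄⟩ := exists_boxIndex_eq hn (c := 3) (by omega)
  have e : ∀ {j c : ℕ}, j < n → boxIndex (unroll h p) j = c →
      boxIndex (unroll h p) (p + (j : ZMod n) - p).val = c := fun hj hc => by
    rw [add_natCast_sub_val p hj, hc]
  let φ : ℕ → ℂ⟦X⟧ := fun c => if c ≤ 2 then 0 else if c = 3 then 1 else -1
  let φ' : ℕ → ℂ⟦X⟧ := fun c => if c ≤ 1 then 0 else if c ≤ 3 then 1 else -1
  have hind : IsIndecomposable k n (lat hg (compat_boxIndex hp φ)) := by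
    refine isIndecomposable_lat_of_three hg _ hp (q₁ := p + j₁) (q₂ := p + j₃) (q₃ := p + j₄)
      n₁ n₃ n₄ ?_ ?_ ?_ <;> simp only [e l₁ b₁, e l₃ b₃, e l₄ b₄] <;> norm_num [φ]
  have hind' : IsIndecomposable k n (lat hg (compat_boxIndex hp φ')) := by
    refine isIndecomposable_lat_of_three hg _ hp (q₁ := p + j₁) (q₂ := p + j₂) (q₃ := p + j₄)
      n₁ n₂ n₄ ?_ ?_ ?_ <;> simp only [e l₁ b₁, e l₂ b₂, e l₄ b₄] <;> norm_num [φ']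
  have := hU.dvd_sub hp _ _ hind hind' (i := p + j₁) (j := p + j₂) (m := 1)
    (Nat.one_le_iff_ne_zero.2 n₁) (Nat.one_le_iff_ne_zero.2 n₂) (by
      simp only [e l₁ b₁, e l₂ b₂]; norm_num [φ])
  simp only [e l₁ b₁, e l₂ b₂] at this
  rw [pow_one, PowerSeries.X_dvd_iff] at this
  norm_num [φ'] at this

/-- The directions `0`, `1`, `-1` of the three legs of the standard tripod. -/
noncomputable def legDirection (c : ℕ) : ℂ⟦X⟧ := if c ≤ 1 then 0 else if c = 2 then 1 else -1

theorem isIndecomposable_tripod (hg : IsGap I J h) {p : ZMod n} (hp : h p = 0)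
    {s : ZMod n → ℂ⟦X⟧} (hs : Compat h s) (hE : 3 ≤ boxIndex (unroll h p) n)
    (hsp : ∀ j, j < n → unroll h p j ≠ 0 → PowerSeries.constantCoeff (s (p + j)) =
      PowerSeries.constantCoeff (legDirection (boxIndex (unroll h p) j))) :
    IsIndecomposable k n (lat hg hs) := by
  have hn : unroll h p n = 0 := by rw [unroll_card, hp]
  obtain ⟨j₁, l₁, n₁, b₁⟩ := exists_boxIndex_eq hn (c := 0) (by omega)
  obtain ⟨j₂, l₂, n₂, b₂⟩ := exists_boxIndex_eq hn (c := 1) (by omega)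
  obtain ⟨j₃, l₃, n₃, b₃⟩ := exists_boxIndex_eq hn (c := 2) (by omega)
  refine isIndecomposable_lat_of_three hg hs hp (q₁ := p + j₁) (q₂ := p + j₂) (q₃ := p + j₃)
    n₁ n₂ n₃ ?_ ?_ ?_
  · rw [hsp _ l₁ n₁, hsp _ l₂ n₂, b₁, b₂]; norm_num [legDirection]
  · rw [hsp _ l₁ n₁, hsp _ l₃ n₃, b₁, b₃]; norm_num [legDirection]
  · rw [hsp _ l₂ n₂, hsp _ l₃ n₃, b₂, b₃]; norm_num [legDirection]

/-- From a valley in a box, the walk may go up by the edge through which it came down, or by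
another one. -/
theorem IsRigid.not_valley (hU : IsRigid hg) {p : ZMod n} (hp : h p = 0)
    (hE : 3 ≤ boxIndex (unroll h p) n) {i v j : ℕ} (hiv : i < v) (hvj : v < j) (hj : j < n)
    (hpos : ∀ u, i ≤ u → u ≤ j → unroll h p u ≠ 0) (hi : unroll h p v < unroll h p i) :
    ¬ unroll h p v < unroll h p j := by
  intro hj'
  let τ : ℕ → ℂ⟦X⟧ := fun u => if v < u then PowerSeries.X ^ unroll h p v else 0
  let σ : ℕ → ℂ⟦X⟧ := fun u => legDirection (boxIndex (unroll h p) u) + τ u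
  have hσ : Compat h fun l => σ (l - p).val := by
    refine compat_unroll hp σ fun u h1 h2 => ?_
    have h3 : σ (u + 1) - σ u = τ (u + 1) - τ u := by
      simp only [σ]
      rw [boxIndex_succ, if_neg (fun h3 => h1 h3.1), add_zero, add_sub_add_left_eq_sub]
    rw [h3]
    simp only [τ]
    rcases lt_trichotomy v u with h4 | h4 | h4
    · rw [if_pos h4, if_pos (by omega), sub_self]; exact dvd_zero _
    · rw [if_pos (by omega), if_neg (by omega), sub_zero, h4]
      exact pow_dvd_pow _ (min_le_right _ _)
    · rw [if_neg (by omega), if_neg (by omega), sub_zero]; exact dvd_zero _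
  have hv0 : unroll h p v ≠ 0 := hpos v hiv.le hvj.le
  have hind := isIndecomposable_tripod hg hp (compat_boxIndex hp legDirection) hE
    fun u hu _ => by rw [add_natCast_sub_val p hu]
  have hind' := isIndecomposable_tripod hg hp hσ hE fun u hu _ => by
    rw [add_natCast_sub_val p hu]
    simp only [σ, τ]
    split_ifs <;> simp [hv0]
  have hb : boxIndex (unroll h p) j = boxIndex (unroll h p) i :=
    boxIndex_eq_of_pos (by omega) fun u h1 h2 => hpos u h1 h2.le
  have h1 := hU.dvd_sub hp _ _ hind hind' (i := p + i) (j := p + j) (m := unroll h p v + 1) hi hj'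
    (by
      rw [add_natCast_sub_val p hj, add_natCast_sub_val p (by omega), hb, sub_self]
      exact dvd_zero _)
  rw [add_natCast_sub_val p hj, add_natCast_sub_val p (by omega)] at h1
  simp only [σ, τ] at h1
  rw [hb, if_neg (by omega), if_pos hvj, add_sub_add_left_eq_sub, zero_sub, dvd_neg,
    X_pow_dvd_X_pow_iff] at h1
  omega

/-- Two boxes of height at least two may or may not share their first edge in the tree. -/
theorem IsRigid.not_two_high (hU : IsRigid hg) {p : ZMod n} (hp : h p = 0)
    (hE : 3 ≤ boxIndex (unroll h p) n) {i j : ℕ} (hi : i < n) (hj : j < n)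
    (hij : boxIndex (unroll h p) i < boxIndex (unroll h p) j) (hi2 : 2 ≤ unroll h p i)
    (hj2 : 2 ≤ unroll h p j) (hEj : boxIndex (unroll h p) j ≤ 3) : False := by
  have hn : unroll h p n = 0 := by rw [unroll_card, hp]
  have hi0 : 0 < boxIndex (unroll h p) i :=
    lt_of_le_of_lt (Nat.zero_le _) (boxIndex_lt (Nat.zero_le i) (by rw [unroll_zero, hp]) (by omega))
  -- the third box
  obtain ⟨c, hc, hci, hcj⟩ : ∃ c < 3, c + 1 ≠ boxIndex (unroll h p) i ∧
      c + 1 ≠ boxIndex (unroll h p) j := by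
    by_contra! hne
    have h0 := hne 0 (by omega)
    have h1 := hne 1 (by omega)
    have h2 := hne 2 (by omega)
    omega
  obtain ⟨q, lq, nq, bq⟩ := exists_boxIndex_eq hn (c := c) (by omega)
  let φ : ℕ → ℂ⟦X⟧ := fun d => if d = boxIndex (unroll h p) i then 0 else
    if d = boxIndex (unroll h p) j then PowerSeries.X else 1
  have hφi : φ (boxIndex (unroll h p) i) = 0 := if_pos rfl
  have hφj : φ (boxIndex (unroll h p) j) = PowerSeries.X := by
    simp only [φ]; rw [if_neg (by omega)]; simp
  have hφq : φ (boxIndex (unroll h p) q) = 1 := by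
    simp only [φ]; rw [bq, if_neg hci, if_neg hcj]
  have hind := isIndecomposable_lat_of_branch hg (compat_boxIndex hp φ) hp (q₁ := p + i)
    (q₂ := p + j) (q₃ := p + q) hi2 hj2 nq (by rw [add_natCast_sub_val p hi, hφi])
    (by rw [add_natCast_sub_val p hj, hφj]) (by rw [add_natCast_sub_val p lq, hφq])
  have hind' := isIndecomposable_tripod hg hp (compat_boxIndex hp legDirection) hE
    fun u hu _ => by rw [add_natCast_sub_val p hu]
  have h1 := hU.dvd_sub hp _ _ hind hind' (i := p + i) (j := p + j) (m := 1)
    (le_trans (by omega) hi2) (le_trans (by omega) hj2)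
    (by rw [add_natCast_sub_val p hi, add_natCast_sub_val p hj, hφi, hφj]; simp)
  rw [add_natCast_sub_val p hi, add_natCast_sub_val p hj, pow_one, PowerSeries.X_dvd_iff] at h1
  obtain ⟨h2, h3⟩ | ⟨h2, h3⟩ | ⟨h2, h3⟩ :
      (boxIndex (unroll h p) i = 1 ∧ boxIndex (unroll h p) j = 2) ∨
      (boxIndex (unroll h p) i = 1 ∧ boxIndex (unroll h p) j = 3) ∨
      (boxIndex (unroll h p) i = 2 ∧ boxIndex (unroll h p) j = 3) := by omega
  all_goals
    rw [h2, h3] at h1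
    norm_num [legDirection, map_ofNat] at h1

/-- The walk can be started so that its highest point lies in the last box. -/
theorem exists_highest_last {p : ZMod n} (hp : h p = 0) (hne : ∃ q, h q ≠ 0) :
    ∃ p, h p = 0 ∧ ∃ j, j < n ∧ (∀ l, h l ≤ unroll h p j) ∧
      boxIndex (unroll h p) j = boxIndex (unroll h p) n := by
  obtain ⟨q, hq⟩ := Finite.exists_max h
  have hq0 : h q ≠ 0 := by
    obtain ⟨q', hq'⟩ := hne
    have := hq q'
    omega
  have hex : ∃ d : ℕ, h (q + d) = 0 := ⟨(p - q).val, by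
    rw [ZMod.natCast_zmod_val, add_sub_cancel, hp]⟩
  classical
  obtain ⟨d, hd, hmin⟩ : ∃ d : ℕ, h (q + d) = 0 ∧ ∀ d' < d, h (q + (d' : ZMod n)) ≠ 0 :=
    ⟨Nat.find hex, Nat.find_spec hex, fun d' => Nat.find_min hex⟩
  have hd0 : 0 < d := by
    rcases Nat.eq_zero_or_pos d with rfl | h1
    · simp [hq0] at hd
    · exact h1
  have hdn : d ≤ n := by
    by_contra! hlt
    have := hmin (p - q).val ((ZMod.val_lt _).trans hlt)
    rw [ZMod.natCast_zmod_val, add_sub_cancel] at this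
    exact this hp
  have hu : ∀ u, unroll h (q + d) (n - d + u) = h (q + u) := by
    intro u
    unfold unroll
    congr 1
    push_cast [Nat.cast_sub hdn]
    simp
  -- From the highest point, the walk goes to `p` without visiting height zero in between.
  refine ⟨q + d, hd, n - d, by omega, fun l => ?_, ?_⟩
  · have := hu 0
    rw [add_zero] at this
    rw [this]
    simpa using hq l
  · refine (boxIndex_eq_of_pos (by omega) fun u h1 h2 => ?_).symm
    obtain ⟨e, rfl⟩ := Nat.exists_eq_add_of_le h1
    rw [hu]
    exact hmin e (by omega)

/-- The edge `l` is the one numbered by `(l - (p + 1)).val` on the walk from `p`. -/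
theorem unroll_edge (h : ZMod n → ℕ) (p l : ZMod n) :
    unroll h p (l - (p + 1)).val = h (l - 1) ∧ unroll h p ((l - (p + 1)).val + 1) = h l := by
  constructor <;> unfold unroll <;> congr 1 <;> push_cast <;> rw [ZMod.natCast_zmod_val] <;> ring

/-- Uniqueness forces three boxes, two of them of height one and the third one without valleys. -/
theorem IsRigid.interlacing (hU : IsRigid hg) {p₀ : ZMod n} (hp₀ : h p₀ = 0)
    (h3 : 3 ≤ numBoxes I J) : numBoxes I J = 3 ∧ AlmostTightlyThreeInterlacing I J := by
  have hne : ∃ q, h q ≠ 0 := by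
    by_contra! h0
    rw [hg.numBoxes_eq hp₀] at h3
    simp [h0] at h3
  obtain ⟨p, hp, q, hqn, hq, hqE⟩ := exists_highest_last hp₀ hne
  have hE : boxIndex (unroll h p) n = 3 :=
    le_antisymm (hU.boxIndex_le hp) (hg.numBoxes_eq_boxIndex hp ▸ h3)
  refine ⟨(hg.numBoxes_eq_boxIndex hp).trans hE, ?_⟩
  have hlow : ∀ j, j ≤ n → boxIndex (unroll h p) j ≤ 2 → unroll h p j ≤ 1 := by
    intro j hj hj2
    by_contra! hlt
    have hjn : j < n := by
      refine lt_of_le_of_ne hj ?_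
      rintro rfl
      rw [unroll_card, hp] at hlt
      omega
    have h1 : unroll h p j ≤ unroll h p q := hq _
    -- the highest point of the walk is in the third box
    exact hU.not_two_high hp hE.ge hjn hqn (by omega) hlt (by omega) (by omega)
  obtain ⟨r, α, β, iα, iβ, mα, mβ, c1, c2, c3, c4, c5⟩ := exists_interlacing
    (unroll_succ_le hg p) (unroll_le_succ hg p) (by rw [unroll_zero, hp]) (by rw [unroll_card, hp])
    hE hlow fun i v j hiv hvj hj => hU.not_valley hp hE.ge hiv hvj hj
  -- the edge after the vertex `p + j` is `p + 1 + j`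
  have hα : ∀ l, (p + 1 + (α l : ZMod n) - (p + 1)).val = α l := fun l =>
    add_natCast_sub_val _ ((iα _).2 ⟨l, rfl⟩).1
  have hβ : ∀ l, (p + 1 + (β l : ZMod n) - (p + 1)).val = β l := fun l =>
    add_natCast_sub_val _ ((iβ _).2 ⟨l, rfl⟩).1
  have key : ∀ (γ : Fin (r + 3) → ℕ) (l : ZMod n), (∃ i, γ i = (l - (p + 1)).val) →
      l ∈ Finset.univ.image fun i => p + 1 + (γ i : ZMod n) := by
    rintro γ l ⟨i, hi⟩
    refine Finset.mem_image.2 ⟨i, Finset.mem_univ _, ?_⟩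
    rw [hi, ZMod.natCast_zmod_val, add_sub_cancel]
  refine ⟨p + 1, r, fun l => p + 1 + (α l : ZMod n), fun l => p + 1 + (β l : ZMod n),
    Finset.Subset.antisymm (fun l hl => key α l ((iα _).1 ⟨ZMod.val_lt _, ?_⟩)) ?_,
    Finset.Subset.antisymm (fun l hl => key β l ((iβ _).1 ⟨ZMod.val_lt _, ?_⟩)) ?_, ?_⟩
  · rw [(unroll_edge h p l).1, (unroll_edge h p l).2]
    have h1 := hg l
    rw [Finset.mem_sdiff] at hl
    rw [if_pos hl.1, if_neg hl.2] at h1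
    omega
  · intro l hl
    obtain ⟨i, -, rfl⟩ := Finset.mem_image.1 hl
    have h1 := ((iα _).2 ⟨i, rfl⟩).2
    have h2 := unroll_edge h p (p + 1 + (α i : ZMod n))
    rw [hα] at h2
    rw [h2.1, h2.2] at h1
    have h3 := hg (p + 1 + (α i : ZMod n))
    rw [Finset.mem_sdiff]
    split_ifs at h3 with h4 h5 h5
    · omega
    · exact ⟨h4, h5⟩
    · omega
    · omega
  · rw [(unroll_edge h p l).1, (unroll_edge h p l).2]
    have h1 := hg l
    rw [Finset.mem_sdiff] at hl
    rw [if_pos hl.1, if_neg hl.2] at h1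
    omega
  · intro l hl
    obtain ⟨i, -, rfl⟩ := Finset.mem_image.1 hl
    have h1 := ((iβ _).2 ⟨i, rfl⟩).2
    have h2 := unroll_edge h p (p + 1 + (β i : ZMod n))
    rw [hβ] at h2
    rw [h2.1, h2.2] at h1
    have h3 := hg (p + 1 + (β i : ZMod n))
    rw [Finset.mem_sdiff]
    split_ifs at h3 with h4 h5 h5
    · omega
    · omega
    · exact ⟨h5, h4⟩
    · omega
  · simp only [hα, hβ]
    exact ⟨mα, mβ, c1, c2, c3, c4, c5⟩

end Rigid

/-! ### Interlacing gives tripods -/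

section Tripod

variable {k n : ℕ} {I J : KSubset k n} {h : ZMod n → ℕ}

theorem Compat.dvd_unroll {s : ZMod n → ℂ⟦X⟧} (hs : Compat h s) (p : ZMod n) {x y m : ℕ}
    (hxy : x ≤ y) (hm : ∀ u, x ≤ u → u ≤ y → m ≤ unroll h p u) :
    PowerSeries.X ^ m ∣ s (p + y) - s (p + x) := by
  induction y, hxy using Nat.le_induction with
  | base => rw [sub_self]; exact dvd_zero _
  | succ y hy ih =>
    have h1 := hs (p + ((y + 1 : ℕ) : ZMod n))
    rw [add_natCast_succ_sub_one] at h1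
    have h2 : m ≤ min (h (p + ((y + 1 : ℕ) : ZMod n))) (h (p + y)) :=
      le_min (hm (y + 1) (by omega) le_rfl) (hm y hy (by omega))
    have h3 := dvd_add ((pow_dvd_pow _ h2).trans h1) (ih fun u h4 h5 => hm u h4 (by omega))
    rwa [sub_add_sub_cancel] at h3

theorem le_of_forall_le_succ {H : ℕ → ℕ} {x y : ℕ} (hxy : x ≤ y)
    (hH : ∀ j, x ≤ j → j < y → H j ≤ H (j + 1)) : H x ≤ H y := by
  induction y, hxy using Nat.le_induction with
  | base => rfl
  | succ y hy ih => exact (ih fun j h1 h2 => hH j h1 (by omega)).trans (hH y hy (by omega))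

theorem le_of_forall_succ_le {H : ℕ → ℕ} {x y : ℕ} (hxy : x ≤ y)
    (hH : ∀ j, x ≤ j → j < y → H (j + 1) ≤ H j) : H y ≤ H x := by
  induction y, hxy using Nat.le_induction with
  | base => rfl
  | succ y hy ih => exact (hH y hy (by omega)).trans (ih fun j h1 h2 => hH j h1 (by omega))

variable [NeZero n]

/-- In the interlacing pattern the walk makes two excursions of height one and then goes up to its
highest point and back. -/
theorem AlmostTightlyThreeInterlacing.exists_isTripod (hIJ : AlmostTightlyThreeInterlacing I J)
    (hg : IsGap I J h) {p₀ : ZMod n} (hp₀ : h p₀ = 0) : ∃ q₁ q₂ q₃, IsTripod h q₁ q₂ q₃ := by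
  obtain ⟨s₀, r, a, b, ha, hb, ma, mb, c1, c2, c3, c4, c5⟩ := hIJ
  obtain ⟨p, rfl⟩ : ∃ p, s₀ = p + 1 := ⟨s₀ - 1, by ring⟩
  obtain ⟨α, hα⟩ : ∃ α : Fin (r + 3) → ℕ, α = fun l => (a l - (p + 1)).val := ⟨_, rfl⟩
  obtain ⟨β, hβ⟩ : ∃ β : Fin (r + 3) → ℕ, β = fun l => (b l - (p + 1)).val := ⟨_, rfl⟩
  obtain ⟨H, hH⟩ : ∃ H, H = unroll h p := ⟨_, rfl⟩
  have eα : ∀ l, (a l - (p + 1)).val = α l := fun l => by rw [hα]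
  have eβ : ∀ l, (b l - (p + 1)).val = β l := fun l => by rw [hβ]
  rw [← hα] at ma
  rw [← hβ] at mb
  simp only [eα, eβ] at c1 c2 c3 c4 c5
  have hup : ∀ l, H (β l + 1) = H (β l) + 1 := by
    intro l
    have h1 : b l ∈ J.1 \ I.1 := hb ▸ Finset.mem_image_of_mem b (Finset.mem_univ l)
    have h2 := hg (b l)
    rw [Finset.mem_sdiff] at h1
    rw [if_pos h1.1, if_neg h1.2] at h2
    rw [← eβ, hH, (unroll_edge h p _).1, (unroll_edge h p _).2]
    exact h2
  have hdown : ∀ l, H (α l + 1) + 1 = H (α l) := by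
    intro l
    have h1 : a l ∈ I.1 \ J.1 := ha ▸ Finset.mem_image_of_mem a (Finset.mem_univ l)
    have h2 := hg (a l)
    rw [Finset.mem_sdiff] at h1
    rw [if_pos h1.1, if_neg h1.2] at h2
    rw [← eα, hH, (unroll_edge h p _).1, (unroll_edge h p _).2]
    exact h2
  have hedge : ∀ j, j < n → ∃ l : ZMod n, (l - (p + 1)).val = j ∧ H j = h (l - 1) ∧
      H (j + 1) = h l := by
    intro j hj
    have h1 := add_natCast_sub_val (p + 1) hj
    have h2 := unroll_edge h p (p + 1 + (j : ZMod n))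
    rw [h1] at h2
    exact ⟨p + 1 + j, h1, by rw [hH]; exact h2.1, by rw [hH]; exact h2.2⟩
  have hup' : ∀ j, j < n → (∀ l, β l ≠ j) → H (j + 1) ≤ H j := by
    intro j hj hne
    obtain ⟨l, h1, h2, h3⟩ := hedge j hj
    have h4 := hg l
    have h5 : ¬ (l ∈ J.1 ∧ l ∉ I.1) := by
      rw [← Finset.mem_sdiff, hb]
      intro h6
      obtain ⟨i, -, rfl⟩ := Finset.mem_image.1 h6
      exact hne i (by rw [← eβ, h1])
    rw [h2, h3]
    split_ifs at h4 with h6 h7 h7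
    · omega
    · omega
    · exact absurd ⟨h7, h6⟩ h5
    · omega
  have hdown' : ∀ j, j < n → (∀ l, α l ≠ j) → H j ≤ H (j + 1) := by
    intro j hj hne
    obtain ⟨l, h1, h2, h3⟩ := hedge j hj
    have h4 := hg l
    have h5 : ¬ (l ∈ I.1 ∧ l ∉ J.1) := by
      rw [← Finset.mem_sdiff, ha]
      intro h6
      obtain ⟨i, -, rfl⟩ := Finset.mem_image.1 h6
      exact hne i (by rw [← eα, h1])
    rw [h2, h3]
    split_ifs at h4 with h6 h7 h7
    · omega
    · exact absurd ⟨h6, h7⟩ h5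
    · omega
    · omega
  have cases : ∀ l : Fin (r + 3), l = 0 ∨ l = 1 ∨ 2 ≤ l := by
    intro l
    have e0 : ((0 : Fin (r + 3)) : ℕ) = 0 := rfl
    have e1 : ((1 : Fin (r + 3)) : ℕ) = 1 := rfl
    have e2 : ((2 : Fin (r + 3)) : ℕ) = 2 := rfl
    rw [Fin.ext_iff, Fin.ext_iff, Fin.le_def]
    omega
  have cα : ∀ l, α l = α 0 ∨ α l = α 1 ∨ α 2 ≤ α l := fun l => by
    rcases cases l with rfl | rfl | h1
    · exact Or.inl rfl
    · exact Or.inr (Or.inl rfl)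
    · exact Or.inr (Or.inr (ma.monotone h1))
  have cβ : ∀ l, β l = β 0 ∨ β l = β 1 ∨ (β 2 ≤ β l ∧ β l ≤ β (Fin.last (r + 2))) := fun l => by
    rcases cases l with rfl | rfl | h1
    · exact Or.inl rfl
    · exact Or.inr (Or.inl rfl)
    · exact Or.inr (Or.inr ⟨mb.monotone h1, mb.monotone (Fin.le_last l)⟩)
  have hmono : ∀ x y, x ≤ y → y ≤ n → (∀ l, α l < x ∨ y ≤ α l) → H x ≤ H y :=
    fun x y hxy hy hl => le_of_forall_le_succ hxy fun j h1 h2 => hdown' j (by omega) fun l h3 => by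
      have := hl l; omega
  have hanti : ∀ x y, x ≤ y → y ≤ n → (∀ l, β l < x ∨ y ≤ β l) → H y ≤ H x :=
    fun x y hxy hy hl => le_of_forall_succ_le hxy fun j h1 h2 => hup' j (by omega) fun l h3 => by
      have := hl l; omega
  have hconst : ∀ x y, x ≤ y → y ≤ n → (∀ l, α l < x ∨ y ≤ α l) → (∀ l, β l < x ∨ y ≤ β l) →
      H y = H x := fun x y hxy hy h1 h2 => le_antisymm (hanti x y hxy hy h2) (hmono x y hxy hy h1)
  have hαn : ∀ l, α l < n := fun l => by rw [← eα]; exact ZMod.val_lt _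
  have hβn : ∀ l, β l < n := fun l => by rw [← eβ]; exact ZMod.val_lt _
  have nα := hαn 1
  have nβ := hβn (Fin.last (r + 2))
  have b2 := mb.monotone (Fin.le_last 2)
  obtain ⟨z, hz⟩ : ∃ z, z = β (Fin.last (r + 2)) := ⟨_, rfl⟩
  rw [← hz] at c5 nβ b2 cβ
  have u0 := hup 0
  have u1 := hup 1
  have d0 := hdown 0
  have d1 := hdown 1
  -- The heights above the initial one: `0`, `1` from `b 0` to `a 0`, `0`, `1` from `b 1` to `a 1`,
  -- `0` up to `b 2`; then the walk goes up until `z + 1` and down afterwards.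
  have s1 : ∀ j, j ≤ β 0 → H j = H 0 := fun j hj => hconst 0 j (by omega) (by omega)
    (fun l => by have := cα l; omega) fun l => by have := cβ l; omega
  have s2 : ∀ j, β 0 < j → j ≤ α 0 → H j = H 0 + 1 := fun j hj hj' => by
    rw [hconst (β 0 + 1) j (by omega) (by omega) (fun l => by have := cα l; omega)
      fun l => by have := cβ l; omega, u0, s1 _ le_rfl]
  have s3 : ∀ j, α 0 < j → j ≤ β 1 → H j = H 0 := fun j hj hj' => by
    have h1 := hconst (α 0 + 1) j (by omega) (by omega) (fun l => by have := cα l; omega)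
      fun l => by have := cβ l; omega
    have h2 := s2 (α 0) c1 le_rfl
    omega
  have s4 : ∀ j, β 1 < j → j ≤ α 1 → H j = H 0 + 1 := fun j hj hj' => by
    rw [hconst (β 1 + 1) j (by omega) (by omega) (fun l => by have := cα l; omega)
      fun l => by have := cβ l; omega, u1, s3 _ c2 le_rfl]
  have s5 : ∀ j, α 1 < j → j ≤ β 2 → H j = H 0 := fun j hj hj' => by
    have h1 := hconst (α 1 + 1) j (by omega) (by omega) (fun l => by have := cα l; omega)
      fun l => by have := cβ l; omega
    have h2 := s4 (α 1) c3 le_rfl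
    omega
  have s6 : ∀ x y, β 2 ≤ x → x ≤ y → y ≤ z + 1 → H x ≤ H y := fun x y h1 h2 h3 =>
    hmono x y h2 (by omega) fun l => by have := cα l; omega
  have s7 : ∀ x y, z < x → x ≤ y → y ≤ n → H y ≤ H x := fun x y h1 h2 h3 =>
    hanti x y h2 h3 fun l => by have := cβ l; omega
  have hHn : H n = H 0 := by rw [hH, unroll_card, unroll_zero]
  -- the walk starts at its lowest height
  have hmin : ∀ j, j ≤ n → H 0 ≤ H j := by
    intro j hj
    by_cases h1 : j ≤ β 2
    · have e1 := s1 j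
      have e2 := s2 j
      have e3 := s3 j
      have e4 := s4 j
      have e5 := s5 j
      omega
    · by_cases h2 : j ≤ z + 1
      · have e5 := s5 (β 2) c4 le_rfl
        have e6 := s6 (β 2) j le_rfl (by omega) h2
        omega
      · have e7 := s7 j n (by omega) hj le_rfl
        omega
  have hH0 : H 0 = 0 := by
    have h1 := hmin (p₀ - p).val (ZMod.val_lt _).le
    rw [hH, unroll_val_sub, hp₀, ← hH] at h1
    omega
  refine ⟨p + ((β 0 + 1 : ℕ) : ZMod n), p + ((β 1 + 1 : ℕ) : ZMod n), p + ((z + 1 : ℕ) : ZMod n),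
    fun i => ?_⟩
  obtain ⟨j, hj⟩ : ∃ j, j = (i - p).val := ⟨_, rfl⟩
  have hjn : j < n := hj ▸ ZMod.val_lt _
  have hi : i = p + (j : ZMod n) := by rw [hj, ZMod.natCast_zmod_val, add_sub_cancel]
  have hHj : h i = H j := by rw [hi, hH]; rfl
  have chain : ∀ {s : ZMod n → ℂ⟦X⟧}, Compat h s → ∀ {x y m : ℕ}, x ≤ y →
      (∀ u, x ≤ u → u ≤ y → m ≤ H u) → PowerSeries.X ^ m ∣ s (p + y) - s (p + x) :=
    fun hs _ _ _ hxy hm => hs.dvd_unroll p hxy (hH ▸ hm)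
  rw [hHj]
  by_cases j1 : j ≤ β 0
  · exact Or.inl ((s1 j j1).trans hH0)
  by_cases j2 : j ≤ α 0
  · refine Or.inr (Or.inl ⟨by rw [s2 j (by omega) j2, hH0], fun s hs => ?_⟩)
    have h1 := chain hs (x := β 0 + 1) (y := j) (m := 1) (by omega) fun u h1 h2 => by
      rw [s2 u (by omega) (by omega)]; omega
    rwa [← hi, pow_one] at h1
  by_cases j3 : j ≤ β 1
  · exact Or.inl ((s3 j (by omega) j3).trans hH0)
  by_cases j4 : j ≤ α 1
  · refine Or.inr (Or.inr (Or.inl ⟨by rw [s4 j (by omega) j4, hH0], fun s hs => ?_⟩))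
    have h1 := chain hs (x := β 1 + 1) (y := j) (m := 1) (by omega) fun u h1 h2 => by
      rw [s4 u (by omega) (by omega)]; omega
    rwa [← hi, pow_one] at h1
  by_cases j5 : j ≤ β 2
  · exact Or.inl ((s5 j (by omega) j5).trans hH0)
  refine Or.inr (Or.inr (Or.inr fun s hs => ?_))
  by_cases j6 : j ≤ z + 1
  · have h1 := chain hs (x := j) (y := z + 1) (m := H j) j6 fun u h1 h2 =>
      s6 j u (by omega) h1 h2
    rwa [← hi, dvd_sub_comm] at h1
  · have h1 := chain hs (x := z + 1) (y := j) (m := H j) (by omega) fun u h1 h2 =>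
      s7 u j (by omega) h2 hjn.le
    rwa [← hi] at h1

end Tripod

/-! ### Uniqueness -/

section Uniqueness

variable {k n : ℕ} [NeZero n]

theorem IsCMOfRank.of_equiv {M N : Type*} [AddCommGroup M] [Module ℂ⟦X⟧ M] [Module (B k n) M]
    [IsScalarTower ℂ⟦X⟧ (B k n) M] [AddCommGroup N] [Module ℂ⟦X⟧ N] [Module (B k n) N]
    [IsScalarTower ℂ⟦X⟧ (B k n) N] {r : ℕ} (e : M ≃ₗ[B k n] N) (hM : IsCMOfRank k n M r) :
    IsCMOfRank k n N r := by
  have := hM.free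
  have := hM.finite
  let e' : M ≃ₗ[ℂ⟦X⟧] N := e.restrictScalars ℂ⟦X⟧
  refine ⟨Module.Free.of_equiv e', Module.Finite.equiv e', fun i => ?_⟩
  have h1 : component k n N i = (component k n M i).map (e' : M →ₗ[ℂ⟦X⟧] N) := by
    ext w
    constructor
    · rintro ⟨v, rfl⟩
      refine ⟨idem k n i • e.symm v, ⟨e.symm v, rfl⟩, ?_⟩
      change e (idem k n i • e.symm v) = idem k n i • v
      rw [map_smul, e.apply_symm_apply]
    · rintro ⟨_, ⟨v, rfl⟩, rfl⟩
      exact ⟨e v, (map_smul e _ _).symm⟩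
  rw [h1, LinearEquiv.finrank_map_eq, hM.rank_component]

end Uniqueness

end GrCat

open GrCat

theorem mainTheorem1 {k n : ℕ} [NeZero n] (hk : 1 ≤ k) (hkn : k < n)
    (M : Type u) [AddCommGroup M] [Module ℂ⟦X⟧ M] [Module (GrCat.B k n) M]
    [IsScalarTower ℂ⟦X⟧ (GrCat.B k n) M]
    (hM : GrCat.IsCMOfRank k n M 2) (hind : GrCat.IsIndecomposable k n M) :
    (∃ I J : GrCat.KSubset k n, GrCat.HasProfile M I J ∧ 3 ≤ GrCat.numBoxes I J) ∧
    ∀ I J : GrCat.KSubset k n, GrCat.HasProfile M I J → 3 ≤ GrCat.numBoxes I J →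
      ((∀ (N : Type u) [AddCommGroup N] [Module ℂ⟦X⟧ N] [Module (GrCat.B k n) N]
          [IsScalarTower ℂ⟦X⟧ (GrCat.B k n) N],
          GrCat.IsCMOfRank k n N 2 → GrCat.IsIndecomposable k n N → GrCat.HasProfile N I J →
            Nonempty (N ≃ₗ[GrCat.B k n] M)) ↔
        GrCat.numBoxes I J = 3 ∧ GrCat.AlmostTightlyThreeInterlacing I J) := by
  refine ⟨?_, fun I J hIJ h3 => ?_⟩
  · obtain ⟨I, J, hIJ⟩ := hM.exists_hasProfile hkn.le
    obtain ⟨h, p, hg, hp⟩ := exists_gap I J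
    obtain ⟨s, hs, ⟨e⟩⟩ := exists_latEquiv hg hp hIJ
    obtain ⟨I', J', h1, h2⟩ := exists_three_le_numBoxes hg hs hp (hind.of_equiv e)
    exact ⟨I', J', h1.of_equiv e.symm, h2⟩
  obtain ⟨h, p, hg, hp⟩ := exists_gap I J
  constructor
  · intro hU
    have key : ∀ (s : ZMod n → ℂ⟦X⟧) (hs : Compat h s), IsIndecomposable k n (lat hg hs) →
        Nonempty (lat hg hs ≃ₗ[B k n] M) := by
      intro s hs hl
      -- The lattice chain has to be lifted to the universe of `M`.
      let e : lat hg hs ≃ₗ[B k n] ULift.{u} (lat hg hs) := ULift.moduleEquiv.symm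
      obtain ⟨φ⟩ := hU (ULift.{u} (lat hg hs)) ((isCMOfRank_lat hg hs).of_equiv e)
        (hl.of_equiv e) ((hasProfile_lat hg hs).of_equiv e)
      exact ⟨e.trans φ⟩
    have hR : IsRigid hg := fun s s' hs hs' hl hl' => by
      obtain ⟨φ⟩ := key s hs hl
      obtain ⟨φ'⟩ := key s' hs' hl'
      exact ⟨φ.trans φ'.symm⟩
    exact hR.interlacing hp h3
  · rintro ⟨-, hI⟩ N _ _ _ _ - hN hNIJ
    obtain ⟨q₁, q₂, q₃, hT⟩ := hI.exists_isTripod hg hp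
    obtain ⟨s, hs, ⟨e⟩⟩ := exists_latEquiv hg hp hIJ
    obtain ⟨s', hs', ⟨e'⟩⟩ := exists_latEquiv hg hp hNIJ
    obtain ⟨φ⟩ := hT.nonempty_latEquiv hg hs' hs (hN.of_equiv e') (hind.of_equiv e)
    exact ⟨(e'.trans φ).trans e.symm⟩
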